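/- Let $\mathscr{T}$ be a triangulated category with shift $[1]$, and let $n\ge 1$. All subcategories are full and closed under isomorphism. **Notation.** For $\mathcal{X},\mathcal{Y}\subseteq\mathscr{T}$ put $\mathcal{X}[i]=\{X[i]\mid X\in\mathcal{X}\}$ (up to isomorphism), $\mathcal{X}^{\perp}=\{Y\mid \mathscr{T}(\mathcal{X},Y)=0\}$, ${}^{\perp}\mathcal{X}=\{Y\mid \mathscr{T}(Y,\mathcal{X})=0\}$, and let $\mathcal{X}*\mathcal{Y}$ consist of all $C$ admitting a distinguished triangle $X\to C\to Y\to X[1]$ with $X\in\mathcal{X}$, $Y\in\mathcal{Y}$. A subcategory $\mathcal{E}\subseteq\mathscr{T}$ is *extension-closed* if $0\in\mathcal{E}$ and $\mathcal{E}*\mathcal{E}\subseteq\mathcal{E}$. An additive subcategory $\mathcal{T}\subseteq\mathscr{T}$ closed under direct summands is *$n$-cluster tilting* if every object of $\mathscr{T}$ has a left and a right $\mathcal{T}$-approximation and $$\mathcal{T}=\{X\mid \mathscr{T}(X,\mathcal{T}[i])=0,\ 1\le i<n\}=\{X\mid \mathscr{T}(\mathcal{T},X[i])=0,\ 1\le i<n\}.$$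 **$n$-exangulated categories.** Let $\mathcal{C}$ be an additive category and $\mathbb{E}:\mathcal{C}^{\mathrm{op}}\times\mathcal{C}\to\mathrm{Ab}$ a biadditive functor; write $a_*\delta=\mathbb{E}(C,a)(\delta)$ and $c^*\delta=\mathbb{E}(c,A)(\delta)$. For objects $A,C$ consider complexes $X^\bullet: X^0=A\to X^1\to\cdots\to X^n\to X^{n+1}=C$, and let $[X^\bullet]$ be the class of $X^\bullet$ under homotopy equivalence by morphisms that are the identity on $A$ and on $C$ (in both directions). Let $\mathfrak{s}$ assign to every $\delta\in\mathbb{E}(C,A)$ a class $\mathfrak{s}(\delta)=[X^\bullet]$; the morphism $d_X^0:A\to X^1$ is then called an inflation, and $d_X^n:X^n\to C$ a deflation. The triplet $(\mathcal{C},\mathbb{E},\mathfrak{s})$ is *$n$-exangulated* if the following hold. - (R0) If $\mathfrak{s}(\delta)=[X^\bullet]$, $\mathfrak{s}(\rho)=[Y^\bullet]$ with $\delta\in\mathbb{E}(C,A)$, $\rho\in\mathbb{E}(D,B)$, and $a:A\to B$, $c:C\to D$ satisfy $a_*\delta=c^*\rho$, then there is a morphism of complexes $X^\bullet\to Y^\bullet$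 of the form $(a,f^1,\dots,f^n,c)$, called a lift of $(a,c)$. - (R1) If $\mathfrak{s}(\delta)=[X^\bullet]$, then the sequences $\mathcal{C}(-,A)\to\mathcal{C}(-,X^1)\to\cdots\to\mathcal{C}(-,C)\to\mathbb{E}(-,A)$ and $\mathcal{C}(C,-)\to\mathcal{C}(X^n,-)\to\cdots\to\mathcal{C}(A,-)\to\mathbb{E}(C,-)$, whose last maps are $g\mapsto g^*\delta$ and $g\mapsto g_*\delta$, are exact (at all inner terms). - (R2) $\mathfrak{s}({}_A0_0)=[A\xrightarrow{\mathrm{id}}A\to0\to\cdots\to0]$ and $\mathfrak{s}({}_00_A)=[0\to\cdots\to0\to A\xrightarrow{\mathrm{id}}A]$ for all $A$. - (EA1) Inflations are closed under composition, and so are deflations. - (EA2) For $\rho\in\mathbb{E}(D,A)$ and $c:C\to D$ with $\mathfrak{s}(c^*\rho)=[X^\bullet]$, $\mathfrak{s}(\rho)=[Y^\bullet]$, the pair $(\mathrm{id}_A,c)$ has a lift $f$ with $\mathfrak{s}((d_X^0)_*\rho)=[M_f]$, where $M_f$ is the mapping cone $X^1\to X^2\oplus Y^1\to\cdots\to X^{n+1}\oplus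 Y^n\to D$ with differentials $\begin{pmatrix}-d_X^1\\ f^1\end{pmatrix}$, $\begin{pmatrix}-d_X^{i+1}&0\\ f^{i+1}&d_Y^i\end{pmatrix}$ $(1\le i<n)$, $(f^{n+1}\ \ d_Y^n)$. - (EA2)$^{\mathrm{op}}$ For $\delta\in\mathbb{E}(C,A)$ and $a:A\to B$ with $\mathfrak{s}(\delta)=[X^\bullet]$, $\mathfrak{s}(a_*\delta)=[Y^\bullet]$, the pair $(a,\mathrm{id}_C)$ has a lift $f$ with $\mathfrak{s}((d_Y^n)^*\delta)=[N_f]$, where $N_f$ is the mapping cocone $A\to X^1\oplus Y^0\to\cdots\to X^n\oplus Y^{n-1}\to Y^n$ with differentials $\begin{pmatrix}d_X^0\\ f^0\end{pmatrix}$, $\begin{pmatrix}d_X^i&0\\ f^i&-d_Y^{i-1}\end{pmatrix}$ $(1\le i<n)$, $(f^n\ \ -d_Y^{n-1})$. A full subcategory $\mathcal{P}\subseteq\mathcal{C}$ is *extension-closed* in $(\mathcal{C},\mathbb{E},\mathfrak{s})$ if for all $A,C\in\mathcal{P}$ and $\delta\in\mathbb{E}(C,A)$ there is $X^\bullet$ with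 $\mathfrak{s}(\delta)=[X^\bullet]$ and $X^1,\dots,X^n\in\mathcal{P}$. **The structure on an $n$-cluster tilting subcategory.** Let $\mathcal{T}\subseteq\mathscr{T}$ be $n$-cluster tilting with $$\mathcal{T}[n-1]^{\perp}\subseteq\mathcal{T}[-1]^{\perp}\quad\text{and}\quad {}^{\perp}\mathcal{T}[n-1]\subseteq{}^{\perp}\mathcal{T}[-1].$$ Let $\mathrm{Ext}^n$ be the biadditive functor $\mathrm{Ext}^n(C,A)=\mathscr{T}(C,A[n])$ on $\mathcal{T}$. For $\delta\in\mathrm{Ext}^n(C,A)$, a complex $X^\bullet$ in $\mathcal{T}$ from $X^0=A$ to $X^{n+1}=C$ is called *decomposable with respect to $\delta$* if there are distinguished triangles $$M^{i-1}\xrightarrow{m^{i-1}}X^i\xrightarrow{e^i}M^i\xrightarrow{\delta_{(i)}}M^{i-1}[1]\quad(1\le i\le n)$$ in $\mathscr{T}$ with $M^0=A$, $M^n=C$, such that $d_X^0=m^0$, $d_X^i=m^i\circ e^i$ for $1\le i<n$, $d_X^n=e^n$, and $\delta=\delta_{(1)}[n-1]\circ\delta_{(2)}[n-2]\circ\cdots\circ\delta_{(n)}$.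 **Statement.** Let $\mathcal{E}\subseteq\mathscr{T}$ be extension-closed, put $\mathcal{T}'=\mathcal{E}\cap\mathcal{T}$, and assume $$\mathcal{T}'[i]*\mathcal{T}'\subseteq\mathcal{T}'*\mathcal{T}'[1]*\cdots*\mathcal{T}'[i]\quad(1\le i<n).$$ Then: 1. There is a (necessarily unique) assignment $\mathfrak{s}^n$ such that, for all $A,C\in\mathcal{T}$, $\delta\in\mathrm{Ext}^n(C,A)$ and all complexes $X^\bullet$ in $\mathcal{T}$ from $A$ to $C$, one has $\mathfrak{s}^n(\delta)=[X^\bullet]$ if and only if $X^\bullet$ is decomposable with respect to $\delta$; and $(\mathcal{T},\mathrm{Ext}^n,\mathfrak{s}^n)$ is an $n$-exangulated category. 2. $\mathcal{T}'$ is an extension-closed subcategory of $(\mathcal{T},\mathrm{Ext}^n,\mathfrak{s}^n)$. 3. $\mathcal{T}'$ has an induced $n$-exangulated structure: there is an assignment $\mathfrak{t}$ for the restriction $\mathrm{Ext}^n|_{\mathcal{T}'}$ such that $\mathfrak{t}(\delta)=[X^\bullet]$ (class taken in $\mathcal{T}'$) if and only if $\mathfrak{s}^n(\delta)=[X^\bullet]$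 (class taken in $\mathcal{T}$), for all complexes $X^\bullet$ in $\mathcal{T}'$ from $A$ to $C$ and all $\delta\in\mathrm{Ext}^n(C,A)$ with $A,C\in\mathcal{T}'$; and $(\mathcal{T}',\mathrm{Ext}^n|_{\mathcal{T}'},\mathfrak{t})$ is an $n$-exangulated category. -/

import Mathlib

open CategoryTheory CategoryTheory.Limits CategoryTheory.Pretriangulated Opposite ZeroObject

universe w v v' u u'

noncomputable section

namespace NExang

/-! ### Complexes `X⁰ ⟶ X¹ ⟶ ⋯ ⟶ Xⁿ⁺¹` with prescribed ends -/

section Complexes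

variable {𝒞 : Type u} [Category.{v} 𝒞] [Preadditive 𝒞]

/-- A complex `A ⟶ X¹ ⟶ ⋯ ⟶ Xⁿ ⟶ C`: a cochain complex concentrated in degrees `0, …, n + 1`
whose term of degree `0` is (identified with) `A` and whose term of degree `n + 1` is
(identified with) `C`. -/
structure NComplex (n : ℕ) (A C : 𝒞) where
  /-- the underlying cochain complex -/
  K : CochainComplex 𝒞 ℕ
  isZero : ∀ i, n + 1 < i → IsZero (K.X i)
  /-- the identification `X⁰ = A` -/
  left : K.X 0 ≅ A
  /-- the identification `Xⁿ⁺¹ = C` -/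
  right : K.X (n + 1) ≅ C

variable {n : ℕ}

/-- The first differential `A ⟶ X¹`. -/
def NComplex.dFirst {A C : 𝒞} (X : NComplex n A C) : A ⟶ X.K.X 1 :=
  X.left.inv ≫ X.K.d 0 1

/-- The last differential `Xⁿ ⟶ C`. -/
def NComplex.dLast {A C : 𝒞} (X : NComplex n A C) : X.K.X n ⟶ C :=
  X.K.d n (n + 1) ≫ X.right.hom

/-- The morphism of complexes `f` is of the form `(a, f¹, …, fⁿ, c)`. -/
def HasEnds {A C B D : 𝒞} {X : NComplex n A C} {Y : NComplex n B D} (f : X.K ⟶ Y.K)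
    (a : A ⟶ B) (c : C ⟶ D) : Prop :=
  f.f 0 ≫ Y.left.hom = X.left.hom ≫ a ∧ f.f (n + 1) ≫ Y.right.hom = X.right.hom ≫ c

/-- `X` and `Y` are homotopically equivalent through morphisms which are the identity at both
ends `A` and `C`. -/
def HtpyEquivalent {A C : 𝒞} (X Y : NComplex n A C) : Prop :=
  ∃ e : HomotopyEquiv X.K Y.K,
    HasEnds (X := X) (Y := Y) e.hom (𝟙 A) (𝟙 C) ∧ HasEnds (X := Y) (Y := X) e.inv (𝟙 A) (𝟙 C)

variable (n) in
/-- Homotopical equivalence is an equivalence relation on the complexes from `A` to `C`. -/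
instance htpySetoid (A C : 𝒞) : Setoid (NComplex n A C) where
  r := HtpyEquivalent
  iseqv :=
    { refl := fun X => ⟨HomotopyEquiv.refl _, by simp [HasEnds, HomotopyEquiv.refl]⟩
      symm := fun ⟨e, h₁, h₂⟩ => ⟨e.symm, h₂, h₁⟩
      trans := by
        rintro X Y Z ⟨e, ⟨h₁, h₂⟩, h₃, h₄⟩ ⟨e', ⟨h₁', h₂'⟩, h₃', h₄'⟩
        refine ⟨e.trans e', ⟨?_, ?_⟩, ?_, ?_⟩ <;> simp_all [HomotopyEquiv.trans] }

variable (n) in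
/-- The homotopic equivalence classes `[X]` of complexes from `A` to `C`. -/
abbrev HtpyClass (A C : 𝒞) := Quotient (htpySetoid n A C)

/-- The complex `A = A ⟶ 0 ⟶ ⋯ ⟶ 0`. -/
def NComplex.idLeft [HasZeroObject 𝒞] (n : ℕ) [NeZero n] (A : 𝒞) : NComplex n A (0 : 𝒞) where
  K := HomologicalComplex.double (𝟙 A) (show (ComplexShape.up ℕ).Rel 0 1 from rfl)
  isZero i hi := HomologicalComplex.isZero_double_X _ _ _ (by omega) (by omega)
  left := HomologicalComplex.doubleXIso₀ _ _
  right := (HomologicalComplex.isZero_double_X _ _ _ (by omega)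
    (by have := NeZero.ne n; omega)).iso (isZero_zero 𝒞)

/-- The complex `0 ⟶ ⋯ ⟶ 0 ⟶ A = A`. -/
def NComplex.idRight [HasZeroObject 𝒞] (n : ℕ) [NeZero n] (A : 𝒞) : NComplex n (0 : 𝒞) A where
  K := HomologicalComplex.double (𝟙 A) (show (ComplexShape.up ℕ).Rel n (n + 1) from rfl)
  isZero i hi := HomologicalComplex.isZero_double_X _ _ _ (by omega) (by omega)
  left := (HomologicalComplex.isZero_double_X _ _ _ (by have := NeZero.ne n; omega)
    (by omega)).iso (isZero_zero 𝒞)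
  right := HomologicalComplex.doubleXIso₁ _ _ (by omega)

/-- The image of a complex under an additive functor. -/
def NComplex.map {𝒟 : Type u'} [Category.{v'} 𝒟] [Preadditive 𝒟] {A C : 𝒞}
    (X : NComplex n A C) (F : 𝒞 ⥤ 𝒟) [F.Additive] : NComplex n (F.obj A) (F.obj C) where
  K := (F.mapHomologicalComplex _).obj X.K
  isZero i hi := F.map_isZero (X.isZero i hi)
  left := F.mapIso X.left
  right := F.mapIso X.right

/-- `M` is (up to isomorphism, with identified ends) the mapping cone of a morphism `f : X ⟶ Y`
which is the identity in degree `0`, that is the complex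
`X¹ ⟶ X² ⊞ Y¹ ⟶ ⋯ ⟶ Xⁿ⁺¹ ⊞ Yⁿ ⟶ D` with differentials
`(-d, f¹)`, then the matrices with rows `(-d, 0)` and `(f, d)`, and finally `(fⁿ⁺¹, d)`. -/
def IsMappingCone [HasBinaryBiproducts 𝒞] {A C D : 𝒞} {X : NComplex n A C} {Y : NComplex n A D}
    (f : X.K ⟶ Y.K) (M : NComplex n (X.K.X 1) D) : Prop :=
  ∃ e : ∀ i, 1 ≤ i → i ≤ n → (M.K.X i ≅ X.K.X (i + 1) ⊞ Y.K.X i),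
    (∀ h : 1 ≤ n, M.dFirst ≫ (e 1 le_rfl h).hom = biprod.lift (-(X.K.d 1 2)) (f.f 1)) ∧
    (∀ (i : ℕ) (h₁ : 1 ≤ i) (h₂ : i + 1 ≤ n),
      M.K.d i (i + 1) ≫ (e (i + 1) (by omega) h₂).hom =
        (e i h₁ (by omega)).hom ≫
          Biprod.ofComponents (-(X.K.d (i + 1) (i + 2))) (f.f (i + 1)) 0 (Y.K.d i (i + 1))) ∧
    (∀ h : 1 ≤ n, M.dLast =
      (e n h le_rfl).hom ≫ biprod.desc (f.f (n + 1) ≫ Y.right.hom) Y.dLast)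

/-- `N` is (up to isomorphism, with identified ends) the mapping cocone of a morphism
`f : X ⟶ Y` which is the identity in degree `n + 1`, that is the complex
`A ⟶ X¹ ⊞ Y⁰ ⟶ ⋯ ⟶ Xⁿ ⊞ Yⁿ⁻¹ ⟶ Yⁿ` with differentials
`(d, f⁰)`, then the matrices with rows `(d, 0)` and `(f, -d)`, and finally `(fⁿ, -d)`. The term
`Xⁱ ⊞ Yⁱ⁻¹` is written as `Xⁱ ⊞ Yʲ` with `j + 1 = i`. -/
def IsMappingCocone [HasBinaryBiproducts 𝒞] {A B C : 𝒞} {X : NComplex n A C}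
    {Y : NComplex n B C} (f : X.K ⟶ Y.K) (N : NComplex n A (Y.K.X n)) : Prop :=
  ∃ e : ∀ i j, j + 1 = i → i ≤ n → (N.K.X i ≅ X.K.X i ⊞ Y.K.X j),
    (∀ h : 1 ≤ n, N.dFirst ≫ (e 1 0 rfl h).hom =
      biprod.lift X.dFirst (X.left.inv ≫ f.f 0)) ∧
    (∀ (i j : ℕ) (h₁ : j + 1 = i) (h₂ : i + 1 ≤ n),
      N.K.d i (i + 1) ≫ (e (i + 1) i rfl h₂).hom =
        (e i j h₁ (by omega)).hom ≫
          Biprod.ofComponents (X.K.d i (i + 1)) (f.f i) 0 (-(Y.K.d j i))) ∧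
    (∀ (j : ℕ) (h : j + 1 = n), N.dLast =
      (e n j h le_rfl).hom ≫ biprod.desc (f.f n) (-(Y.K.d j n)))

end Complexes

/-! ### `n`-exangulated categories -/

section NExangulated

variable {𝒞 : Type u} [Category.{v} 𝒞] [Preadditive 𝒞]

/-- The group `𝔼(C, A)` of extensions. -/
abbrev Extn (𝔼 : 𝒞ᵒᵖ ⥤ 𝒞 ⥤ AddCommGrpCat.{w}) (C A : 𝒞) : Type w := (𝔼.obj (op C)).obj A

/-- The extension `a_* δ = 𝔼(C, a)(δ)`. -/
def push {𝔼 : 𝒞ᵒᵖ ⥤ 𝒞 ⥤ AddCommGrpCat.{w}} {C A B : 𝒞} (a : A ⟶ B) (δ : Extn 𝔼 C A) :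
    Extn 𝔼 C B := (𝔼.obj (op C)).map a δ

/-- The extension `c^* δ = 𝔼(c, A)(δ)`. -/
def pull {𝔼 : 𝒞ᵒᵖ ⥤ 𝒞 ⥤ AddCommGrpCat.{w}} {C D A : 𝒞} (c : C ⟶ D) (δ : Extn 𝔼 D A) :
    Extn 𝔼 C A := (𝔼.map c.op).app A δ

/-- The pair `⟨X, δ⟩` is an `n`-exangle: the sequences of functors
`𝒞(-, A) ⟶ 𝒞(-, X¹) ⟶ ⋯ ⟶ 𝒞(-, C) ⟶ 𝔼(-, A)` and
`𝒞(C, -) ⟶ 𝒞(Xⁿ, -) ⟶ ⋯ ⟶ 𝒞(A, -) ⟶ 𝔼(C, -)` are exact. -/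
structure IsNExangle {𝔼 : 𝒞ᵒᵖ ⥤ 𝒞 ⥤ AddCommGrpCat.{w}} {n : ℕ} {A C : 𝒞} (X : NComplex n A C)
    (δ : Extn 𝔼 C A) : Prop where
  exact_to : ∀ (Q : 𝒞) (i : ℕ), i + 1 ≤ n →
    Function.Exact (fun f : Q ⟶ X.K.X i => f ≫ X.K.d i (i + 1))
      (fun f : Q ⟶ X.K.X (i + 1) => f ≫ X.K.d (i + 1) (i + 2))
  exact_to_last : ∀ Q : 𝒞,
    Function.Exact (fun f : Q ⟶ X.K.X n => f ≫ X.dLast) (fun f : Q ⟶ C => pull f δ)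
  exact_from : ∀ (Q : 𝒞) (i : ℕ), i + 1 ≤ n →
    Function.Exact (fun f : X.K.X (i + 2) ⟶ Q => X.K.d (i + 1) (i + 2) ≫ f)
      (fun f : X.K.X (i + 1) ⟶ Q => X.K.d i (i + 1) ≫ f)
  exact_from_first : ∀ Q : 𝒞,
    Function.Exact (fun f : X.K.X 1 ⟶ Q => X.dFirst ≫ f) (fun f : A ⟶ Q => push f δ)

/-- A correspondence `𝔰` which associates a homotopic equivalence class `𝔰 δ = [X]` of complexes
from `A` to `C` to each extension `δ ∈ 𝔼(C, A)`. -/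
abbrev Correspondence (𝔼 : 𝒞ᵒᵖ ⥤ 𝒞 ⥤ AddCommGrpCat.{w}) (n : ℕ) :=
  ∀ ⦃A C : 𝒞⦄, Extn 𝔼 C A → HtpyClass n A C

variable {𝔼 : 𝒞ᵒᵖ ⥤ 𝒞 ⥤ AddCommGrpCat.{w}} {n : ℕ}

/-- `𝔰 δ = [X]`. -/
def Realizes (𝔰 : Correspondence 𝔼 n) {A C : 𝒞} (X : NComplex n A C) (δ : Extn 𝔼 C A) : Prop :=
  𝔰 δ = Quotient.mk (htpySetoid n A C) X

/-- `f : A ⟶ B` is the first differential of a conflation. -/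
def IsInflation (𝔰 : Correspondence 𝔼 n) {A B : 𝒞} (f : A ⟶ B) : Prop :=
  ∃ (C : 𝒞) (δ : Extn 𝔼 C A) (X : NComplex n A C) (e : X.K.X 1 ≅ B),
    Realizes 𝔰 X δ ∧ X.dFirst ≫ e.hom = f

/-- `g : B ⟶ C` is the last differential of a conflation. -/
def IsDeflation (𝔰 : Correspondence 𝔼 n) {B C : 𝒞} (g : B ⟶ C) : Prop :=
  ∃ (A : 𝒞) (δ : Extn 𝔼 C A) (X : NComplex n A C) (e : B ≅ X.K.X n),
    Realizes 𝔰 X δ ∧ e.hom ≫ X.dLast = g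

variable (𝔼) in
/-- `(𝒞, 𝔼, 𝔰)` is an `n`-exangulated category: `𝒞` is additive, `𝔼` is biadditive, and `𝔰` is an
exact realization of `𝔼` satisfying (EA1), (EA2) and (EA2)ᵒᵖ. -/
structure IsNExangulated [NeZero n] (𝔰 : Correspondence 𝔼 n) : Prop where
  hasZeroObject : HasZeroObject 𝒞
  hasBinaryBiproducts : HasBinaryBiproducts 𝒞
  additive_left : 𝔼.Additive
  additive_right : ∀ C : 𝒞ᵒᵖ, (𝔼.obj C).Additive
  /-- (R0) -/
  exists_lift : ∀ {A B C D : 𝒞} (δ : Extn 𝔼 C A) (ρ : Extn 𝔼 D B) (X : NComplex n A C)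
    (Y : NComplex n B D), Realizes 𝔰 X δ → Realizes 𝔰 Y ρ →
    ∀ (a : A ⟶ B) (c : C ⟶ D), push a δ = pull c ρ →
      ∃ f : X.K ⟶ Y.K, HasEnds (X := X) (Y := Y) f a c
  /-- (R1) -/
  isNExangle : ∀ {A C : 𝒞} (δ : Extn 𝔼 C A) (X : NComplex n A C), Realizes 𝔰 X δ → IsNExangle X δ
  /-- (R2) -/
  realizes_idLeft : ∀ A : 𝒞, Realizes 𝔰 (NComplex.idLeft n A) 0
  realizes_idRight : ∀ A : 𝒞, Realizes 𝔰 (NComplex.idRight n A) 0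
  /-- (EA1) -/
  inflation_comp : ∀ {A B C : 𝒞} (f : A ⟶ B) (g : B ⟶ C),
    IsInflation 𝔰 f → IsInflation 𝔰 g → IsInflation 𝔰 (f ≫ g)
  deflation_comp : ∀ {A B C : 𝒞} (f : A ⟶ B) (g : B ⟶ C),
    IsDeflation 𝔰 f → IsDeflation 𝔰 g → IsDeflation 𝔰 (f ≫ g)
  /-- (EA2): `(id, c)` has a lift whose mapping cone realizes `(d⁰)_* ρ` -/
  exists_good_lift : ∀ {A C D : 𝒞} (ρ : Extn 𝔼 D A) (c : C ⟶ D) (X : NComplex n A C)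
    (Y : NComplex n A D), Realizes 𝔰 X (pull c ρ) → Realizes 𝔰 Y ρ →
      ∃ (f : X.K ⟶ Y.K) (M : NComplex n (X.K.X 1) D),
        HasEnds (X := X) (Y := Y) f (𝟙 A) c ∧ IsMappingCone (X := X) (Y := Y) f M ∧
          Realizes 𝔰 M (push X.dFirst ρ)
  /-- (EA2)ᵒᵖ: `(a, id)` has a lift whose mapping cocone realizes `(dⁿ)^* δ` -/
  exists_good_colift : ∀ {A B C : 𝒞} (δ : Extn 𝔼 C A) (a : A ⟶ B) (X : NComplex n A C)
    (Y : NComplex n B C), Realizes 𝔰 X δ → Realizes 𝔰 Y (push a δ) →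
      ∃ (f : X.K ⟶ Y.K) (N : NComplex n A (Y.K.X n)),
        HasEnds (X := X) (Y := Y) f a (𝟙 C) ∧ IsMappingCocone (X := X) (Y := Y) f N ∧
          Realizes 𝔰 N (pull Y.dLast δ)

/-- The full subcategory `P` of `(𝒞, 𝔼, 𝔰)` is extension-closed: each extension of objects of `P`
is realized by a complex with all terms in `P`. -/
def IsExtensionClosed (𝔰 : Correspondence 𝔼 n) (P : ObjectProperty 𝒞) : Prop :=
  ∀ ⦃A C : 𝒞⦄, P A → P C → ∀ δ : Extn 𝔼 C A,
    ∃ X : NComplex n A C, Realizes 𝔰 X δ ∧ ∀ i, 1 ≤ i → i ≤ n → P (X.K.X i)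

variable (𝔼) in
/-- The restriction of `𝔼` to a full subcategory. -/
def restrictExt (P : ObjectProperty 𝒞) :
    P.FullSubcategoryᵒᵖ ⥤ P.FullSubcategory ⥤ AddCommGrpCat.{w} :=
  P.ι.op ⋙ 𝔼 ⋙ (Functor.whiskeringLeft _ _ _).obj P.ι

/-- `𝔱` is the correspondence induced by `𝔰` on the full subcategory `P`: for complexes `X` with
terms in `P`, one has `𝔱 δ = [X]` (classes taken in `P`) iff `𝔰 δ = [X]` (classes taken
in `𝒞`). -/
def IsInduced (𝔰 : Correspondence 𝔼 n) (P : ObjectProperty 𝒞)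
    (𝔱 : Correspondence (restrictExt 𝔼 P) n) : Prop :=
  ∀ ⦃A C : P.FullSubcategory⦄ (δ : Extn 𝔼 C.obj A.obj) (X : NComplex n A C),
    Realizes 𝔱 X δ ↔ Realizes 𝔰 (X.map P.ι) δ

end NExangulated

/-! ### Triangulated categories -/

section Triangulated

variable {𝒯 : Type u} [Category.{v} 𝒯] [Preadditive 𝒯] [HasZeroObject 𝒯] [HasShift 𝒯 ℤ]
  [∀ k : ℤ, (shiftFunctor 𝒯 k).Additive] [Pretriangulated 𝒯]

/-- The full subcategory `P[k]`, consisting of the objects isomorphic to `X[k]` with `X` in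
`P`. -/
abbrev shifted (P : ObjectProperty 𝒯) (k : ℤ) : ObjectProperty 𝒯 := P.map (shiftFunctor 𝒯 k)

/-- The full subcategory `P * P[1] * ⋯ * P[i]`. -/
def starShifts (P : ObjectProperty 𝒯) : ℕ → ObjectProperty 𝒯
  | 0 => P
  | i + 1 => ObjectProperty.extensionProduct (starShifts P i) (shifted P (i + 1 : ℕ))

/-- The full subcategory `E` of the triangulated category `𝒯` contains a zero object and is closed
under extensions: in a distinguished triangle `A ⟶ B ⟶ C ⟶ A[1]` with `A`, `C` in `E`, the object
`B` is in `E`. -/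
structure IsTriangExtensionClosed (E : ObjectProperty 𝒯) : Prop where
  containsZero : E.ContainsZero
  obj₂ : ∀ S ∈ distTriang 𝒯, E S.obj₁ → E S.obj₃ → E S.obj₂

/-- `n`-cluster tilting subcategories of a triangulated category. -/
structure IsNClusterTilting (n : ℕ) (T : ObjectProperty 𝒯) : Prop where
  isClosedUnderIsomorphisms : T.IsClosedUnderIsomorphisms
  containsZero : T.ContainsZero
  biprod : ∀ ⦃X Y : 𝒯⦄, T X → T Y → T (X ⊞ Y)
  summand : ∀ ⦃X Y : 𝒯⦄, T (X ⊞ Y) → T X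
  /-- each object has a right `T`-approximation -/
  exists_right_approximation : ∀ X : 𝒯, ∃ (X₀ : 𝒯) (f : X₀ ⟶ X), T X₀ ∧
    ∀ ⦃Y : 𝒯⦄, T Y → ∀ g : Y ⟶ X, ∃ h : Y ⟶ X₀, h ≫ f = g
  /-- each object has a left `T`-approximation -/
  exists_left_approximation : ∀ X : 𝒯, ∃ (X₀ : 𝒯) (f : X ⟶ X₀), T X₀ ∧
    ∀ ⦃Y : 𝒯⦄, T Y → ∀ g : X ⟶ Y, ∃ h : X₀ ⟶ Y, f ≫ h = g
  iff_left : ∀ X : 𝒯, T X ↔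
    ∀ i : ℕ, 1 ≤ i → i < n → ∀ ⦃Y : 𝒯⦄, T Y → ∀ f : X ⟶ Y⟦(i : ℤ)⟧, f = 0
  iff_right : ∀ X : 𝒯, T X ↔
    ∀ i : ℕ, 1 ≤ i → i < n → ∀ ⦃Y : 𝒯⦄, T Y → ∀ f : Y ⟶ X⟦(i : ℤ)⟧, f = 0

/-- The biadditive functor `Extⁿ(C, A) = 𝒯(C, A[n])` on the full subcategory `T`. -/
def extN (T : ObjectProperty 𝒯) (n : ℕ) :
    T.FullSubcategoryᵒᵖ ⥤ T.FullSubcategory ⥤ AddCommGrpCat.{v} :=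
  T.ι.op ⋙ preadditiveCoyoneda ⋙
    (Functor.whiskeringLeft _ _ _).obj (T.ι ⋙ shiftFunctor 𝒯 (n : ℤ))

/-- For `δ i ∈ Ext¹(M (i + 1), M i)`, the product of `δ 0, …, δ (k - 1)` in
`Extᵏ(M k, M 0)`, which is the composition
`M k ⟶ M (k - 1)[1] ⟶ M (k - 2)[2] ⟶ ⋯ ⟶ M 0[k]` of their shifts. -/
def iteratedProduct (M : ℕ → 𝒯) (δ : ∀ i, M (i + 1) ⟶ (M i)⟦(1 : ℤ)⟧) :
    ∀ k : ℕ, ShiftedHom (M k) (M 0) (k : ℤ)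
  | 0 => ShiftedHom.mk₀ _ (by simp) (𝟙 (M 0))
  | k + 1 => ShiftedHom.comp (δ k) (iteratedProduct M δ k) (by simp)

/-- The pair `⟨X, δ⟩`, with `X` a complex `A ⟶ X¹ ⟶ ⋯ ⟶ Xⁿ ⟶ C` in `T` and
`δ ∈ Extⁿ(C, A)`, is decomposable: there are distinguished triangles
`M i ⟶ Xⁱ⁺¹ ⟶ M (i + 1) ⟶ (M i)[1]` for `0 ≤ i < n`, with `M 0 = A` and `M n = C`, such that
the differentials of `X` are the compositions `Xⁱ ⟶ M i ⟶ Xⁱ⁺¹` and `δ` is the product of the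
connecting morphisms. -/
def IsDecomposable {T : ObjectProperty 𝒯} {n : ℕ} {A C : T.FullSubcategory}
    (X : NComplex n A C) (δ : C.obj ⟶ A.obj⟦(n : ℤ)⟧) : Prop :=
  ∃ (M : ℕ → 𝒯) (a : A.obj ≅ M 0) (c : M n ≅ C.obj)
    (m : ∀ i, M i ⟶ (X.K.X (i + 1)).obj) (e : ∀ i, (X.K.X i).obj ⟶ M i)
    (η : ∀ i, M (i + 1) ⟶ (M i)⟦(1 : ℤ)⟧),
    (∀ i < n, Triangle.mk (m i) (e (i + 1)) (η i) ∈ distTriang 𝒯) ∧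
    X.dFirst.hom = a.hom ≫ m 0 ∧
    (∀ i, 1 ≤ i → i < n → (X.K.d i (i + 1)).hom = e i ≫ m i) ∧
    X.dLast.hom = e n ≫ c.hom ∧
    c.hom ≫ δ = iteratedProduct M η n ≫ a.inv⟦(n : ℤ)⟧'

end Triangulated

end NExang

end

open NExang

noncomputable section

set_option linter.unusedSectionVars false

/-! Everything is proved once, for a fully faithful additive functor `F : 𝒞 ⥤ 𝒯` whose essential
image P satisfies two conditions: (a) `IsRigid`, that is 𝒯(P, P[j]) = 0 for 0 < |j| < n; (b) P *
P[1] * ⋯ * P[n-1] is closed under extensions. The complexes that decompose into triangles then form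
an n-exangulated structure (`isNExangulated_extAlong`). This is applied to T and to E ∩ T.

Reason for (a): positive degrees belong to the definition of cluster tilting. The condition on right
orthogonals makes each X in T a retract of some R[n] with R in T (`exists_retract`), so for -n < j <
0 the group 𝒯(Q, X[j]) embeds in 𝒯(Q, R[n+j]) = 0. Reason for (b): for T the product is all of 𝒯
(`starShifts_eq_top`); for E ∩ T the hypothesis on T'[i] * T' allows the layers to be reordered
(`starShifts_extensionProduct_le`).

Condition (b) gives realizations and (EA1). The cocone of δ : C ⟶ A[n] is an extension of C by
A[n-1], hence lies in the product; peeling off its layers with the octahedral axiom factors δ into n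
connecting morphisms (`Tower.exists_prod_eq`). Inflations and deflations are characterised by their
cone or cocone lying in the product up to shift, so they compose by the octahedral axiom.

Condition (a) gives lifts, exactness and well-definedness. Positive vanishing makes multiplication
by the product of connecting morphisms injective, negative vanishing lets the intermediate objects M
i behave like images. Hence morphisms of extensions lift to towers (`Tower.exists_isHom_of_prod`),
which yields (R0); exactness (R1) follows by chasing triangles. Decomposable complexes of one
extension are homotopy equivalent because lifts of identities compose to the identity plus a
square-zero map up to homotopy; conversely decomposability passes along homotopy equivalences
(`IsDecomposableAlong.of_htpyEquivalent`).

For (EA2), the objects N i decomposing the cone of X ⟶ Y are built inductively as extensions of the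
(i+1)-st object of X by the i-th object of Y (`exists_three_by_three`, `exists_cone_chain`). The
good lift is read off from this construction rather than chosen beforehand. -/

namespace NExang

/-! ### Exact sequences and vanishing of morphisms in a triangulated category. -/

section
variable {𝒯 : Type u} [Category.{v} 𝒯] [Preadditive 𝒯] [HasZeroObject 𝒯] [HasShift 𝒯 ℤ]
  [∀ k : ℤ, (shiftFunctor 𝒯 k).Additive] [Pretriangulated 𝒯]

/-- The vanishing of `𝒯(X, Y[j])`. -/
def HomVanish (X Y : 𝒯) (j : ℤ) : Prop := ∀ f : X ⟶ Y⟦j⟧, f = 0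

section Exactness

variable {A B C Q : 𝒯} {f : A ⟶ B} {g : B ⟶ C} {h : C ⟶ A⟦(1 : ℤ)⟧}

lemma distTriang_comp₁₂ (hT : Triangle.mk f g h ∈ distTriang 𝒯) : f ≫ g = 0 :=
  comp_distTriang_mor_zero₁₂ _ hT

lemma distTriang_comp₂₃ (hT : Triangle.mk f g h ∈ distTriang 𝒯) : g ≫ h = 0 :=
  comp_distTriang_mor_zero₂₃ _ hT

lemma distTriang_comp₃₁ (hT : Triangle.mk f g h ∈ distTriang 𝒯) : h ≫ f⟦(1 : ℤ)⟧' = 0 :=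
  comp_distTriang_mor_zero₃₁ _ hT

lemma exists_lift₁ (hT : Triangle.mk f g h ∈ distTriang 𝒯) (x : Q ⟶ B) (hx : x ≫ g = 0) :
    ∃ y : Q ⟶ A, x = y ≫ f :=
  Triangle.coyoneda_exact₂ _ hT x hx

lemma exists_lift₂ (hT : Triangle.mk f g h ∈ distTriang 𝒯) (x : Q ⟶ C) (hx : x ≫ h = 0) :
    ∃ y : Q ⟶ B, x = y ≫ g :=
  Triangle.coyoneda_exact₃ _ hT x hx

lemma exists_desc₃ (hT : Triangle.mk f g h ∈ distTriang 𝒯) (x : B ⟶ Q) (hx : f ≫ x = 0) :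
    ∃ y : C ⟶ Q, x = g ≫ y :=
  Triangle.yoneda_exact₂ _ hT x hx

lemma exists_desc₁ (hT : Triangle.mk f g h ∈ distTriang 𝒯) (x : C ⟶ Q) (hx : g ≫ x = 0) :
    ∃ y : A⟦(1 : ℤ)⟧ ⟶ Q, x = h ≫ y :=
  Triangle.yoneda_exact₃ _ hT x hx

variable {A' B' C' : 𝒯} {f' : A' ⟶ B'} {g' : B' ⟶ C'} {h' : C' ⟶ A'⟦(1 : ℤ)⟧}

lemma exists_hom₃ (hT : Triangle.mk f g h ∈ distTriang 𝒯)
    (hT' : Triangle.mk f' g' h' ∈ distTriang 𝒯) (a : A ⟶ A') (b : B ⟶ B')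
    (comm : f ≫ b = a ≫ f') : ∃ c : C ⟶ C', g ≫ c = b ≫ g' ∧ h ≫ a⟦(1 : ℤ)⟧' = c ≫ h' :=
  complete_distinguished_triangle_morphism _ _ hT hT' a b comm

lemma exists_hom₂ (hT : Triangle.mk f g h ∈ distTriang 𝒯)
    (hT' : Triangle.mk f' g' h' ∈ distTriang 𝒯) (a : A ⟶ A') (c : C ⟶ C')
    (comm : h ≫ a⟦(1 : ℤ)⟧' = c ≫ h') : ∃ b : B ⟶ B', f ≫ b = a ≫ f' ∧ g ≫ c = b ≫ g' :=
  complete_distinguished_triangle_morphism₂ _ _ hT hT' a c comm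

/-- A triangle whose objects and morphisms are identified with those of a distinguished triangle
is distinguished. -/
lemma distTriang_of_iso (hT : Triangle.mk f g h ∈ distTriang 𝒯) (a : A' ≅ A) (b : B' ≅ B)
    (c : C' ≅ C) (h₁ : f' ≫ b.hom = a.hom ≫ f) (h₂ : g' ≫ c.hom = b.hom ≫ g)
    (h₃ : h' ≫ a.hom⟦(1 : ℤ)⟧' = c.hom ≫ h) : Triangle.mk f' g' h' ∈ distTriang 𝒯 :=
  isomorphic_distinguished _ hT _ (Triangle.isoMk _ _ a b c h₁ h₂ h₃)

end Exactness

/-- In a distinguished triangle `A ⟶ B ⟶ C ⟶ A[1]`, a morphism `Q ⟶ C[j]` whose composition with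
the connecting morphism vanishes lifts to `B[j]`. -/
lemma exists_lift_of_comp_eq_zero {A B C Q : 𝒯} {f : A ⟶ B} {g : B ⟶ C} {h : C ⟶ A⟦(1 : ℤ)⟧}
    (hT : Triangle.mk f g h ∈ distTriang 𝒯) {j k : ℤ} (x : ShiftedHom Q C j)
    (hk : 1 + j = k) (hx : x.comp (M := ℤ) (Z := A) h hk = 0) : ∃ y : Q ⟶ B⟦j⟧, x = y ≫ g⟦j⟧' := by
  have hx' : x ≫ h⟦j⟧' = 0 := by
    rw [ShiftedHom.comp, ← Category.assoc] at hx
    simpa using (Preadditive.IsIso.comp_right_eq_zero _ _).1 hx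
  -- The shifted triangle carries the sign (-1)^j on its maps; the sign is moved into the lift.
  obtain ⟨y, hy⟩ : ∃ y : Q ⟶ B⟦j⟧, x = y ≫ (j.negOnePow • g⟦j⟧') :=
    Triangle.coyoneda_exact₃ _ (Triangle.shift_distinguished _ hT j) x (by
      change x ≫ (j.negOnePow • h⟦j⟧' ≫ (shiftFunctorComm 𝒯 1 j).hom.app A) = 0
      rw [Linear.comp_units_smul, reassoc_of% hx', zero_comp, smul_zero])
  exact ⟨j.negOnePow • y, by rw [hy, Linear.comp_units_smul, Linear.units_smul_comp]⟩

/-- In a distinguished triangle `A ⟶ B ⟶ C ⟶ A[1]`, a morphism `A ⟶ Q[j]` whose composition with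
the connecting morphism vanishes extends to `B`. -/
lemma exists_desc_of_comp_eq_zero {A B C Q : 𝒯} {f : A ⟶ B} {g : B ⟶ C} {h : C ⟶ A⟦(1 : ℤ)⟧}
    (hT : Triangle.mk f g h ∈ distTriang 𝒯) (x : A ⟶ Q)
    (hx : h ≫ x⟦(1 : ℤ)⟧' = 0) : ∃ y : B ⟶ Q, x = f ≫ y := by
  -- The last map of the rotated triangle is `-f[1]`; fullness of the shift then brings `y` back to
  -- degree 0.
  obtain ⟨y, hy⟩ : ∃ y : B⟦(1 : ℤ)⟧ ⟶ Q⟦(1 : ℤ)⟧, x⟦(1 : ℤ)⟧' = (-f⟦(1 : ℤ)⟧') ≫ y :=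
    Triangle.yoneda_exact₃ _ (rot_of_distTriang _ hT) (x⟦(1 : ℤ)⟧') hx
  obtain ⟨y, rfl⟩ := (shiftFunctor 𝒯 (1 : ℤ)).map_surjective y
  refine ⟨-y, (shiftFunctor 𝒯 (1 : ℤ)).map_injective (hy.trans ?_)⟩
  simp

lemma homVanish_shift_right {X Y : 𝒯} {a j k : ℤ} (h : a + j = k) :
    HomVanish X (Y⟦a⟧) j ↔ HomVanish X Y k := by
  constructor
  · intro H f
    have := H (f ≫ (shiftFunctorAdd' 𝒯 a j k h).hom.app Y)
    exact (Preadditive.IsIso.comp_right_eq_zero _ _).1 this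
  · intro H f
    have := H (f ≫ (shiftFunctorAdd' 𝒯 a j k h).inv.app Y)
    exact (Preadditive.IsIso.comp_right_eq_zero _ _).1 this

lemma homVanish_shift_left {X Y : 𝒯} {a j k : ℤ} (h : k + a = j) :
    HomVanish (X⟦a⟧) Y j ↔ HomVanish X Y k := by
  constructor
  · intro H f
    have := H (f⟦a⟧' ≫ (shiftFunctorAdd' 𝒯 k a j h).inv.app Y)
    have := (Preadditive.IsIso.comp_right_eq_zero _ _).1 this
    exact (shiftFunctor 𝒯 a).map_injective (this.trans (by simp))
  · intro H f
    obtain ⟨g, hg⟩ := (shiftFunctor 𝒯 a).map_surjective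
      (f ≫ (shiftFunctorAdd' 𝒯 k a j h).hom.app Y)
    rw [H g, Functor.map_zero] at hg
    exact (Preadditive.IsIso.comp_right_eq_zero _ _).1 hg.symm

lemma HomVanish.of_iso {X X' Y Y' : 𝒯} {j : ℤ} (H : HomVanish X Y j) (e : X ≅ X') (e' : Y ≅ Y') :
    HomVanish X' Y' j := by
  intro f
  have := H (e.hom ≫ f ≫ e'.inv⟦j⟧')
  simpa using this

lemma homVanish_zero {X Y : 𝒯} : HomVanish X Y 0 ↔ ∀ f : X ⟶ Y, f = 0 := by
  constructor
  · intro H f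
    have := H (f ≫ (shiftFunctorZero 𝒯 ℤ).inv.app Y)
    exact (Preadditive.IsIso.comp_right_eq_zero _ _).1 this
  · intro H f
    have := H (f ≫ (shiftFunctorZero 𝒯 ℤ).hom.app Y)
    exact (Preadditive.IsIso.comp_right_eq_zero _ _).1 this

section Triangle

variable {A B C Q : 𝒯} {f : A ⟶ B} {g : B ⟶ C} {h : C ⟶ A⟦(1 : ℤ)⟧}
  (hT : Triangle.mk f g h ∈ distTriang 𝒯)

include hT

lemma homVanish_to₃ {j : ℤ} (h₂ : HomVanish Q B j) (h₁ : HomVanish Q A (j + 1)) :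
    HomVanish Q C j := by
  intro x
  obtain ⟨y, rfl⟩ := exists_lift_of_comp_eq_zero hT x (add_comm 1 j) (h₁ _)
  rw [h₂ y, zero_comp]

lemma homVanish_to₂ {j : ℤ} (h₁ : HomVanish Q A j) (h₃ : HomVanish Q C j) :
    HomVanish Q B j := by
  exact homVanish_to₃ (inv_rot_of_distTriang _ hT) h₁
    ((homVanish_shift_right (by ring)).2 h₃)

lemma homVanish_to₁ {j : ℤ} (h₂ : HomVanish Q B j) (h₃ : HomVanish Q C (j - 1)) :
    HomVanish Q A j :=
  homVanish_to₂ (inv_rot_of_distTriang _ hT) ((homVanish_shift_right (by ring)).2 h₃) h₂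

lemma homVanish_from₁ {j : ℤ} (h₂ : HomVanish B Q j) (h₃ : HomVanish C Q (j + 1)) :
    HomVanish A Q j := by
  intro x
  obtain ⟨y, rfl⟩ := exists_desc_of_comp_eq_zero hT x
    ((homVanish_shift_right (X := C) (Y := Q) rfl).2 h₃ _)
  rw [h₂ y, comp_zero]

lemma homVanish_from₃ {j : ℤ} (h₂ : HomVanish B Q j) (h₁ : HomVanish A Q (j - 1)) :
    HomVanish C Q j :=
  homVanish_from₁ (rot_of_distTriang _ (rot_of_distTriang _ hT))
    ((homVanish_shift_left (by ring)).2 h₁) ((homVanish_shift_left (by ring)).2 h₂)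

end Triangle

end

/-! ### Towers of triangles, their products and their morphisms. -/

section
variable {𝒯 : Type u} [Category.{v} 𝒯] [Preadditive 𝒯] [HasZeroObject 𝒯] [HasShift 𝒯 ℤ]
  [∀ k : ℤ, (shiftFunctor 𝒯 k).Additive] [Pretriangulated 𝒯]

/-- `𝒯(P, P[j]) = 0` for all `0 < |j| < n`. -/
def IsRigid (n : ℕ) (P : ObjectProperty 𝒯) : Prop :=
  ∀ ⦃Q Q' : 𝒯⦄, P Q → P Q' → ∀ j : ℤ, j ≠ 0 → -n < j → j < n → HomVanish Q Q' j

variable (𝒯) in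
/-- A sequence of morphisms `M i ⟶ X i ⟶ M (i + 1) ⟶ (M i)[1]`. -/
structure Tower where
  /-- the objects `M i` -/
  M : ℕ → 𝒯
  /-- the objects `X i` -/
  X : ℕ → 𝒯
  /-- the morphisms `M i ⟶ X i` -/
  m : ∀ i, M i ⟶ X i
  /-- the morphisms `X i ⟶ M (i + 1)` -/
  e : ∀ i, X i ⟶ M (i + 1)
  /-- the connecting morphisms -/
  η : ∀ i, M (i + 1) ⟶ (M i)⟦(1 : ℤ)⟧

namespace Tower

/-- The first `k` triangles of the tower are distinguished. -/
def IsDist (t : Tower 𝒯) (k : ℕ) : Prop :=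
  ∀ i < k, Triangle.mk (t.m i) (t.e i) (t.η i) ∈ distTriang 𝒯

/-- The tower without its first triangle. -/
abbrev tail (t : Tower 𝒯) : Tower 𝒯 where
  M i := t.M (i + 1)
  X i := t.X (i + 1)
  m i := t.m (i + 1)
  e i := t.e (i + 1)
  η i := t.η (i + 1)

/-- The product of the first `k` connecting morphisms. -/
def prod (t : Tower 𝒯) (k : ℕ) : ShiftedHom (t.M k) (t.M 0) (k : ℤ) := iteratedProduct t.M t.η k

lemma IsDist.tail {t : Tower 𝒯} {k : ℕ} (h : t.IsDist (k + 1)) : t.tail.IsDist k :=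
  fun i hi => h (i + 1) (by omega)

lemma IsDist.mono {t : Tower 𝒯} {k l : ℕ} (h : t.IsDist k) (hl : l ≤ k) : t.IsDist l :=
  fun i hi => h i (by omega)

lemma prod_zero (t : Tower 𝒯) : t.prod 0 = ShiftedHom.mk₀ _ (by simp) (𝟙 _) := rfl

lemma prod_zero_naturality (t t' : Tower 𝒯) (f : t.M 0 ⟶ t'.M 0) :
    t.prod 0 ≫ f⟦((0 : ℕ) : ℤ)⟧' = f ≫ t'.prod 0 := by
  have := (shiftFunctorZero' 𝒯 ((0 : ℕ) : ℤ) (by simp)).inv.naturality f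
  simpa [prod_zero, ShiftedHom.mk₀] using this.symm

lemma isIso_prod_zero (t : Tower 𝒯) : IsIso (t.prod 0) := by
  rw [prod_zero, ShiftedHom.mk₀]
  infer_instance

lemma prod_succ (t : Tower 𝒯) (k : ℕ) :
    t.prod (k + 1) = ShiftedHom.comp (t.η k) (t.prod k) (by simp) := rfl

/-- The definition splits off the last connecting morphism; associativity splits off the first one
instead, as needed for inductions along `tail`. -/
lemma prod_succ' (t : Tower 𝒯) (k : ℕ) :
    t.prod (k + 1) = ShiftedHom.comp (t.tail.prod k) (t.η 0) (by push_cast; ring) := by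
  induction k with
  | zero =>
    rw [prod_succ, prod_zero, prod_zero]
    exact (ShiftedHom.comp_mk₀_id _ _ _).trans (ShiftedHom.mk₀_id_comp _ _ _).symm
  | succ k ih =>
    rw [prod_succ, ih, prod_succ]
    exact (ShiftedHom.comp_assoc _ _ _ _ _ (by push_cast; ring)).symm

section Vanishing

variable {t : Tower 𝒯} {k n : ℕ} {P : ObjectProperty 𝒯}

/-- Dimension shifting: each triangle crossed costs one degree of the rigidity range, whence the
bound on `j + i`. The next three lemmas are the variants for the other variable of Hom and for the
other end of the tower. -/
lemma homVanish_to_of_first (hP : IsRigid n P) (hd : t.IsDist k) (hX : ∀ i < k, P (t.X i))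
    (h₀ : P (t.M 0)) {Q : 𝒯} (hQ : P Q) {i : ℕ} (hi : i ≤ k) {j : ℤ} (hj : 1 ≤ j)
    (hj' : j + i < n) : HomVanish Q (t.M i) j := by
  induction i generalizing j with
  | zero => exact hP hQ h₀ j (by omega) (by omega) (by omega)
  | succ i ih =>
    exact homVanish_to₃ (hd i (by omega))
      (hP hQ (hX i (by omega)) j (by omega) (by omega) (by omega))
      (ih (by omega) (by omega) (by push_cast at hj'; omega))

lemma homVanish_from_of_first (hP : IsRigid n P) (hd : t.IsDist k) (hX : ∀ i < k, P (t.X i))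
    (h₀ : P (t.M 0)) {Q : 𝒯} (hQ : P Q) {i : ℕ} (hi : i ≤ k) {j : ℤ} (hj : j ≤ -1)
    (hj' : i - j < n) : HomVanish (t.M i) Q j := by
  induction i generalizing j with
  | zero => exact hP h₀ hQ j (by omega) (by omega) (by omega)
  | succ i ih =>
    exact homVanish_from₃ (hd i (by omega))
      (hP (hX i (by omega)) hQ j (by omega) (by omega) (by omega))
      (ih (by omega) (by omega) (by push_cast at hj'; omega))

lemma homVanish_to_of_last (hP : IsRigid n P) (hd : t.IsDist k) (hX : ∀ i < k, P (t.X i))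
    (hk : P (t.M k)) {Q : 𝒯} (hQ : P Q) {i r : ℕ} (hi : i + r = k) {j : ℤ} (hj : j ≤ -1)
    (hj' : r - j < n) : HomVanish Q (t.M i) j := by
  induction r generalizing i j with
  | zero => subst hi; exact hP hQ hk j (by omega) (by omega) (by omega)
  | succ r ih =>
    exact homVanish_to₁ (hd i (by omega))
      (hP hQ (hX i (by omega)) j (by omega) (by omega) (by omega))
      (ih (by omega) (by omega) (by push_cast at hj'; omega))

lemma homVanish_from_of_last (hP : IsRigid n P) (hd : t.IsDist k) (hX : ∀ i < k, P (t.X i))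
    (hk : P (t.M k)) {Q : 𝒯} (hQ : P Q) {i r : ℕ} (hi : i + r = k) {j : ℤ} (hj : 1 ≤ j)
    (hj' : j + r < n) : HomVanish (t.M i) Q j := by
  induction r generalizing i j with
  | zero => subst hi; exact hP hk hQ j (by omega) (by omega) (by omega)
  | succ r ih =>
    exact homVanish_from₁ (hd i (by omega))
      (hP (hX i (by omega)) hQ j (by omega) (by omega) (by omega))
      (ih (by omega) (by omega) (by push_cast at hj'; omega))

/-- The kernel of composition with a connecting morphism comes from 𝒯(Q, X i[j]), which rigidity
kills in this range of degrees; so multiplication by the whole product is injective. -/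
lemma eq_zero_of_comp_prod (hP : IsRigid n P) (hd : t.IsDist k) (hX : ∀ i < k, P (t.X i))
    {Q : 𝒯} (hQ : P Q) {j l : ℤ} (hj : 1 ≤ j) (hj' : j + k ≤ n) (f : ShiftedHom Q (t.M k) j)
    (hl : k + j = l) (hf : f.comp (t.prod k) hl = 0) : f = 0 := by
  induction k generalizing j l with
  | zero =>
    obtain rfl : j = l := by simpa using hl
    exact (ShiftedHom.comp_mk₀_id f _ _).symm.trans hf
  | succ k ih =>
    rw [prod_succ] at hf
    push_cast at hl hj'
    have := ih (hd.mono (by omega)) (fun i hi => hX i (by omega)) (j := 1 + j) (by omega)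
      (by omega) (f.comp (t.η k) rfl) (by omega)
      ((ShiftedHom.comp_assoc f (t.η k) (t.prod k) rfl (by omega) (by omega)).trans hf)
    obtain ⟨y, rfl⟩ := exists_lift_of_comp_eq_zero (hd k (by omega)) f rfl this
    rw [hP hQ (hX k (by omega)) j (by omega) (by omega) (by omega) y, zero_comp]

lemma exists_lift_of_comp_prod (hP : IsRigid n P) (hd : t.IsDist (k + 1))
    (hX : ∀ i < k + 1, P (t.X i)) {Q : 𝒯} (hQ : P Q) (hk : k + 1 ≤ n) (f : Q ⟶ t.M (k + 1))
    (hf : f ≫ t.prod (k + 1) = 0) : ∃ g, f = g ≫ t.e k := by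
  -- The other `k` factors of the product are injective in degree 1, so the last connecting morphism
  -- alone already kills `f`.
  have h : f ≫ t.η k = 0 := by
    refine eq_zero_of_comp_prod hP (hd.mono (by omega)) (fun i hi => hX i (by omega)) hQ
      le_rfl (by omega) (f ≫ t.η k) (l := k + 1) rfl ?_
    exact Eq.trans (by rw [prod_succ, ShiftedHom.comp, ShiftedHom.comp, Category.assoc]; rfl) hf
  exact exists_lift₂ (hd k (by omega)) f h

lemma eq_zero_of_prod_comp (hP : IsRigid n P) (hd : t.IsDist k) (hX : ∀ i < k, P (t.X i))
    {Q : 𝒯} (hQ : P Q) {j l : ℤ} (hj : 1 ≤ j) (hj' : j + k ≤ n) (g : ShiftedHom (t.M 0) Q j)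
    (hl : j + k = l) (hg : (t.prod k).comp g hl = 0) : g = 0 := by
  induction k generalizing t j l with
  | zero =>
    obtain rfl : j = l := by simpa using hl
    exact (ShiftedHom.mk₀_id_comp _ _ g).symm.trans hg
  | succ k ih =>
    rw [prod_succ'] at hg
    push_cast at hl hj'
    have := ih hd.tail (fun i hi => hX (i + 1) (by omega)) (j := j + 1) (by omega) (by omega)
      (ShiftedHom.comp (t.η 0) g rfl) (by omega)
      ((ShiftedHom.comp_assoc (t.tail.prod k) (t.η 0) g _ rfl (by omega)).symm.trans hg)
    have this : (t.η 0 ≫ g⟦(1 : ℤ)⟧') ≫ _ = 0 := (Category.assoc _ _ _).trans this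
    obtain ⟨y, rfl⟩ := exists_desc_of_comp_eq_zero (hd 0 (by omega)) g
      ((Preadditive.IsIso.comp_right_eq_zero _ _).1 this)
    rw [hP (hX 0 (by omega)) hQ j (by omega) (by omega) (by omega) y, comp_zero]

lemma tail_prod_comp_map (t : Tower 𝒯) (k : ℕ) {Q : 𝒯} (f : t.M 0 ⟶ Q) :
    (t.tail.prod k).comp (Z := Q) (t.η 0 ≫ f⟦(1 : ℤ)⟧' : ShiftedHom _ _ _)
      (by push_cast; ring) = t.prod (k + 1) ≫ f⟦((k + 1 : ℕ) : ℤ)⟧' := by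
  rw [prod_succ', ← ShiftedHom.comp_mk₀ _ 0 rfl, ← ShiftedHom.comp_mk₀ _ 0 rfl]
  exact (ShiftedHom.comp_assoc _ _ _ _ _ (by push_cast; ring)).symm

lemma exists_desc_of_prod_comp (hP : IsRigid n P) (hd : t.IsDist (k + 1))
    (hX : ∀ i < k + 1, P (t.X i)) {Q : 𝒯} (hQ : P Q) (hk : k + 1 ≤ n) (f : t.M 0 ⟶ Q)
    (hf : t.prod (k + 1) ≫ f⟦((k + 1 : ℕ) : ℤ)⟧' = 0) : ∃ g, f = t.m 0 ≫ g := by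
  refine exists_desc_of_comp_eq_zero (hd 0 (by omega)) f ?_
  refine eq_zero_of_prod_comp hP hd.tail (fun i hi => hX (i + 1) (by omega)) hQ le_rfl
    (by omega) (t.η 0 ≫ f⟦(1 : ℤ)⟧') _ ((tail_prod_comp_map t k f).trans hf)

end Vanishing

/-- The sequences `φ` and `f` give morphisms between the first `k` triangles of two towers. -/
def IsHom (t t' : Tower 𝒯) (k : ℕ) (φ : ∀ i, t.M i ⟶ t'.M i) (f : ∀ i, t.X i ⟶ t'.X i) : Prop :=
  ∀ i < k, t.m i ≫ f i = φ i ≫ t'.m i ∧ t.e i ≫ φ (i + 1) = f i ≫ t'.e i ∧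
    t.η i ≫ (φ i)⟦(1 : ℤ)⟧' = φ (i + 1) ≫ t'.η i

section Hom

variable {t t' t'' : Tower 𝒯} {k : ℕ}

lemma IsHom.prod_comp {φ : ∀ i, t.M i ⟶ t'.M i} {f : ∀ i, t.X i ⟶ t'.X i}
    (h : IsHom t t' k φ f) : t.prod k ≫ (φ 0)⟦(k : ℤ)⟧' = φ k ≫ t'.prod k := by
  induction k with
  | zero =>
    exact prod_zero_naturality t t' (φ 0)
  | succ k ih =>
    have ih := ih (fun i hi => h i (by omega))
    rw [prod_succ, prod_succ, ← ShiftedHom.comp_mk₀ _ 0 rfl]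
    refine (ShiftedHom.comp_assoc _ _ _ _ (zero_add _) (by push_cast; ring)).trans ?_
    rw [ShiftedHom.comp_mk₀, ih]
    have h₃ := (h k (by omega)).2.2
    simp only [ShiftedHom.comp, Functor.map_comp, Category.assoc]
    rw [reassoc_of% h₃]

lemma IsHom.comp {φ : ∀ i, t.M i ⟶ t'.M i} {f : ∀ i, t.X i ⟶ t'.X i}
    {φ' : ∀ i, t'.M i ⟶ t''.M i} {f' : ∀ i, t'.X i ⟶ t''.X i}
    (h : IsHom t t' k φ f) (h' : IsHom t' t'' k φ' f') :
    IsHom t t'' k (fun i => φ i ≫ φ' i) (fun i => f i ≫ f' i) := by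
  intro i hi
  obtain ⟨h₁, h₂, h₃⟩ := h i hi
  obtain ⟨h₁', h₂', h₃'⟩ := h' i hi
  refine ⟨?_, ?_, ?_⟩
  · rw [reassoc_of% h₁, h₁', Category.assoc]
  · rw [reassoc_of% h₂, h₂', Category.assoc]
  · rw [Functor.map_comp, reassoc_of% h₃, h₃', Category.assoc]

lemma IsHom.sub {φ φ' : ∀ i, t.M i ⟶ t'.M i} {f f' : ∀ i, t.X i ⟶ t'.X i}
    (h : IsHom t t' k φ f) (h' : IsHom t t' k φ' f') :
    IsHom t t' k (fun i => φ i - φ' i) (fun i => f i - f' i) := by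
  intro i hi
  obtain ⟨h₁, h₂, h₃⟩ := h i hi
  obtain ⟨h₁', h₂', h₃'⟩ := h' i hi
  simp only [Preadditive.comp_sub, Preadditive.sub_comp, Functor.map_sub, *, and_self]

lemma IsHom.isIso (hd : t.IsDist k) (hd' : t'.IsDist k)
    {φ : ∀ i, t.M i ⟶ t'.M i} {f : ∀ i, t.X i ⟶ t'.X i} (h : IsHom t t' k φ f)
    (h₀ : IsIso (φ 0)) (hf : ∀ i < k, IsIso (f i)) : ∀ i ≤ k, IsIso (φ i) := by
  intro i hi
  induction i with
  | zero => exact h₀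
  | succ i ih =>
    obtain ⟨h₁, h₂, h₃⟩ := h i (by omega)
    exact isIso₃_of_isIso₁₂ (Triangle.homMk (Triangle.mk (t.m i) (t.e i) (t.η i))
      (Triangle.mk (t'.m i) (t'.e i) (t'.η i)) (φ i) (f i) (φ (i + 1)) h₁ h₂ h₃)
      (hd i (by omega)) (hd' i (by omega)) (ih (by omega)) (hf i (by omega))

/-- TR3 provides the next `φ`. Its square with the following term commutes up to a map factoring
through M i[1] ⟶ X' (i + 1), and `hv` removes that error. -/
lemma exists_isHom_of_comm (hd : t.IsDist k) (hd' : t'.IsDist k)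
    (hv : ∀ i, i + 1 < k → HomVanish (t.M i) (t'.X (i + 1)) (-1))
    (f : ∀ i, t.X i ⟶ t'.X i)
    (hf : ∀ i, i + 1 < k → (t.e i ≫ t.m (i + 1)) ≫ f (i + 1) =
      f i ≫ t'.e i ≫ t'.m (i + 1))
    (φ₀ : t.M 0 ⟶ t'.M 0) (h₀ : 0 < k → t.m 0 ≫ f 0 = φ₀ ≫ t'.m 0) :
    ∃ φ : ∀ i, t.M i ⟶ t'.M i, φ 0 = φ₀ ∧ IsHom t t' k φ f := by
  induction k generalizing t t' with
  | zero =>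
    refine ⟨fun | 0 => φ₀ | i + 1 => 0, rfl, fun i hi => by omega⟩
  | succ k ih =>
    obtain ⟨φ₁, h₁, h₂⟩ := exists_hom₃ (hd 0 (by omega)) (hd' 0 (by omega)) φ₀ (f 0) (h₀ (by omega))
    obtain ⟨φ, h, hφ⟩ := ih hd.tail hd'.tail (fun i hi => hv (i + 1) (by omega))
      (fun i => f (i + 1)) (fun i hi => hf (i + 1) (by omega)) φ₁ (fun hk => by
        obtain ⟨w, hw⟩ : ∃ w, t.m 1 ≫ f 1 - φ₁ ≫ t'.m 1 = t.η 0 ≫ w :=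
          exists_desc₁ (hd 0 (by omega)) _ (by
            have := hf 0 (by omega)
            rw [Category.assoc] at this
            rw [Preadditive.comp_sub, this, reassoc_of% h₁, sub_self])
        have hv : HomVanish ((t.M 0)⟦(1 : ℤ)⟧) (t'.X 1) 0 :=
          (homVanish_shift_left (by norm_num)).2 (hv 0 (by omega))
        rw [homVanish_zero.1 hv w, comp_zero, sub_eq_zero] at hw
        exact hw)
    refine ⟨fun | 0 => φ₀ | i + 1 => φ i, rfl, ?_⟩
    rintro (_ | i) hi
    · dsimp
      rw [h]
      exact ⟨h₀ (by omega), h₁, h₂⟩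
    · exact hφ i (by omega)

/-- This is the core of (R0): both ends are prescribed, and compatibility with the products is the
only condition. The induction passes to the tails, so the TR3 filler must be made compatible with
the remaining product. -/
lemma exists_isHom_of_prod {n : ℕ} {P : ObjectProperty 𝒯} (hP : IsRigid n P)
    (hd : t.IsDist k) (hd' : t'.IsDist k) (hX : ∀ i < k, P (t.X i)) (hX' : ∀ i < k, P (t'.X i))
    (hk : P (t.M k)) (hkn : k ≤ n) (φ₀ : t.M 0 ⟶ t'.M 0) (c : t.M k ⟶ t'.M k)
    (hc : t.prod k ≫ φ₀⟦(k : ℤ)⟧' = c ≫ t'.prod k) :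
    ∃ (φ : ∀ i, t.M i ⟶ t'.M i) (f : ∀ i, t.X i ⟶ t'.X i), φ 0 = φ₀ ∧ φ k = c ∧
      IsHom t t' k φ f := by
  induction k generalizing t t' with
  | zero =>
    refine ⟨fun | 0 => φ₀ | i + 1 => 0, 0, rfl, ?_, fun i hi => by omega⟩
    have := isIso_prod_zero t'
    exact (cancel_mono (t'.prod 0)).1 ((prod_zero_naturality t t' φ₀).symm.trans hc)
  | succ k ih =>
    -- By `hc`, the product of `t` followed by this map factors through the product of `t'` followed
    -- by `m' 0`, which is zero.
    obtain ⟨f₀, hf₀⟩ : ∃ f₀, φ₀ ≫ t'.m 0 = t.m 0 ≫ f₀ := by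
      refine exists_desc_of_prod_comp hP hd hX (hX' 0 (by omega)) hkn _ ?_
      rw [Functor.map_comp, reassoc_of% hc, ← tail_prod_comp_map]
      rw [distTriang_comp₃₁ (hd' 0 (by omega)), ShiftedHom.comp_zero, comp_zero]
    obtain ⟨φ₁, h₁, h₂⟩ := exists_hom₃ (hd 0 (by omega)) (hd' 0 (by omega)) φ₀ f₀ hf₀.symm
    -- The two sides agree after the first connecting morphism of `t'`, so their difference comes
    -- from `t'.X 0`.
    obtain ⟨y, hy⟩ : ∃ y : t.M (k + 1) ⟶ (t'.X 0)⟦(k : ℤ)⟧,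
        t.tail.prod k ≫ φ₁⟦(k : ℤ)⟧' - c ≫ t'.tail.prod k = y ≫ (t'.e 0)⟦(k : ℤ)⟧' := by
      refine exists_lift_of_comp_eq_zero (hd' 0 (by omega)) _
        (show 1 + (k : ℤ) = (k + 1 : ℕ) by push_cast; ring) ?_
      have e₁ : ShiftedHom.comp (Y := t'.M 1) (t.tail.prod k ≫ φ₁⟦(k : ℤ)⟧') (t'.η 0)
          (show 1 + (k : ℤ) = (k + 1 : ℕ) by push_cast; ring) =
          t.prod (k + 1) ≫ φ₀⟦((k + 1 : ℕ) : ℤ)⟧' := by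
        rw [← tail_prod_comp_map, h₂]
        simp [ShiftedHom.comp]
      have e₂ : ShiftedHom.comp (Y := t'.M 1) (c ≫ t'.tail.prod k) (t'.η 0)
          (show 1 + (k : ℤ) = (k + 1 : ℕ) by push_cast; ring) = c ≫ t'.prod (k + 1) := by
        rw [prod_succ']
        simp [ShiftedHom.comp]
      rw [sub_eq_add_neg, ShiftedHom.add_comp, ShiftedHom.neg_comp, e₁, e₂, hc, add_neg_cancel]
    obtain ⟨f₀', φ₁', h₀', h₁', h₂', h₃'⟩ : ∃ (f₀' : t.X 0 ⟶ t'.X 0) (φ₁' : t.M 1 ⟶ t'.M 1),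
        t.m 0 ≫ f₀' = φ₀ ≫ t'.m 0 ∧ t.e 0 ≫ φ₁' = f₀' ≫ t'.e 0 ∧
        t.η 0 ≫ φ₀⟦1⟧' = φ₁' ≫ t'.η 0 ∧
        t.tail.prod k ≫ φ₁'⟦(k : ℤ)⟧' = c ≫ t'.tail.prod k := by
      -- For `k = 0` the error is a map to `t'.X 0` in degree 0, which need not vanish and is
      -- absorbed into `f₀` and `φ₁`; for `k > 0` it vanishes by rigidity.
      rcases Nat.eq_zero_or_pos k with rfl | hk0
      · have := isIso_prod_zero t'.tail
        obtain ⟨z, hz⟩ : ∃ z : t.M 1 ⟶ t'.X 0, φ₁ - c = z ≫ t'.e 0 := by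
          refine ⟨y ≫ (shiftFunctorZero' 𝒯 ((0 : ℕ) : ℤ) (by simp)).hom.app _, ?_⟩
          have e₁ := (shiftFunctorZero' 𝒯 ((0 : ℕ) : ℤ) (by simp)).hom.naturality (t'.e 0)
          have e₂ := prod_zero_naturality t.tail t'.tail φ₁
          rw [e₂, ← Preadditive.sub_comp] at hy
          rw [Category.assoc]
          refine Eq.trans ?_ (congrArg (y ≫ ·) e₁)
          rw [← Category.assoc]
          refine Eq.trans ?_ (congrArg (· ≫ _) hy)
          simp [prod_zero, ShiftedHom.mk₀]
        obtain rfl : c = φ₁ - z ≫ t'.e 0 := by rw [← hz]; abel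
        refine ⟨f₀ - t.e 0 ≫ z, φ₁ - z ≫ t'.e 0, ?_, ?_, ?_,
          prod_zero_naturality t.tail t'.tail (φ₁ - z ≫ t'.e 0)⟩
        · rw [Preadditive.comp_sub, hf₀, ← Category.assoc, distTriang_comp₁₂ (hd 0 (by omega)),
            zero_comp, sub_zero]
        · rw [Preadditive.comp_sub, Preadditive.sub_comp, h₁, Category.assoc]
        · rw [Preadditive.sub_comp, Category.assoc, distTriang_comp₂₃ (hd' 0 (by omega)),
            comp_zero, sub_zero, h₂]
      · refine ⟨f₀, φ₁, hf₀.symm, h₁, h₂, ?_⟩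
        rw [hP hk (hX' 0 (by omega)) k (by omega) (by omega) (by omega) y, zero_comp,
          sub_eq_zero] at hy
        exact hy
    obtain ⟨φ, f, h, hc', hφ⟩ := ih hd.tail hd'.tail (fun i hi => hX (i + 1) (by omega))
      (fun i hi => hX' (i + 1) (by omega)) hk (by omega) φ₁' c h₃'
    refine ⟨fun | 0 => φ₀ | i + 1 => φ i, fun | 0 => f₀' | i + 1 => f i, rfl, hc', ?_⟩
    rintro (_ | i) hi
    · dsimp
      rw [h]
      exact ⟨h₀', h₁', h₂'⟩
    · exact hφ i (by omega)

end Hom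

end Tower

end

/-! ### Direct sums, 3×3 diagrams and homotopy cartesian squares. -/

section
variable {𝒯 : Type u} [Category.{v} 𝒯] [Preadditive 𝒯] [HasZeroObject 𝒯] [HasShift 𝒯 ℤ]
  [∀ k : ℤ, (shiftFunctor 𝒯 k).Additive] [Pretriangulated 𝒯]

lemma isIso_of_distTriang₃ {A B C A' B' C' : 𝒯} {f : A ⟶ B} {g : B ⟶ C} {h : C ⟶ A⟦(1 : ℤ)⟧}
    {f' : A' ⟶ B'} {g' : B' ⟶ C'} {h' : C' ⟶ A'⟦(1 : ℤ)⟧}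
    (hT : Triangle.mk f g h ∈ distTriang 𝒯) (hT' : Triangle.mk f' g' h' ∈ distTriang 𝒯)
    {a : A ⟶ A'} {b : B ⟶ B'} {c : C ⟶ C'} (h₁ : f ≫ b = a ≫ f') (h₂ : g ≫ c = b ≫ g')
    (h₃ : h ≫ a⟦(1 : ℤ)⟧' = c ≫ h') (ha : IsIso a) (hb : IsIso b) : IsIso c :=
  isIso₃_of_isIso₁₂ (Triangle.homMk (Triangle.mk f g h) (Triangle.mk f' g' h') a b c h₁ h₂ h₃)
    hT hT' ha hb

lemma isIso_of_distTriang₂ {A B C A' B' C' : 𝒯} {f : A ⟶ B} {g : B ⟶ C} {h : C ⟶ A⟦(1 : ℤ)⟧}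
    {f' : A' ⟶ B'} {g' : B' ⟶ C'} {h' : C' ⟶ A'⟦(1 : ℤ)⟧}
    (hT : Triangle.mk f g h ∈ distTriang 𝒯) (hT' : Triangle.mk f' g' h' ∈ distTriang 𝒯)
    {a : A ⟶ A'} {b : B ⟶ B'} {c : C ⟶ C'} (h₁ : f ≫ b = a ≫ f') (h₂ : g ≫ c = b ≫ g')
    (h₃ : h ≫ a⟦(1 : ℤ)⟧' = c ≫ h') (ha : IsIso a) (hc : IsIso c) : IsIso b :=
  isIso₂_of_isIso₁₃ (Triangle.homMk (Triangle.mk f g h) (Triangle.mk f' g' h') a b c h₁ h₂ h₃)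
    hT hT' ha hc

lemma biprod_inr_fst_distTriang (X Y : 𝒯) :
    Triangle.mk (biprod.inr : Y ⟶ X ⊞ Y) biprod.fst (0 : X ⟶ Y⟦(1 : ℤ)⟧) ∈ distTriang 𝒯 :=
  distTriang_of_iso (binaryBiproductTriangle_distinguished Y X) (Iso.refl _)
    (biprod.braiding X Y) (Iso.refl _) (by ext <;> simp) (by simp) (by simp)

/-- The direct sum of a distinguished triangle `L ⟶ Y ⟶ L' ⟶ L[1]` and of the triangle
`0 ⟶ X ⟶ X ⟶ 0`. -/
lemma biprod_distTriang (X : 𝒯) {L Y L' : 𝒯} {m : L ⟶ Y} {e : Y ⟶ L'} {η : L' ⟶ L⟦(1 : ℤ)⟧}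
    (hT : Triangle.mk m e η ∈ distTriang 𝒯) :
    Triangle.mk (biprod.lift (0 : L ⟶ X) m) (biprod.map (𝟙 X) e) (biprod.snd ≫ η) ∈
      distTriang 𝒯 := by
  -- The cone Z is compared with X ⊞ L' by maps `p` and `r`. These need not be mutually inverse, but
  -- `p ≫ r` is invertible by the five lemma and `r ≫ p` by a direct computation.
  obtain ⟨Z, v, w, hZ⟩ := distinguished_cocone_triangle (biprod.lift (0 : L ⟶ X) m)
  obtain ⟨a, ha⟩ := exists_desc₃ hZ biprod.fst (by simp)
  obtain ⟨b, hb, hb'⟩ := exists_hom₃ hZ hT (𝟙 L) biprod.snd (by simp)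
  obtain ⟨c, hc, hc'⟩ := exists_hom₃ hT hZ (𝟙 L) biprod.inr (by ext <;> simp)
  rw [CategoryTheory.Functor.map_id, Category.comp_id] at hb' hc'
  have h₁ : IsIso (c ≫ b) :=
    isIso_of_distTriang₃ hT hT (a := 𝟙 _) (b := 𝟙 _) (by simp)
      (by rw [reassoc_of% hc, hb]; simp) (by simp [← hb', ← hc']) inferInstance inferInstance
  let p : Z ⟶ X ⊞ L' := biprod.lift a b
  let r : X ⊞ L' ⟶ Z := biprod.desc (biprod.inl ≫ v) c
  have h₂ : IsIso (p ≫ r) := by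
    refine isIso_of_distTriang₃ hZ hZ (a := 𝟙 _) (b := 𝟙 _) (by simp) ?_ ?_
      inferInstance inferInstance
    · simp only [p, r, biprod.lift_desc, Preadditive.comp_add]
      rw [← reassoc_of% ha, reassoc_of% hb, hc, ← Category.assoc, ← Category.assoc,
        ← Preadditive.add_comp, biprod.total]
    · have := distTriang_comp₂₃ hZ
      simp [p, r, biprod.lift_desc, Preadditive.add_comp, this, ← hc', ← hb']
  -- `r ≫ p` is triangular, with the identity on X and the isomorphism `c ≫ b` on L'; `q` is its
  -- inverse matrix.
  let q : X ⊞ L' ⟶ X ⊞ L' :=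
    biprod.desc biprod.inl (inv (c ≫ b) ≫ (biprod.inr - (c ≫ a) ≫ biprod.inl))
  have h₃ : q ≫ r ≫ p = 𝟙 _ := by
    have e₁ : biprod.inl ≫ v ≫ a = 𝟙 X := by rw [← ha, biprod.inl_fst]
    have e₂ : biprod.inl ≫ v ≫ b = (0 : X ⟶ L') := by rw [hb]; simp
    have e₃ : c ≫ p = biprod.lift (c ≫ a) (c ≫ b) := by ext <;> simp [p]
    have e₄ : biprod.inl ≫ v ≫ p = biprod.inl := by ext <;> simp [p, e₁, e₂]
    ext1
    · simp [q, r, e₄]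
    · simp only [q, r, biprod.inr_desc_assoc, Category.assoc, Preadditive.sub_comp,
        biprod.inl_desc_assoc, e₄, e₃, Category.comp_id]
      rw [IsIso.inv_comp_eq]
      ext <;> simp
  have : IsSplitEpi p := ⟨⟨⟨q ≫ r, by simpa using h₃⟩⟩⟩
  have : Mono p := mono_of_mono p r
  have : IsIso p := isIso_of_mono_of_isSplitEpi p
  refine distTriang_of_iso hZ (Iso.refl _) (Iso.refl _) (asIso p).symm (by simp) ?_ ?_
  · simp only [Iso.symm_hom, asIso_inv, Iso.refl_hom, Category.id_comp]
    rw [IsIso.comp_inv_eq]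
    ext <;> simp [p, ← ha, hb]
  · simp [← hb', p]

/-- From distinguished triangles `L ⟶ N ⟶ M ⟶ L[1]`, `L ⟶ Y ⟶ L' ⟶ L[1]`, `M ⟶ X ⟶ M' ⟶ M[1]`
and an extension `N ⟶ Y` of `L ⟶ Y`, one obtains distinguished triangles
`N ⟶ X ⊞ Y ⟶ N' ⟶ N[1]` and `L' ⟶ N' ⟶ M' ⟶ L'[1]`. -/
lemma exists_three_by_three [IsTriangulated 𝒯] {L N M Y L' X M' : 𝒯}
    {j : L ⟶ N} {p : N ⟶ M} {ω : M ⟶ L⟦(1 : ℤ)⟧} (h₁ : Triangle.mk j p ω ∈ distTriang 𝒯)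
    {m : L ⟶ Y} {e : Y ⟶ L'} {η : L' ⟶ L⟦(1 : ℤ)⟧} (h₂ : Triangle.mk m e η ∈ distTriang 𝒯)
    {m' : M ⟶ X} {e' : X ⟶ M'} {η' : M' ⟶ M⟦(1 : ℤ)⟧}
    (h₃ : Triangle.mk m' e' η' ∈ distTriang 𝒯) (q : N ⟶ Y) (hq : j ≫ q = m)
    (hv : ∀ f : L⟦(1 : ℤ)⟧ ⟶ X, f = 0) :
    ∃ (N' : 𝒯) (x : X ⟶ N') (j' : L' ⟶ N') (θ : N' ⟶ N⟦(1 : ℤ)⟧) (p' : N' ⟶ M')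
      (ω' : M' ⟶ L'⟦(1 : ℤ)⟧),
      Triangle.mk (biprod.lift (p ≫ m') q) (biprod.desc x (e ≫ j')) θ ∈ distTriang 𝒯 ∧
      Triangle.mk j' p' ω' ∈ distTriang 𝒯 ∧ x ≫ p' = e' ∧ j' ≫ θ = η ≫ j⟦(1 : ℤ)⟧' ∧
      θ ≫ p⟦(1 : ℤ)⟧' = p' ≫ η' ∧ ω' ≫ η⟦(1 : ℤ)⟧' = -(η' ≫ ω⟦(1 : ℤ)⟧') := by
  obtain ⟨N', g, θ, hN⟩ := distinguished_cocone_triangle (biprod.lift (p ≫ m') q)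
  have comm₁ : j ≫ biprod.lift (p ≫ m') q = biprod.lift 0 m := by
    have := distTriang_comp₁₂ h₁
    ext <;> simp [reassoc_of% this, hq]
  -- The octahedron on L ⟶ N ⟶ X ⊞ Y gives a triangle M ⟶ X ⊞ L' ⟶ N'.
  let O := Triangulated.someOctahedron comm₁ h₁ hN (biprod_distTriang X h₂)
  obtain ⟨u, v, c₁, c₂, c₃, c₄, hO⟩ :
      ∃ (u : M ⟶ X ⊞ L') (v : X ⊞ L' ⟶ N'), p ≫ u = biprod.lift (p ≫ m') q ≫ biprod.map (𝟙 X) e ∧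
        u ≫ biprod.snd ≫ η = ω ∧ biprod.map (𝟙 X) e ≫ v = g ∧
        (biprod.snd ≫ η) ≫ j⟦(1 : ℤ)⟧' = v ≫ θ ∧
        Triangle.mk u v (θ ≫ p⟦(1 : ℤ)⟧') ∈ distTriang 𝒯 :=
    ⟨O.m₁, O.m₃, O.comm₁, O.comm₂, O.comm₃, O.comm₄, O.mem⟩
  -- The octahedron determines only `p ≫ u`; the remaining ambiguity factors through L[1] ⟶ X, which
  -- `hv` excludes.
  have hu : u ≫ biprod.fst = m' := by
    obtain ⟨k, hk⟩ := exists_desc₁ h₁ (u ≫ biprod.fst - m') (by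
      rw [Preadditive.comp_sub, reassoc_of% c₁]
      simp)
    rw [hv k, comp_zero, sub_eq_zero] at hk
    exact hk
  -- A second octahedron, on M ⟶ X ⊞ L' ⟶ X, gives the rotated triangle N' ⟶ M' ⟶ L'[1].
  let O' := Triangulated.someOctahedron hu hO
    (rot_of_distTriang _ (biprod_inr_fst_distTriang X L')) h₃
  obtain ⟨p', ω', d₁, d₂, d₃, d₄, hO'⟩ :
      ∃ (p' : N' ⟶ M') (ω' : M' ⟶ L'⟦(1 : ℤ)⟧), v ≫ p' = biprod.fst ≫ e' ∧
        p' ≫ η' = θ ≫ p⟦(1 : ℤ)⟧' ∧ e' ≫ ω' = 0 ∧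
        η' ≫ u⟦(1 : ℤ)⟧' = ω' ≫ (-(biprod.inr : L' ⟶ X ⊞ L')⟦(1 : ℤ)⟧') ∧
        Triangle.mk p' ω' ((-(biprod.inr : L' ⟶ X ⊞ L')⟦(1 : ℤ)⟧') ≫ v⟦(1 : ℤ)⟧') ∈
          distTriang 𝒯 :=
    ⟨O'.m₁, O'.m₃, O'.comm₁, O'.comm₂, O'.comm₃, O'.comm₄, O'.mem⟩
  refine ⟨N', biprod.inl ≫ v, biprod.inr ≫ v, θ, p', ω', ?_, ?_, ?_, ?_, d₂.symm, ?_⟩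
  · convert hN using 2
    rw [← c₃]
    ext <;> simp
  · rw [Pretriangulated.rotate_distinguished_triangle]
    have e : -((biprod.inr ≫ v)⟦(1 : ℤ)⟧') =
      (-(biprod.inr : L' ⟶ X ⊞ L')⟦(1 : ℤ)⟧') ≫ v⟦(1 : ℤ)⟧' := by simp
    change Triangle.mk p' ω' (-((biprod.inr ≫ v)⟦(1 : ℤ)⟧')) ∈ _
    rw [e]
    exact hO'
  · simp [d₁]
  · rw [Category.assoc, ← c₄]
    simp
  · have : ω' = -(η' ≫ u⟦(1 : ℤ)⟧' ≫ (biprod.snd : X ⊞ L' ⟶ L')⟦(1 : ℤ)⟧') := by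
      rw [reassoc_of% d₄, Preadditive.neg_comp, ← Functor.map_comp, biprod.inr_snd]
      simp
    rw [this, ← c₂]
    simp

/-- A morphism `c : M ⟶ L'` compatible with the connecting morphisms of distinguished triangles
`L ⟶ N ⟶ M ⟶ L[1]` and `L ⟶ Y ⟶ L' ⟶ L[1]` is part of a homotopy cartesian square. -/
lemma exists_homotopy_cartesian [IsTriangulated 𝒯] {L N M Y L' : 𝒯}
    {j : L ⟶ N} {p : N ⟶ M} {ω : M ⟶ L⟦(1 : ℤ)⟧} (h₁ : Triangle.mk j p ω ∈ distTriang 𝒯)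
    {m : L ⟶ Y} {e : Y ⟶ L'} {η : L' ⟶ L⟦(1 : ℤ)⟧} (h₂ : Triangle.mk m e η ∈ distTriang 𝒯)
    (c : M ⟶ L') (hc : c ≫ η = ω) :
    ∃ q : N ⟶ Y, j ≫ q = m ∧
      Triangle.mk (biprod.lift (-p) q) (biprod.desc c e) (η ≫ j⟦(1 : ℤ)⟧') ∈ distTriang 𝒯 := by
  -- N₀ is the homotopy fibre of `(c, e)`. The octahedron on Y ⟶ M ⊞ Y ⟶ L' shows that it sits over
  -- the same `ω` as N, so TR3 identifies the shifts of N and N₀, and the shift is fully faithful.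
  obtain ⟨N₀, r, s, hN⟩ := distinguished_cocone_triangle₁ (biprod.desc c e)
  let O := Triangulated.someOctahedron (biprod.inr_desc c e) (biprod_inr_fst_distTriang M Y)
    (rot_of_distTriang _ hN) (rot_of_distTriang _ h₂)
  obtain ⟨m₁, m₃, c₁, c₃, c₄, hO⟩ :
      ∃ (m₁ : M ⟶ L⟦(1 : ℤ)⟧) (m₃ : L⟦(1 : ℤ)⟧ ⟶ N₀⟦(1 : ℤ)⟧),
        biprod.fst ≫ m₁ = biprod.desc c e ≫ η ∧ η ≫ m₃ = s ∧
        (-m⟦(1 : ℤ)⟧') ≫ (biprod.inr : Y ⟶ M ⊞ Y)⟦(1 : ℤ)⟧' = m₃ ≫ (-r⟦(1 : ℤ)⟧') ∧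
        Triangle.mk m₁ m₃ ((-r⟦(1 : ℤ)⟧') ≫ (biprod.fst : M ⊞ Y ⟶ M)⟦(1 : ℤ)⟧') ∈
          distTriang 𝒯 :=
    ⟨O.m₁, O.m₃, O.comm₁, O.comm₃, O.comm₄, O.mem⟩
  obtain rfl : m₁ = ω := by
    have := biprod.inl ≫= c₁
    simpa [hc] using this
  have h₁' : Triangle.mk m₁ (-j⟦(1 : ℤ)⟧') (-p⟦(1 : ℤ)⟧') ∈ distTriang 𝒯 :=
    rot_of_distTriang _ (rot_of_distTriang _ h₁)
  obtain ⟨d, hd₁, hd₂⟩ := exists_hom₃ h₁' hO (𝟙 _) (𝟙 _) (by simp)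
  have hd : IsIso d := isIso_of_distTriang₃ h₁' hO (a := 𝟙 _) (b := 𝟙 _) (by simp) hd₁ hd₂
    inferInstance inferInstance
  obtain ⟨b, rfl⟩ := (shiftFunctor 𝒯 (1 : ℤ)).map_surjective d
  have hb : IsIso b := isIso_of_reflects_iso b (shiftFunctor 𝒯 (1 : ℤ))
  simp only [Category.comp_id, Category.id_comp, ← Functor.map_comp,
    ← Functor.map_neg, Preadditive.neg_comp, Preadditive.comp_neg] at hd₁ hd₂ c₄
  have e₁ : p = b ≫ r ≫ biprod.fst := by
    have := (shiftFunctor 𝒯 (1 : ℤ)).map_injective hd₂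
    simpa using this
  rw [← hd₁] at c₃ c₄
  rw [← Functor.map_comp] at c₄
  have e₂ : m ≫ biprod.inr = -(j ≫ b ≫ r) := by
    have := (shiftFunctor 𝒯 (1 : ℤ)).map_injective c₄
    simpa [neg_eq_iff_eq_neg] using this
  refine ⟨-(b ≫ r ≫ biprod.snd), ?_, ?_⟩
  · have := e₂ =≫ biprod.snd
    simp only [Category.assoc, biprod.inr_snd, Category.comp_id, Preadditive.neg_comp] at this
    rw [this, Preadditive.comp_neg]
  · refine distTriang_of_iso hN (-(asIso b)) (Iso.refl _) (Iso.refl _) ?_ (by simp) ?_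
    · ext <;> simp [e₁]
    · simp [← c₃]

end

/-! ### Inductive construction of the triangles of mapping cones and cocones. -/

section
variable {𝒯 : Type u} [Category.{v} 𝒯] [Preadditive 𝒯] [HasZeroObject 𝒯] [HasShift 𝒯 ℤ]
  [∀ k : ℤ, (shiftFunctor 𝒯 k).Additive] [Pretriangulated 𝒯]

lemma distTriang_neg {A B C : 𝒯} {f : A ⟶ B} {g : B ⟶ C} {h : C ⟶ A⟦(1 : ℤ)⟧}
    (hT : Triangle.mk f g h ∈ distTriang 𝒯) : Triangle.mk (-f) g (-h) ∈ distTriang 𝒯 :=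
  distTriang_of_iso hT (-Iso.refl _) (Iso.refl _) (Iso.refl _) (by simp) (by simp) (by simp)

/-- A sequence `L ⟶ N ⟶ M ⟶ L[1]`. -/
structure Link (L M : 𝒯) where
  /-- the middle object -/
  N : 𝒯
  /-- the first morphism -/
  j : L ⟶ N
  /-- the second morphism -/
  p : N ⟶ M
  /-- the connecting morphism -/
  ω : M ⟶ L⟦(1 : ℤ)⟧

/-- The sequence `L ⟶ N ⟶ M ⟶ L[1]` is a distinguished triangle. -/
def Link.IsDist {L M : 𝒯} (s : Link L M) : Prop := Triangle.mk s.j s.p s.ω ∈ distTriang 𝒯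

/-- A distinguished triangle `s.N ⟶ X i ⊞ Y i ⟶ s'.N` compatible with the `i`-th triangle of the
tower `Y`. -/
structure Link.IsStep (X Y : Tower 𝒯) (i : ℕ) (s : Link (Y.M i) (X.M i))
    (s' : Link (Y.M (i + 1)) (X.M (i + 1))) (q : s.N ⟶ Y.X i) (x : X.X i ⟶ s'.N)
    (θ : s'.N ⟶ s.N⟦(1 : ℤ)⟧) : Prop where
  j_q : s.j ≫ q = Y.m i
  dist : Triangle.mk (biprod.lift (s.p ≫ (-X.m i)) q) (biprod.desc x (Y.e i ≫ s'.j)) θ ∈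
    distTriang 𝒯
  j_θ : s'.j ≫ θ = Y.η i ≫ s.j⟦(1 : ℤ)⟧'
  j_p : s.j ≫ s.p = 0

/-- Compatibility of a distinguished triangle `s.N ⟶ X i ⊞ Y i ⟶ s'.N` with the `i`-th triangle of
the tower `X`. -/
structure Link.IsCompat (X Y : Tower 𝒯) (i : ℕ) (s : Link (Y.M i) (X.M i))
    (s' : Link (Y.M (i + 1)) (X.M (i + 1))) (x : X.X i ⟶ s'.N)
    (θ : s'.N ⟶ s.N⟦(1 : ℤ)⟧) : Prop where
  x_p : x ≫ s'.p = X.e i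
  θ_p : θ ≫ s.p⟦(1 : ℤ)⟧' = -(s'.p ≫ X.η i)

variable [IsTriangulated 𝒯]

/-- The induction step common to cones and cocones. The relation `hc` between the products produces
`q`, and it is inherited by the tails, so the step can be repeated. -/
lemma exists_link_step {n k : ℕ} {P : ObjectProperty 𝒯} (hP : IsRigid n P) {X Y : Tower 𝒯}
    (hX : X.IsDist (k + 1)) (hY : Y.IsDist (k + 2)) (hkn : k + 2 ≤ n)
    (hX' : ∀ i < k + 1, P (X.X i)) (hY' : ∀ i < k + 2, P (Y.X i)) (hk : P (X.M (k + 1)))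
    (hv : HomVanish (Y.M 0) (X.X 0) (-1)) (s : Link (Y.M 0) (X.M 0)) (hs : s.IsDist)
    (c : X.M (k + 1) ⟶ Y.M (k + 2))
    (hc : (X.prod (k + 1)).comp s.ω (by push_cast; ring) = c ≫ Y.prod (k + 2)) :
    ∃ (s' : Link (Y.M 1) (X.M 1)) (q : s.N ⟶ Y.X 0) (x : X.X 0 ⟶ s'.N)
      (θ : s'.N ⟶ s.N⟦(1 : ℤ)⟧), s'.IsDist ∧ Link.IsStep X Y 0 s s' q x θ ∧
      Link.IsCompat X Y 0 s s' x θ ∧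
      (X.tail.prod k).comp s'.ω (by push_cast; ring) = c ≫ Y.tail.prod (k + 1) := by
  -- The obstruction is `s.ω` followed by the shift of `Y.m 0`. By `hc` it is annihilated by the
  -- product of X, and that product is injective on it.
  obtain ⟨q, hq⟩ : ∃ q, Y.m 0 = s.j ≫ q := by
    refine exists_desc_of_comp_eq_zero hs _ ?_
    refine Tower.eq_zero_of_prod_comp hP hX hX' (hY' 0 (by omega)) le_rfl
      (by push_cast; omega) (s.ω ≫ (Y.m 0)⟦(1 : ℤ)⟧') (l := (k + 1 + 1 : ℕ)) (by push_cast; ring) ?_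
    have := Tower.tail_prod_comp_map Y (k + 1) (Y.m 0)
    rw [distTriang_comp₃₁ (hY 0 (by omega)), ShiftedHom.comp_zero] at this
    rw [← ShiftedHom.comp_mk₀ s.ω 0 rfl]
    refine (ShiftedHom.comp_assoc (a₁₂ := ((k + 2 : ℕ) : ℤ)) (X.prod (k + 1)) s.ω _
      (by push_cast; ring) (zero_add _) (by push_cast; ring)).symm.trans ?_
    rw [hc, ShiftedHom.comp_mk₀, Category.assoc, ← this, comp_zero]
  -- Negating the triangle of X introduces the sign of the cone differential, and turns the
  -- anticommutative square of connecting morphisms into a commutative one.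
  obtain ⟨N', x, j', θ, p', ω', h₁, h₂, h₃, h₄, h₅, h₆⟩ := exists_three_by_three hs
    (hY 0 (by omega)) (distTriang_neg (hX 0 (by omega))) q hq.symm
    (homVanish_zero.1 ((homVanish_shift_left (by norm_num)).2 hv))
  rw [Preadditive.neg_comp, neg_neg] at h₆
  refine ⟨⟨N', j', p', ω'⟩, q, x, θ, h₂, ⟨hq.symm, h₁, h₄, distTriang_comp₁₂ hs⟩,
    ⟨h₃, by simpa using h₅⟩, ?_⟩
  rw [← sub_eq_zero]
  -- The two products agree after `Y.η 0`, so their difference lifts to `Y.X 0` shifted by `k + 1`,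
  -- where rigidity applies.
  obtain ⟨y, hy⟩ := exists_lift_of_comp_eq_zero (hY 0 (by omega)) (j := (k + 1 : ℕ))
    (k := (k + 2 : ℕ))
    ((X.tail.prod k).comp ω' (by push_cast; ring) - c ≫ Y.tail.prod (k + 1))
    (by push_cast; ring) (by
      rw [sub_eq_add_neg, ShiftedHom.add_comp, ShiftedHom.neg_comp, ← sub_eq_add_neg, sub_eq_zero]
      refine (ShiftedHom.comp_assoc (X.tail.prod k) ω' (Y.η 0) _ (a₂₃ := (2 : ℤ)) (by norm_num)
        (by push_cast; ring)).trans ?_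
      have e₁ : ShiftedHom.comp ω' (Y.η 0) (show (1 : ℤ) + 1 = 2 by norm_num) =
          ShiftedHom.comp (X.η 0) s.ω (show (1 : ℤ) + 1 = 2 by norm_num) := by
        simp only [ShiftedHom.comp]
        rw [reassoc_of% h₆]
      rw [e₁]
      refine (ShiftedHom.comp_assoc (X.tail.prod k) (X.η 0) s.ω (a₁₂ := ((k + 1 : ℕ) : ℤ))
        (by push_cast; ring) _ (by push_cast; ring)).symm.trans ?_
      rw [← Tower.prod_succ', hc, Tower.prod_succ' Y (k + 1)]
      simp only [ShiftedHom.comp, Category.assoc])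
  rw [hy, hP hk (hY' 0 (by omega)) _ (by push_cast; omega) (by push_cast; omega)
    (by push_cast; omega) y, zero_comp]

/-- The distinguished triangles decomposing the mapping cone of a morphism of towers. -/
lemma exists_cone_chain {n k : ℕ} {P : ObjectProperty 𝒯} (hP : IsRigid n P) {X Y : Tower 𝒯}
    (hX : X.IsDist k) (hY : Y.IsDist (k + 1)) (hkn : k + 1 ≤ n)
    (hX' : ∀ i < k, P (X.X i)) (hY' : ∀ i < k + 1, P (Y.X i)) (hk : P (X.M k))
    (hv : ∀ i < k, HomVanish (Y.M i) (X.X i) (-1)) (hm : IsIso (X.m k))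
    (s₀ : Link (Y.M 0) (X.M 0)) (hs : s₀.IsDist) (c : X.M k ⟶ Y.M (k + 1))
    (hc : (X.prod k).comp s₀.ω (by push_cast; ring) = c ≫ Y.prod (k + 1)) :
    ∃ (s : ∀ i, Link (Y.M i) (X.M i)) (q : ∀ i, (s i).N ⟶ Y.X i)
      (x : ∀ i, X.X i ⟶ (s (i + 1)).N) (θ : ∀ i, (s (i + 1)).N ⟶ (s i).N⟦(1 : ℤ)⟧),
      s 0 = s₀ ∧ (∀ i < k + 1, Link.IsStep X Y i (s i) (s (i + 1)) (q i) (x i) (θ i)) ∧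
      (∀ i < k, Link.IsCompat X Y i (s i) (s (i + 1)) (x i) (θ i)) ∧
      IsIso (s (k + 1)).j ∧ X.m k ≫ x k = c ≫ (s (k + 1)).j := by
  induction k generalizing X Y with
  | zero =>
    -- No triangle of X remains and `hc` reads `s₀.ω = c ≫ Y.η 0`. The homotopy cartesian square
    -- closes the chain with `Y.M 1` itself as its last object.
    obtain ⟨q, hq, hT⟩ := exists_homotopy_cartesian hs (hY 0 (by omega)) c (by
      have h := (ShiftedHom.mk₀_id_comp ((0 : ℕ) : ℤ) (by simp) s₀.ω).symm.trans hc
      rw [Tower.prod_succ, Tower.prod_zero, ShiftedHom.comp_mk₀_id] at h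
      exact h.symm)
    refine ⟨fun | 0 => s₀ | i + 1 => ⟨Y.M (i + 1), 𝟙 _, 0, 0⟩, fun | 0 => q | i + 1 => 0,
      fun | 0 => inv (X.m 0) ≫ c | i + 1 => 0, fun | 0 => Y.η 0 ≫ s₀.j⟦(1 : ℤ)⟧' | i + 1 => 0,
      rfl, ?_, fun i hi => by omega, inferInstanceAs (IsIso (𝟙 _)), by simp⟩
    intro i hi
    obtain rfl : i = 0 := by omega
    refine ⟨hq, ?_, by simp, distTriang_comp₁₂ hs⟩
    refine distTriang_of_iso hT (Iso.refl _) (biprod.mapIso (asIso (X.m 0)).symm (Iso.refl _))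
      (Iso.refl _) ?_ ?_ (by simp)
    · ext <;> simp
    · ext <;> simp
  | succ k ih =>
    obtain ⟨s₁, q, x, θ, hs₁, h₁, h₂, h₃⟩ := exists_link_step hP hX hY hkn hX' hY' hk
      (hv 0 (by omega)) s₀ hs c hc
    obtain ⟨s, q', x', θ', rfl, h₁', h₂', h₃', h₄'⟩ := ih hX.tail hY.tail (by omega)
      (fun i hi => hX' (i + 1) (by omega)) (fun i hi => hY' (i + 1) (by omega)) hk
      (fun i hi => hv (i + 1) (by omega)) hm s₁ hs₁ c h₃
    refine ⟨fun | 0 => s₀ | i + 1 => s i, fun | 0 => q | i + 1 => q' i,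
      fun | 0 => x | i + 1 => x' i, fun | 0 => θ | i + 1 => θ' i, rfl, ?_, ?_, h₃', h₄'⟩
    · rintro (_ | i) hi
      · exact h₁
      · obtain ⟨a, b, c, d⟩ := h₁' i (by omega)
        exact ⟨a, b, c, d⟩
    · rintro (_ | i) hi
      · exact h₂
      · obtain ⟨a, b⟩ := h₂' i (by omega)
        exact ⟨a, b⟩

/-- The distinguished triangles decomposing the mapping cocone of a morphism of towers. -/
lemma exists_cocone_chain {n k : ℕ} {P : ObjectProperty 𝒯} (hP : IsRigid n P) {X Y : Tower 𝒯}
    (hX : X.IsDist k) (hY : Y.IsDist (k + 1)) (hkn : k + 1 ≤ n)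
    (hX' : ∀ i < k, P (X.X i)) (hY' : ∀ i < k + 1, P (Y.X i)) (hk : P (X.M k))
    (hv : ∀ i < k, HomVanish (Y.M i) (X.X i) (-1))
    (s₀ : Link (Y.M 0) (X.M 0)) (hs : s₀.IsDist) (c : X.M k ⟶ Y.M (k + 1))
    (hc : (X.prod k).comp s₀.ω (by push_cast; ring) = c ≫ Y.prod (k + 1)) :
    ∃ (s : ∀ i, Link (Y.M i) (X.M i)) (q : ∀ i, (s i).N ⟶ Y.X i)
      (x : ∀ i, X.X i ⟶ (s (i + 1)).N) (θ : ∀ i, (s (i + 1)).N ⟶ (s i).N⟦(1 : ℤ)⟧),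
      s 0 = s₀ ∧ (∀ i < k, Link.IsStep X Y i (s i) (s (i + 1)) (q i) (x i) (θ i)) ∧
      (∀ i < k, Link.IsCompat X Y i (s i) (s (i + 1)) (x i) (θ i)) ∧
      (s k).IsDist ∧ (s k).ω = c ≫ Y.η k := by
  induction k generalizing X Y with
  | zero =>
    -- The chain stops one step earlier than for the cone; only the link of index 0 matters here,
    -- the other values being placeholders.
    refine ⟨fun | 0 => s₀ | i + 1 => ⟨Y.M (i + 1), 𝟙 _, 0, 0⟩, 0, 0, 0,
      rfl, fun i hi => by omega, fun i hi => by omega, hs, ?_⟩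
    have h := (ShiftedHom.mk₀_id_comp ((0 : ℕ) : ℤ) (by simp) s₀.ω).symm.trans hc
    rw [Tower.prod_succ, Tower.prod_zero, ShiftedHom.comp_mk₀_id] at h
    exact h
  | succ k ih =>
    obtain ⟨s₁, q, x, θ, hs₁, h₁, h₂, h₃⟩ := exists_link_step hP hX hY hkn hX' hY' hk
      (hv 0 (by omega)) s₀ hs c hc
    obtain ⟨s, q', x', θ', rfl, h₁', h₂', h₃', h₄'⟩ := ih hX.tail hY.tail (by omega)
      (fun i hi => hX' (i + 1) (by omega)) (fun i hi => hY' (i + 1) (by omega)) hk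
      (fun i hi => hv (i + 1) (by omega)) s₁ hs₁ c h₃
    refine ⟨fun | 0 => s₀ | i + 1 => s i, fun | 0 => q | i + 1 => q' i,
      fun | 0 => x | i + 1 => x' i, fun | 0 => θ | i + 1 => θ' i, rfl, ?_, ?_, h₃', h₄'⟩
    · rintro (_ | i) hi
      · exact h₁
      · obtain ⟨a, b, c, d⟩ := h₁' i (by omega)
        exact ⟨a, b, c, d⟩
    · rintro (_ | i) hi
      · exact h₂
      · obtain ⟨a, b⟩ := h₂' i (by omega)
        exact ⟨a, b⟩

end

/-! ### Shifts of triangles and the calculus of extension products. -/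

section
variable {𝒯 : Type u} [Category.{v} 𝒯] [Preadditive 𝒯] [HasZeroObject 𝒯] [HasShift 𝒯 ℤ]
  [∀ k : ℤ, (shiftFunctor 𝒯 k).Additive] [Pretriangulated 𝒯]

lemma exists_shift_distTriang {A B C : 𝒯} {f : A ⟶ B} {g : B ⟶ C} {h : C ⟶ A⟦(1 : ℤ)⟧}
    (hT : Triangle.mk f g h ∈ distTriang 𝒯) (a : ℤ) :
    ∃ h', Triangle.mk (f⟦a⟧') (g⟦a⟧') h' ∈ distTriang 𝒯 := by
  have H : Triangle.mk (a.negOnePow • f⟦a⟧') (a.negOnePow • g⟦a⟧')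
      (a.negOnePow • h⟦a⟧' ≫ (shiftFunctorComm 𝒯 1 a).hom.app A) ∈ distTriang 𝒯 :=
    Triangle.shift_distinguished _ hT a
  -- The automorphism (-1)^a of the middle object removes the signs of the first two maps.
  let ε : B⟦a⟧ ≅ B⟦a⟧ := ⟨a.negOnePow • 𝟙 _, a.negOnePow • 𝟙 _,
    by simp [Linear.comp_units_smul, smul_smul],
    by simp [Linear.comp_units_smul, smul_smul]⟩
  refine ⟨a.negOnePow • h⟦a⟧' ≫ (shiftFunctorComm 𝒯 1 a).hom.app A,
    distTriang_of_iso H (Iso.refl _) ε (Iso.refl _) ?_ ?_ ?_⟩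
  · simp [ε, Linear.comp_units_smul]
  · simp [ε, Linear.units_smul_comp, smul_smul]
  · simp

lemma shifted_shifted (P : ObjectProperty 𝒯) {a b c : ℤ} (h : a + b = c) :
    shifted (shifted P a) b = shifted P c := by
  ext X
  simp only [ObjectProperty.prop_map_iff]
  constructor
  · rintro ⟨Y, ⟨Z, hZ, ⟨e⟩⟩, ⟨e'⟩⟩
    exact ⟨Z, hZ, ⟨(shiftFunctorAdd' 𝒯 a b c h).app Z ≪≫ (shiftFunctor 𝒯 b).mapIso e ≪≫ e'⟩⟩
  · rintro ⟨Z, hZ, ⟨e⟩⟩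
    exact ⟨Z⟦a⟧, ⟨Z, hZ, ⟨Iso.refl _⟩⟩, ⟨((shiftFunctorAdd' 𝒯 a b c h).app Z).symm ≪≫ e⟩⟩

lemma shifted_mono {P Q : ObjectProperty 𝒯} (h : P ≤ Q) (a : ℤ) : shifted P a ≤ shifted Q a := by
  intro X
  simp only [ObjectProperty.prop_map_iff]
  rintro ⟨Z, hZ, e⟩
  exact ⟨Z, h _ hZ, e⟩

/-- An extension of shifted objects is the shift of an extension. -/
lemma exists_unshift_distTriang {A B C : 𝒯} {a : ℤ} {f : A⟦a⟧ ⟶ B} {g : B ⟶ C⟦a⟧}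
    {h : C⟦a⟧ ⟶ A⟦a⟧⟦(1 : ℤ)⟧} (hT : Triangle.mk f g h ∈ distTriang 𝒯) :
    ∃ (B' : 𝒯) (f' : A ⟶ B') (g' : B' ⟶ C) (h' : C ⟶ A⟦(1 : ℤ)⟧) (b : B'⟦a⟧ ≅ B),
      Triangle.mk f' g' h' ∈ distTriang 𝒯 ∧ f'⟦a⟧' ≫ b.hom = f ∧ b.hom ≫ g = g'⟦a⟧' := by
  obtain ⟨w, hw⟩ := (shiftFunctor 𝒯 a).map_surjective (h ≫ (shiftFunctorComm 𝒯 1 a).inv.app A)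
  obtain ⟨V, f', g', hT'⟩ := distinguished_cocone_triangle₂ (a.negOnePow • w)
  have H : Triangle.mk (a.negOnePow • f'⟦a⟧') (a.negOnePow • g'⟦a⟧')
    (a.negOnePow • (a.negOnePow • w)⟦a⟧' ≫ (shiftFunctorComm 𝒯 1 a).hom.app A) ∈
      distTriang 𝒯 := Triangle.shift_distinguished _ hT' a
  have hc : (a.negOnePow • (a.negOnePow • w)⟦a⟧' ≫ (shiftFunctorComm 𝒯 1 a).hom.app A) ≫
      (𝟙 (A⟦a⟧))⟦(1 : ℤ)⟧' = 𝟙 (C⟦a⟧) ≫ h := by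
    rw [Functor.map_units_smul]
    simp [hw, Linear.units_smul_comp, smul_smul]
  obtain ⟨b, hb₁, hb₂⟩ := exists_hom₂ H hT (𝟙 _) (𝟙 _) hc
  have := isIso_of_distTriang₂ H hT hb₁ hb₂ hc inferInstance inferInstance
  refine ⟨V, f', g', _, ⟨a.negOnePow • b, a.negOnePow • inv b, ?_, ?_⟩, hT', ?_, ?_⟩
  · simp [Linear.units_smul_comp, Linear.comp_units_smul, smul_smul]
  · simp [Linear.units_smul_comp, Linear.comp_units_smul, smul_smul]
  · simpa [Linear.units_smul_comp, Linear.comp_units_smul] using hb₁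
  · rw [Linear.units_smul_comp, ← hb₂]
    simp [smul_smul]

lemma shifted_extensionProduct (P Q : ObjectProperty 𝒯) (a : ℤ) :
    shifted (ObjectProperty.extensionProduct P Q) a =
      ObjectProperty.extensionProduct (shifted P a) (shifted Q a) := by
  apply le_antisymm
  · intro X hX
    obtain ⟨X', ⟨Y, Z, f, g, h, hT, hY, hZ⟩, ⟨e⟩⟩ := (ObjectProperty.prop_map_iff _ _ _).1 hX
    obtain ⟨h', hT'⟩ := exists_shift_distTriang hT a
    exact ObjectProperty.prop_of_iso _ e ⟨_, _, _, _, _, hT',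
      ObjectProperty.prop_map_obj _ _ hY, ObjectProperty.prop_map_obj _ _ hZ⟩
  · intro X ⟨Y, Z, f, g, h, hT, hY, hZ⟩
    obtain ⟨Y', hY', ⟨e⟩⟩ := (ObjectProperty.prop_map_iff _ _ _).1 hY
    obtain ⟨Z', hZ', ⟨e'⟩⟩ := (ObjectProperty.prop_map_iff _ _ _).1 hZ
    have hT₁ : Triangle.mk (e.hom ≫ f) (g ≫ e'.inv) (e'.hom ≫ h ≫ e.inv⟦(1 : ℤ)⟧') ∈
        distTriang 𝒯 :=
      distTriang_of_iso hT e (Iso.refl _) e' (by simp) (by simp) (by simp [← Functor.map_comp])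
    obtain ⟨V, f', g', h', b, hT', -, -⟩ := exists_unshift_distTriang hT₁
    exact (ObjectProperty.prop_map_iff _ _ _).2 ⟨V, ⟨_, _, _, _, _, hT', hY', hZ'⟩, ⟨b⟩⟩

variable {S : ObjectProperty 𝒯}

instance [S.ContainsZero] (a : ℤ) : (shifted S a).ContainsZero where
  exists_zero := by
    obtain ⟨Z, hZ, h⟩ := S.exists_prop_of_containsZero
    exact ⟨_, (shiftFunctor 𝒯 a).map_isZero hZ, ObjectProperty.prop_map_obj _ _ h⟩

instance [S.IsClosedUnderIsomorphisms] (k : ℕ) : (starShifts S k).IsClosedUnderIsomorphisms := by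
  cases k with
  | zero => assumption
  | succ k => exact inferInstanceAs (ObjectProperty.extensionProduct _ _).IsClosedUnderIsomorphisms

lemma le_starShifts [S.ContainsZero] (k : ℕ) : S ≤ starShifts S k := by
  induction k with
  | zero => exact le_rfl
  | succ k ih => exact ih.trans (ObjectProperty.le_extensionProduct_left _)

instance [S.ContainsZero] (k : ℕ) : (starShifts S k).ContainsZero where
  exists_zero := by
    obtain ⟨Z, hZ, h⟩ := S.exists_prop_of_containsZero
    exact ⟨Z, hZ, le_starShifts k _ h⟩

lemma starShifts_obj_mem [S.IsClosedUnderIsomorphisms] [S.ContainsZero] (k : ℕ) {X : 𝒯}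
    (hX : S X) : starShifts S k (X⟦(k : ℤ)⟧) := by
  cases k with
  | zero => exact S.prop_of_iso ((shiftFunctorZero' 𝒯 ((0 : ℕ) : ℤ) (by simp)).symm.app X) hX
  | succ k =>
    exact ObjectProperty.le_extensionProduct_right (starShifts S k) _
      (ObjectProperty.prop_map_obj _ _ hX)

/-- Associativity of the extension product allows the bottom layer to be split off instead of the
top one. -/
lemma starShifts_succ' [IsTriangulated 𝒯] (S : ObjectProperty 𝒯) (k : ℕ) :
    starShifts S (k + 1) = ObjectProperty.extensionProduct S (shifted (starShifts S k) 1) := by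
  induction k with
  | zero => rfl
  | succ k ih =>
    change ObjectProperty.extensionProduct (starShifts S (k + 1)) _ =
      ObjectProperty.extensionProduct S (shifted (ObjectProperty.extensionProduct _ _) 1)
    rw [shifted_extensionProduct, ih, ObjectProperty.extensionProduct_assoc,
      shifted_shifted S (show ((k + 1 : ℕ) : ℤ) + 1 = (k + 1 + 1 : ℕ) by push_cast; ring)]

/-- If `P[i] * P ⊆ P * P[1] * ⋯ * P[i]` for `i < n`, then `P * P[1] * ⋯ * P[n - 1]` is closed under
extensions. -/
lemma starShifts_extensionProduct_le [IsTriangulated 𝒯] {n : ℕ}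
    (h₀ : ObjectProperty.extensionProduct S S ≤ S)
    (hstar : ∀ i : ℕ, 1 ≤ i → i < n →
      ObjectProperty.extensionProduct (shifted S (i : ℤ)) S ≤ starShifts S i) (b : ℕ) (hb : b < n) :
    ObjectProperty.extensionProduct (starShifts S b) (starShifts S b) ≤ starShifts S b := by
  -- If each single layer S[k] with k ≤ b is absorbed, so is any block S[k] * ⋯ * S[k + j] with k +
  -- j ≤ b, one layer after the other.
  have claim : ∀ (b : ℕ), (∀ k ≤ b, ObjectProperty.extensionProduct (starShifts S b)
      (shifted S (k : ℤ)) ≤ starShifts S b) → ∀ k j : ℕ, k + j ≤ b →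
      ObjectProperty.extensionProduct (starShifts S b) (shifted (starShifts S j) (k : ℤ)) ≤
        starShifts S b := by
    intro b h k j hj
    induction j with
    | zero => exact h k hj
    | succ j ih =>
      change ObjectProperty.extensionProduct _ (shifted (ObjectProperty.extensionProduct _ _) _) ≤ _
      rw [shifted_extensionProduct, ← ObjectProperty.extensionProduct_assoc,
        shifted_shifted S (show ((j + 1 : ℕ) : ℤ) + (k : ℤ) = (k + (j + 1) : ℕ) by push_cast; ring)]
      exact (ObjectProperty.monotone_extensionProduct_left _ (ih (by omega))).trans
        (h _ (by omega))
  have main : ∀ b < n, ∀ k ≤ b, ObjectProperty.extensionProduct (starShifts S b)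
      (shifted S (k : ℤ)) ≤ starShifts S b := by
    intro b hb
    induction b with
    | zero =>
      intro k hk
      obtain rfl : k = 0 := by omega
      refine le_trans ?_ h₀
      intro X ⟨Y, Z, f, g, h, hT, hY, hZ⟩
      obtain ⟨Z', hZ', ⟨e⟩⟩ := (ObjectProperty.prop_map_iff _ _ _).1 hZ
      have e' : Z ≅ Z' := e.symm ≪≫ (shiftFunctorZero' 𝒯 ((0 : ℕ) : ℤ) (by simp)).app Z'
      exact ⟨Y, Z', f, g ≫ e'.hom, e'.inv ≫ h, distTriang_of_iso hT (Iso.refl _) (Iso.refl _)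
        e'.symm (by simp) (by simp) (by simp), hY, hZ'⟩
    | succ b ih =>
      intro k hk
      have ih := ih (by omega)
      change ObjectProperty.extensionProduct (ObjectProperty.extensionProduct _ _) _ ≤ _
      rw [ObjectProperty.extensionProduct_assoc]
      -- The top layer S[b + 1] either meets S[b + 1], or must be moved past S[k] with k ≤ b: the
      -- shifted hypothesis puts S[b + 1] * S[k] inside S[k] * ⋯ * S[b + 1], whose layers below S[b
      -- + 1] are absorbed by induction.
      rcases Nat.lt_or_ge b k with hk' | hk'
      · obtain rfl : k = b + 1 := by omega
        rw [← shifted_extensionProduct]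
        exact ObjectProperty.monotone_extensionProduct_right _ (shifted_mono h₀ _)
      · obtain ⟨d, rfl⟩ := Nat.exists_eq_add_of_le hk'
        have h₁ := shifted_mono (hstar (d + 1) (by omega) (by omega)) (k : ℤ)
        rw [shifted_extensionProduct,
          shifted_shifted S (show ((d + 1 : ℕ) : ℤ) + (k : ℤ) = (k + d + 1 : ℕ) by
            push_cast; ring)] at h₁
        refine (ObjectProperty.monotone_extensionProduct_right _ h₁).trans ?_
        change ObjectProperty.extensionProduct _ (shifted (ObjectProperty.extensionProduct _ _) _) ≤ _
        rw [shifted_extensionProduct, ← ObjectProperty.extensionProduct_assoc,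
          shifted_shifted S (show ((d + 1 : ℕ) : ℤ) + (k : ℤ) = (k + d + 1 : ℕ) by
            push_cast; ring)]
        exact ObjectProperty.monotone_extensionProduct_left _ (claim _ ih k d le_rfl)
  intro X ⟨Y, Z, f, g, h, hT, hY, hZ⟩
  refine claim b (main b hb) 0 b (by omega) X ⟨Y, Z⟦((0 : ℕ) : ℤ)⟧, f,
    g ≫ (shiftFunctorZero' 𝒯 ((0 : ℕ) : ℤ) (by simp)).inv.app Z,
    (shiftFunctorZero' 𝒯 ((0 : ℕ) : ℤ) (by simp)).hom.app Z ≫ h, ?_, hY,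
    ObjectProperty.prop_map_obj _ _ hZ⟩
  exact distTriang_of_iso hT (Iso.refl _) (Iso.refl _)
    ((shiftFunctorZero' 𝒯 ((0 : ℕ) : ℤ) (by simp)).app Z) (by simp) (by simp) (by simp)

end

/-! ### Towers as iterated extensions, and factorization of extensions. -/

section
variable {𝒯 : Type u} [Category.{v} 𝒯] [Preadditive 𝒯] [HasZeroObject 𝒯] [HasShift 𝒯 ℤ]
  [∀ k : ℤ, (shiftFunctor 𝒯 k).Additive] [Pretriangulated 𝒯]

lemma distTriang_of_rot {A B C : 𝒯} {f : A ⟶ B} {g : B ⟶ C} {h : C ⟶ A⟦(1 : ℤ)⟧}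
    (hT : Triangle.mk g h (-f⟦(1 : ℤ)⟧') ∈ distTriang 𝒯) : Triangle.mk f g h ∈ distTriang 𝒯 :=
  (Pretriangulated.rotate_distinguished_triangle _).2 hT

lemma exists_iso₁ {A B C A' B' C' : 𝒯} {f : A ⟶ B} {g : B ⟶ C} {h : C ⟶ A⟦(1 : ℤ)⟧}
    {f' : A' ⟶ B'} {g' : B' ⟶ C'} {h' : C' ⟶ A'⟦(1 : ℤ)⟧}
    (hT : Triangle.mk f g h ∈ distTriang 𝒯) (hT' : Triangle.mk f' g' h' ∈ distTriang 𝒯)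
    (b : B ≅ B') (c : C ≅ C') (hbc : g ≫ c.hom = b.hom ≫ g') : Nonempty (A ≅ A') := by
  have r : Triangle.mk g h (-f⟦(1 : ℤ)⟧') ∈ distTriang 𝒯 := rot_of_distTriang _ hT
  have r' : Triangle.mk g' h' (-f'⟦(1 : ℤ)⟧') ∈ distTriang 𝒯 := rot_of_distTriang _ hT'
  obtain ⟨a, ha₁, ha₂⟩ := exists_hom₃ r r' b.hom c.hom hbc
  have := isIso_of_distTriang₃ r r' hbc ha₁ ha₂ inferInstance inferInstance
  exact ⟨(shiftFunctor 𝒯 (1 : ℤ)).preimageIso (asIso a)⟩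

namespace Tower

/-- The tower obtained by adding a triangle at the beginning. -/
abbrev cons (t : Tower 𝒯) {M X : 𝒯} (m : M ⟶ X) (e : X ⟶ t.M 0) (η : t.M 0 ⟶ M⟦(1 : ℤ)⟧) :
    Tower 𝒯 where
  M | 0 => M | i + 1 => t.M i
  X | 0 => X | i + 1 => t.X i
  m | 0 => m | i + 1 => t.m i
  e | 0 => e | i + 1 => t.e i
  η | 0 => η | i + 1 => t.η i

/-- The tower with a single object `M 0 = M`, with no requirement on the morphisms. -/
abbrev const (M : 𝒯) : Tower 𝒯 where
  M _ := M
  X _ := M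
  m _ := 0
  e _ := 0
  η _ := 0

lemma isDist_zero (t : Tower 𝒯) : t.IsDist 0 := fun _ h => absurd h (Nat.not_lt_zero _)

lemma IsDist.cons {t : Tower 𝒯} {k : ℕ} (ht : t.IsDist k) {M X : 𝒯} {m : M ⟶ X}
    {e : X ⟶ t.M 0} {η : t.M 0 ⟶ M⟦(1 : ℤ)⟧} (h : Triangle.mk m e η ∈ distTriang 𝒯) :
    (t.cons m e η).IsDist (k + 1) := by
  rintro (_ | i) hi
  · exact h
  · exact ht i (by omega)

variable {S : ObjectProperty 𝒯}

/-- Adding a triangle at the end of a tower. -/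
lemma exists_snoc (k : ℕ) (t : Tower 𝒯) (ht : t.IsDist k) {X M : 𝒯} {m : t.M k ⟶ X}
    {e : X ⟶ M} {η : M ⟶ (t.M k)⟦(1 : ℤ)⟧} (h : Triangle.mk m e η ∈ distTriang 𝒯)
    (hS : ∀ i < k, S (t.X i)) :
    ∃ (t' : Tower 𝒯) (_ : t'.M 0 ≅ t.M 0) (x : t'.X k ≅ X) (c : t'.M (k + 1) ≅ M),
      t'.IsDist (k + 1) ∧ (∀ i < k, S (t'.X i)) ∧ t'.e k ≫ c.hom = x.hom ≫ e := by
  induction k generalizing t with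
  | zero =>
    exact ⟨(const M).cons m e η, Iso.refl _, Iso.refl _, Iso.refl _, (isDist_zero _).cons h,
      fun i hi => absurd hi (Nat.not_lt_zero _), by simp⟩
  | succ k ih =>
    obtain ⟨t', a, x, c, h₁, h₂, h₃⟩ := ih t.tail ht.tail h (fun i hi => hS (i + 1) (by omega))
    refine ⟨t'.cons (t.m 0) (t.e 0 ≫ a.inv) (a.hom ≫ t.η 0), Iso.refl _, x, c, h₁.cons ?_, ?_, h₃⟩
    · exact distTriang_of_iso (ht 0 (by omega)) (Iso.refl _) (Iso.refl _) a (by simp) (by simp)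
        (by simp)
    · rintro (_ | i) hi
      · exact hS 0 (by omega)
      · exact h₂ i (by omega)

/-- The top layer of the shifted M unshifts to a map from M to an object of S, the first map of the
tower; the lower layers describe its cone. Together with its converse `starShifts_shift_of_isDist`,
this serves to recognise inflations. -/
lemma exists_of_starShifts_shift [S.IsClosedUnderIsomorphisms] (k : ℕ) (M : 𝒯)
    (hM : starShifts S k (M⟦(k : ℤ)⟧)) :
    ∃ t : Tower 𝒯, t.M 0 = M ∧ t.IsDist k ∧ (∀ i < k, S (t.X i)) ∧ S (t.M k) := by
  induction k generalizing M with
  | zero =>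
    exact ⟨const M, rfl, isDist_zero _, fun i hi => absurd hi (Nat.not_lt_zero _),
      S.prop_of_iso ((shiftFunctorZero' 𝒯 ((0 : ℕ) : ℤ) (by simp)).app M) hM⟩
  | succ k ih =>
    obtain ⟨Z, W, f, g, h, hT, hZ, hW⟩ := hM
    obtain ⟨Q, hQ, ⟨e⟩⟩ := (ObjectProperty.prop_map_iff _ _ _).1 hW
    obtain ⟨u, hu⟩ := (shiftFunctor 𝒯 ((k + 1 : ℕ) : ℤ)).map_surjective (g ≫ e.inv)
    obtain ⟨V, v, w, hV⟩ := distinguished_cocone_triangle₁ u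
    obtain ⟨h', hV'⟩ := exists_shift_distTriang hV ((k + 1 : ℕ) : ℤ)
    obtain ⟨i⟩ := exists_iso₁ hT hV' (Iso.refl _) e.symm
      (by rw [Iso.refl_hom, Iso.symm_hom, Category.id_comp, hu])
    obtain ⟨M', w', η, hM', ⟨j⟩⟩ : ∃ (M' : 𝒯) (w' : Q ⟶ M') (η : M' ⟶ M⟦(1 : ℤ)⟧),
        Triangle.mk u w' η ∈ distTriang 𝒯 ∧ Nonempty (V⟦(1 : ℤ)⟧ ≅ M') :=
      ⟨_, _, _, rot_of_distTriang _ hV, ⟨Iso.refl _⟩⟩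
    obtain ⟨t, rfl, h₁, h₂, h₃⟩ := ih M' (ObjectProperty.prop_of_iso _ (i ≪≫
      (shiftFunctorAdd' 𝒯 1 (k : ℤ) ((k + 1 : ℕ) : ℤ) (by push_cast; ring)).app V ≪≫
        (shiftFunctor 𝒯 (k : ℤ)).mapIso j) hZ)
    refine ⟨t.cons u w' η, rfl, h₁.cons hM', ?_, h₃⟩
    · rintro (_ | i) hi
      · exact hQ
      · exact h₂ i (by omega)

lemma starShifts_shift_of_isDist [S.IsClosedUnderIsomorphisms] (k : ℕ) (t : Tower 𝒯)
    (ht : t.IsDist k) (hS : ∀ i < k, S (t.X i)) (hk : S (t.M k)) :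
    starShifts S k ((t.M 0)⟦(k : ℤ)⟧) := by
  induction k generalizing t with
  | zero => exact S.prop_of_iso ((shiftFunctorZero' 𝒯 ((0 : ℕ) : ℤ) (by simp)).symm.app _) hk
  | succ k ih =>
    have h := ih t.tail ht.tail (fun i hi => hS (i + 1) (by omega)) hk
    obtain ⟨h', hT⟩ := exists_shift_distTriang (inv_rot_of_distTriang _ (ht 0 (by omega)))
      ((k + 1 : ℕ) : ℤ)
    exact ⟨_, _, _, _, _, hT, ObjectProperty.prop_of_iso _ ((shiftFunctorAdd' 𝒯 (-1)
      ((k + 1 : ℕ) : ℤ) (k : ℤ) (by push_cast; ring)).app _) h,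
      ObjectProperty.prop_map_obj _ _ (hS 0 (by omega))⟩

variable [IsTriangulated 𝒯]

/-- The rotated triangle X k ⟶ M (k + 1) ⟶ M k[1] adds one layer at the bottom. This description by
resolutions serves to recognise deflations. -/
lemma starShifts_of_isDist (k : ℕ) (t : Tower 𝒯)
    (ht : t.IsDist k) (hS : ∀ i < k, S (t.X i)) (h₀ : S (t.M 0)) :
    starShifts S k (t.M k) := by
  induction k with
  | zero => exact h₀
  | succ k ih =>
    rw [starShifts_succ']
    exact ⟨_, _, _, _, _, rot_of_distTriang _ (ht k (by omega)), hS k (by omega),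
      ObjectProperty.prop_map_obj _ _ (ih (ht.mono (by omega)) (fun i hi => hS i (by omega)))⟩

lemma exists_of_starShifts [S.IsClosedUnderIsomorphisms] (k : ℕ) {M X M' : 𝒯} {m : M ⟶ X}
    {e : X ⟶ M'} {η : M' ⟶ M⟦(1 : ℤ)⟧} (h : Triangle.mk m e η ∈ distTriang 𝒯)
    (hM : starShifts S k M) (hX : S X) :
    ∃ (t : Tower 𝒯) (x : t.X k ≅ X) (c : t.M (k + 1) ≅ M'), t.IsDist (k + 1) ∧ S (t.M 0) ∧
      (∀ i < k + 1, S (t.X i)) ∧ t.e k ≫ c.hom = x.hom ≫ e := by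
  suffices ∃ (t : Tower 𝒯) (_ : t.M k ≅ M), t.IsDist k ∧ S (t.M 0) ∧ (∀ i < k, S (t.X i)) by
    obtain ⟨t, i, h₁, h₂, h₃⟩ := this
    obtain ⟨t', a, x, c, h₄, h₅, h₆⟩ := exists_snoc k t h₁ (m := i.hom ≫ m) (e := e)
      (η := η ≫ i.inv⟦(1 : ℤ)⟧')
      (distTriang_of_iso h i (Iso.refl _) (Iso.refl _) (by simp) (by simp)
        (by simp [← Functor.map_comp])) h₃
    refine ⟨t', x, c, h₄, S.prop_of_iso a.symm h₂, fun i hi => ?_, h₆⟩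
    rcases Nat.lt_succ_iff_lt_or_eq.1 hi with hi | rfl
    · exact h₅ i hi
    · exact S.prop_of_iso x.symm hX
  clear h e η m hX
  induction k generalizing M with
  | zero =>
    exact ⟨const M, Iso.refl _, isDist_zero _, hM, fun i hi => absurd hi (Nat.not_lt_zero _)⟩
  | succ k ih =>
    rw [starShifts_succ'] at hM
    obtain ⟨X₁, W, f, g, h, hT, hX₁, hW⟩ := hM
    obtain ⟨M₁, hM₁, ⟨e⟩⟩ := (ObjectProperty.prop_map_iff _ _ _).1 hW
    obtain ⟨t, i, h₁, h₂, h₃⟩ := ih hM₁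
    obtain ⟨u, hu⟩ := (shiftFunctor 𝒯 (1 : ℤ)).map_surjective ((i.hom⟦(1 : ℤ)⟧' ≫ e.hom) ≫ h)
    have hT' : Triangle.mk (-u) f (g ≫ e.inv ≫ i.inv⟦(1 : ℤ)⟧') ∈ distTriang 𝒯 := by
      refine distTriang_of_rot (distTriang_of_iso hT (Iso.refl _) (Iso.refl _)
        ((shiftFunctor 𝒯 (1 : ℤ)).mapIso i ≪≫ e) (by simp) (by simp [← Functor.map_comp_assoc]) ?_)
      simp [hu]
    obtain ⟨t', a, x, c, h₄, h₅, h₆⟩ := exists_snoc k t h₁ hT' h₃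
    refine ⟨t', c, h₄, S.prop_of_iso a.symm h₂, fun i hi => ?_⟩
    rcases Nat.lt_succ_iff_lt_or_eq.1 hi with hi | rfl
    · exact h₅ i hi
    · exact S.prop_of_iso x.symm hX₁

end Tower

/-- The full subcategory `P * P[1] * ⋯ * P[k - 1]`. -/
def starBelow (S : ObjectProperty 𝒯) : ℕ → ObjectProperty 𝒯
  | 0 => IsZero
  | k + 1 => starShifts S k

lemma starBelow_succ_le (S : ObjectProperty 𝒯)
    [S.IsClosedUnderIsomorphisms] (k : ℕ) : starBelow S (k + 1) ≤
      ObjectProperty.extensionProduct (starBelow S k) (shifted S (k : ℤ)) := by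
  cases k with
  | zero =>
    have : (starBelow S 0).ContainsZero := ⟨0, isZero_zero _, isZero_zero _⟩
    intro Z hZ
    exact ObjectProperty.le_extensionProduct_right (starBelow S 0) _
      ((ObjectProperty.prop_map_iff _ _ _).2
        ⟨Z, hZ, ⟨(shiftFunctorZero' 𝒯 ((0 : ℕ) : ℤ) (by simp)).app Z⟩⟩)
  | succ k => exact le_rfl

/-- Let X₀[k] be the top layer of Z and Z' the rest. The octahedron on Z' ⟶ Z ⟶ C gives X₀[k] ⟶ G ⟶
M₀[k + 1] with G the cone of Z' ⟶ C. Then G unshifts to M₁[k], which provides the first triangle of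
the tower, and Z' ⟶ C ⟶ M₁[k] is the same situation one step lower. -/
lemma Tower.exists_prod_eq [IsTriangulated 𝒯] {S : ObjectProperty 𝒯}
    [S.IsClosedUnderIsomorphisms] (k : ℕ) {Z C M₀ : 𝒯} {z : Z ⟶ C} {δ : C ⟶ M₀⟦(k : ℤ)⟧}
    {w : M₀⟦(k : ℤ)⟧ ⟶ Z⟦(1 : ℤ)⟧} (hT : Triangle.mk z δ w ∈ distTriang 𝒯)
    (hZ : starBelow S k Z) :
    ∃ (t : Tower 𝒯) (a : t.M 0 ≅ M₀) (c : t.M k ≅ C), t.IsDist k ∧ (∀ i < k, S (t.X i)) ∧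
      t.prod k ≫ a.hom⟦(k : ℤ)⟧' = c.hom ≫ δ := by
  induction k generalizing Z M₀ with
  | zero =>
    have : IsIso δ := (Triangle.isZero₁_iff_isIso₂ _ hT).1 hZ
    have := isIso_prod_zero (Tower.const M₀)
    refine ⟨Tower.const M₀, Iso.refl _, asIso ((Tower.const M₀).prod 0) ≪≫ (asIso δ).symm,
      isDist_zero _, fun i hi => absurd hi (Nat.not_lt_zero _), ?_⟩
    simp
  | succ k ih =>
    obtain ⟨Z', W, f, g, h, hT', hZ', hW⟩ := starBelow_succ_le S k _ hZ
    obtain ⟨X₀, hX₀, ⟨e⟩⟩ := (ObjectProperty.prop_map_iff _ _ _).1 hW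
    obtain ⟨G, y, y', hG⟩ := distinguished_cocone_triangle (f ≫ z)
    let O := Triangulated.someOctahedron rfl hT' hT hG
    obtain ⟨p, q, c₁, c₂, c₃, c₄, hO⟩ : ∃ (p : W ⟶ G) (q : G ⟶ M₀⟦((k + 1 : ℕ) : ℤ)⟧),
        g ≫ p = z ≫ y ∧ p ≫ y' = h ∧ y ≫ q = δ ∧ q ≫ w = y' ≫ f⟦(1 : ℤ)⟧' ∧
          Triangle.mk p q (w ≫ g⟦(1 : ℤ)⟧') ∈ distTriang 𝒯 :=
      ⟨O.m₁, O.m₃, O.comm₁, O.comm₂, O.comm₃, O.comm₄.symm, O.mem⟩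
    let ι : M₀⟦((k + 1 : ℕ) : ℤ)⟧ ≅ M₀⟦(1 : ℤ)⟧⟦(k : ℤ)⟧ :=
      (shiftFunctorAdd' 𝒯 1 (k : ℤ) ((k + 1 : ℕ) : ℤ) (by push_cast; ring)).app M₀
    have hO' : Triangle.mk (e.hom ≫ p) (q ≫ ι.hom)
        (ι.inv ≫ (w ≫ g⟦(1 : ℤ)⟧') ≫ e.inv⟦(1 : ℤ)⟧') ∈ distTriang 𝒯 :=
      distTriang_of_iso hO e (Iso.refl _) ι.symm (by simp) (by simp) (by simp [← Functor.map_comp])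
    obtain ⟨M₁, e₀, η₀, h', b, h₁, h₂, h₃⟩ := exists_unshift_distTriang hO'
    obtain ⟨f₀, rfl⟩ := (shiftFunctor 𝒯 (1 : ℤ)).map_surjective h'
    have h₁' : Triangle.mk (-f₀) e₀ η₀ ∈ distTriang 𝒯 := by
      refine distTriang_of_rot (distTriang_of_iso h₁ (Iso.refl _) (Iso.refl _) (Iso.refl _) (by simp) (by simp)
        (by simp))
    obtain ⟨t, a, c, h₄, h₅, h₆⟩ := ih (Z := Z') (M₀ := M₁) (z := f ≫ z) (δ := y ≫ b.inv)
      (w := b.hom ≫ y')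
      (distTriang_of_iso hG (Iso.refl _) (Iso.refl _) b (by simp) (by simp) (by simp)) hZ'
    refine ⟨t.cons (-f₀) (e₀ ≫ a.inv) (a.hom ≫ η₀), Iso.refl _, c, h₄.cons ?_, ?_, ?_⟩
    · exact distTriang_of_iso h₁' (Iso.refl _) (Iso.refl _) a (by simp) (by simp) (by simp)
    · rintro (_ | i) hi
      · exact hX₀
      · exact h₅ i (by omega)
    · rw [prod_succ']
      change ShiftedHom.comp (Y := t.M 0) (t.prod k) (a.hom ≫ η₀) _ ≫ _ = _
      have : b.hom ≫ q = η₀⟦(k : ℤ)⟧' ≫ ι.inv := by rw [← h₃]; simp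
      have e₁ : c.hom ≫ δ = t.prod k ≫ a.hom⟦(k : ℤ)⟧' ≫ η₀⟦(k : ℤ)⟧' ≫ ι.inv := by
        rw [reassoc_of% h₆, ← this, ← c₃]
        simp
      rw [e₁]
      simp only [ShiftedHom.comp, Iso.refl_hom, CategoryTheory.Functor.map_id, Category.comp_id,
        Functor.map_comp, Category.assoc]
      rfl

end

/-! ### Consequences of the cluster tilting hypotheses. -/

section
variable {𝒯 : Type u} [Category.{v} 𝒯] [Preadditive 𝒯] [HasZeroObject 𝒯] [HasShift 𝒯 ℤ]
  [∀ k : ℤ, (shiftFunctor 𝒯 k).Additive] [Pretriangulated 𝒯]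

lemma rightOrthogonal_shifted_iff (T : ObjectProperty 𝒯) (Y : 𝒯) {a b k : ℤ} (h : k + a = b) :
    (shifted T a).rightOrthogonal (Y⟦b⟧) ↔ ∀ Q, T Q → HomVanish Q Y k := by
  constructor
  · intro H Q hQ
    rw [← homVanish_shift_left h]
    exact fun f => H f (ObjectProperty.prop_map_obj _ _ hQ)
  · intro H X f hX
    obtain ⟨Q, hQ, ⟨e⟩⟩ := (ObjectProperty.prop_map_iff _ _ _).1 hX
    have := (homVanish_shift_left (Y := Y) h).2 (H Q hQ) (e.hom ≫ f)
    exact (Preadditive.IsIso.comp_left_eq_zero _ _).1 this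

namespace IsNClusterTilting

variable {n : ℕ} {T : ObjectProperty 𝒯} (hT : IsNClusterTilting n T)

include hT

lemma homVanish {Q Q' : 𝒯} (hQ : T Q) (hQ' : T Q') {j : ℤ} (h₁ : 1 ≤ j) (h₂ : j < n) :
    HomVanish Q Q' j := by
  lift j to ℕ using by omega
  exact fun f => (hT.iff_right Q').1 hQ' j (by omega) (by omega) hQ f

lemma prop_of_homVanish {X : 𝒯} (h : ∀ Q, T Q → ∀ j : ℤ, 1 ≤ j → j < n → HomVanish Q X j) : T X :=
  (hT.iff_right X).2 fun i h₁ h₂ Q hQ f => h Q hQ i (by omega) (by omega) f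

lemma extensionProduct_le : ObjectProperty.extensionProduct T T ≤ T := by
  intro X ⟨Y, Z, f, g, h, hT', hY, hZ⟩
  exact hT.prop_of_homVanish fun Q hQ j h₁ h₂ =>
    homVanish_to₂ hT' (hT.homVanish hQ hY h₁ h₂) (hT.homVanish hQ hZ h₁ h₂)

/-- For a right approximation R ⟶ X[-n] with cone Z one has 𝒯(T, Z) = 0, and the inclusion of
orthogonals turns this into 𝒯(T, Z[n]) = 0. So X ≅ X[-n][n] ⟶ Z[n] vanishes, and the identity of X
factors through R[n]. -/
lemma exists_retract (h : 2 ≤ n)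
    (hright : (shifted T ((n : ℤ) - 1)).rightOrthogonal ≤ (shifted T (-1)).rightOrthogonal)
    {X : 𝒯} (hX : T X) : ∃ (R : 𝒯) (s : X ⟶ R⟦(n : ℤ)⟧) (p : R⟦(n : ℤ)⟧ ⟶ X), T R ∧ s ≫ p = 𝟙 X := by
  obtain ⟨R, f, hR, hf⟩ := hT.exists_right_approximation (X⟦(-n : ℤ)⟧)
  obtain ⟨Z, g, w, hZ⟩ := distinguished_cocone_triangle f
  have hZ₀ : ∀ Q, T Q → HomVanish Q Z 0 := by
    intro Q hQ
    rw [homVanish_zero]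
    intro x
    have hx : x ≫ w = 0 := hT.homVanish hQ hR le_rfl (by omega) _
    obtain ⟨y, rfl⟩ := exists_lift₂ hZ x hx
    obtain ⟨y, rfl⟩ := hf hQ y
    rw [Category.assoc, distTriang_comp₁₂ hZ, comp_zero]
  have H := (rightOrthogonal_shifted_iff T Z (k := n) (by ring)).1
    (hright _ ((rightOrthogonal_shifted_iff T Z (b := (n : ℤ) - 1) (by ring)).2 hZ₀)) X hX
  obtain ⟨h', hZ'⟩ := exists_shift_distTriang hZ (n : ℤ)
  let ι : X⟦(-n : ℤ)⟧⟦(n : ℤ)⟧ ≅ X := (shiftFunctorCompIsoId 𝒯 (-n : ℤ) n (by ring)).app X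
  obtain ⟨s, hs⟩ := exists_lift₁ hZ' ι.inv (H _)
  exact ⟨R, s, f⟦(n : ℤ)⟧' ≫ ι.hom, hR, by rw [← reassoc_of% hs, ι.inv_hom_id]⟩

/-- A map Q ⟶ Q'[j] with -n < j < 0 is detected in 𝒯(Q, R[n + j]), where Q' is a retract of R[n] and
0 < n + j < n. -/
lemma isRigid
    (hright : (shifted T ((n : ℤ) - 1)).rightOrthogonal ≤ (shifted T (-1)).rightOrthogonal) :
    IsRigid n T := by
  intro Q Q' hQ hQ' j hj₀ hj₁ hj₂
  rcases lt_or_gt_of_ne hj₀ with hj | hj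
  · obtain ⟨R, s, p, hR, hsp⟩ := hT.exists_retract (by omega) hright hQ'
    intro f
    have h : HomVanish Q (R⟦(n : ℤ)⟧) j :=
      (homVanish_shift_right rfl).2 (hT.homVanish hQ hR (by omega) (by omega))
    rw [← Category.comp_id f, ← CategoryTheory.Functor.map_id, ← hsp, Functor.map_comp,
      ← Category.assoc, h (f ≫ s⟦j⟧'), zero_comp]
  · exact hT.homVanish hQ hQ' (by omega) hj₂

lemma starShifts_eq_top [IsTriangulated 𝒯] {r : ℕ} (hr : r + 1 = n) (X : 𝒯) :
    starShifts T r X := by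
  -- Each right approximation gains one degree of vanishing for its cocone; for `r = n - 1` the
  -- vanishing condition is empty.
  have key : ∀ (r : ℕ) (Y : 𝒯), r + 1 ≤ n →
      (∀ Q, T Q → ∀ j : ℤ, 1 ≤ j → j + r < n → HomVanish Q Y j) → starShifts T r Y := by
    intro r
    induction r with
    | zero =>
      exact fun Y _ h => hT.prop_of_homVanish fun Q hQ j h₁ h₂ => h Q hQ j h₁ (by simpa using h₂)
    | succ r ih =>
      intro Y hr h
      obtain ⟨X₀, p, hX₀, hp⟩ := hT.exists_right_approximation Y
      obtain ⟨K, i, w, hK⟩ := distinguished_cocone_triangle₁ p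
      rw [starShifts_succ']
      refine ⟨_, _, _, _, _, rot_of_distTriang _ hK, hX₀,
        ObjectProperty.prop_map_obj _ _ (ih K (by omega) fun Q hQ j h₁ h₂ => ?_)⟩
      -- Degree 1 is where the approximation property is used.
      rcases eq_or_lt_of_le h₁ with rfl | h₁
      · intro f
        have hf : f ≫ (-i⟦(1 : ℤ)⟧') = 0 := hT.homVanish hQ hX₀ le_rfl (by omega) _
        have hK' : Triangle.mk p w (-i⟦(1 : ℤ)⟧') ∈ distTriang 𝒯 := rot_of_distTriang _ hK
        obtain ⟨y, rfl⟩ := exists_lift₂ hK' f hf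
        obtain ⟨y, rfl⟩ := hp hQ y
        rw [Category.assoc, distTriang_comp₂₃ hK, comp_zero]
      · exact homVanish_to₁ hK (hT.homVanish hQ hX₀ (by omega) (by omega))
          (h Q hQ _ (by omega) (by push_cast; omega))
  refine key r X hr.le fun Q _ j h₁ h₂ => ?_
  omega

end IsNClusterTilting

lemma IsTriangExtensionClosed.isClosedUnderIsomorphisms {E : ObjectProperty 𝒯}
    (hE : IsTriangExtensionClosed E) : E.IsClosedUnderIsomorphisms where
  of_iso {X Y} e hX := by
    have := hE.containsZero
    obtain ⟨Z, hZ, h⟩ := E.exists_prop_of_containsZero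
    refine hE.obj₂ (Triangle.mk e.hom (0 : Y ⟶ Z) 0) ?_ hX h
    exact distTriang_of_iso (contractible_distinguished X) (Iso.refl _) e.symm
      (hZ.iso (isZero_zero _)) (by simp) (by simp) (by simp)

lemma IsTriangExtensionClosed.extensionProduct_le {E : ObjectProperty 𝒯}
    (hE : IsTriangExtensionClosed E) : ObjectProperty.extensionProduct E E ≤ E :=
  fun _ ⟨_, _, _, _, _, hT, hY, hZ⟩ => hE.obj₂ _ hT hY hZ

lemma extensionProduct_inf_le {P Q : ObjectProperty 𝒯}
    (hP : ObjectProperty.extensionProduct P P ≤ P) (hQ : ObjectProperty.extensionProduct Q Q ≤ Q) :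
    ObjectProperty.extensionProduct (P ⊓ Q) (P ⊓ Q) ≤ P ⊓ Q :=
  le_inf (fun _ ⟨_, _, _, _, _, hT, hY, hZ⟩ => hP _ ⟨_, _, _, _, _, hT, hY.1, hZ.1⟩)
    (fun _ ⟨_, _, _, _, _, hT, hY, hZ⟩ => hQ _ ⟨_, _, _, _, _, hT, hY.2, hZ.2⟩)

lemma IsRigid.mono {n : ℕ} {P Q : ObjectProperty 𝒯} (hQ : IsRigid n Q) (h : P ≤ Q) :
    IsRigid n P :=
  fun _ _ hX hY => hQ (h _ hX) (h _ hY)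

end

/-! ### Passage between towers and complexes. -/

section
variable {𝒯 : Type u} [Category.{v} 𝒯] [Preadditive 𝒯] [HasZeroObject 𝒯] [HasShift 𝒯 ℤ]
  [∀ k : ℤ, (shiftFunctor 𝒯 k).Additive] [Pretriangulated 𝒯]

/-- A tower can be cut off after its `k`-th triangle, so that it ends with an isomorphism
`M k ⟶ X k` and vanishes afterwards. -/
lemma Tower.exists_truncation (k : ℕ) (t : Tower 𝒯) (ht : t.IsDist k) :
    ∃ (t' : Tower 𝒯) (φ : ∀ i, t'.M i ⟶ t.M i) (f : ∀ i, t'.X i ⟶ t.X i), t'.IsDist k ∧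
      IsHom t' t k φ f ∧ (∀ i ≤ k, IsIso (φ i)) ∧ (∀ i < k, IsIso (f i)) ∧ IsIso (t'.m k) ∧
      ∀ i, k < i → IsZero (t'.X i) := by
  induction k generalizing t with
  | zero =>
    refine ⟨(const (0 : 𝒯)).cons (𝟙 (t.M 0)) 0 0, fun | 0 => 𝟙 _ | i + 1 => 0, 0, isDist_zero _,
      fun i hi => absurd hi (Nat.not_lt_zero _), ?_, fun i hi => absurd hi (Nat.not_lt_zero _),
      inferInstanceAs (IsIso (𝟙 _)), ?_⟩
    · intro i hi
      obtain rfl : i = 0 := by omega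
      exact inferInstanceAs (IsIso (𝟙 _))
    · rintro (_ | i) hi
      · omega
      · exact isZero_zero 𝒯
  | succ k ih =>
    obtain ⟨t', φ, f, h₁, h₂, h₃, h₄, h₅, h₆⟩ := ih t.tail ht.tail
    have := h₃ 0 (by omega)
    refine ⟨t'.cons (t.m 0) (t.e 0 ≫ inv (φ 0)) (φ 0 ≫ t.η 0), fun | 0 => 𝟙 _ | i + 1 => φ i,
      fun | 0 => 𝟙 _ | i + 1 => f i, h₁.cons ?_, ?_, ?_, ?_, h₅, ?_⟩
    · exact distTriang_of_iso (ht 0 (by omega)) (Iso.refl _) (Iso.refl _) (asIso (φ 0)) (by simp)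
        (by simp) (by simp)
    · rintro (_ | i) hi
      · exact ⟨by simp, by simp, by simp⟩
      · exact h₂ i (by omega)
    · rintro (_ | i) hi
      · exact inferInstanceAs (IsIso (𝟙 _))
      · exact h₃ i (by omega)
    · rintro (_ | i) hi
      · exact inferInstanceAs (IsIso (𝟙 _))
      · exact h₄ i (by omega)
    · rintro (_ | i) hi
      · omega
      · exact h₆ i (by omega)

variable {𝒞 : Type u'} [Category.{v'} 𝒞] [Preadditive 𝒞] (F : 𝒞 ⥤ 𝒯) {n : ℕ}

/-- A decomposition of the image of a complex `K⁰ ⟶ K¹ ⟶ ⋯ ⟶ Kⁿ⁺¹` under `F` into distinguished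
triangles. -/
structure Postnikov (n : ℕ) (K : CochainComplex 𝒞 ℕ) where
  /-- the objects `M i` of the decomposition -/
  M : ℕ → 𝒯
  /-- the identification of `M 0` -/
  a : F.obj (K.X 0) ≅ M 0
  /-- the morphisms `M i ⟶ Kⁱ⁺¹` -/
  m : ∀ i, M i ⟶ F.obj (K.X (i + 1))
  /-- the morphisms `Kⁱ⁺¹ ⟶ M (i + 1)` -/
  e : ∀ i, F.obj (K.X (i + 1)) ⟶ M (i + 1)
  /-- the connecting morphisms -/
  η : ∀ i, M (i + 1) ⟶ (M i)⟦(1 : ℤ)⟧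
  dist : ∀ i < n, Triangle.mk (m i) (e i) (η i) ∈ distTriang 𝒯
  d_zero : F.map (K.d 0 1) = a.hom ≫ m 0
  d_succ : ∀ i < n, F.map (K.d (i + 1) (i + 2)) = e i ≫ m (i + 1)
  isIso : IsIso (m n)

namespace Postnikov

variable {F} {K K' : CochainComplex 𝒞 ℕ} (p : Postnikov F n K) (p' : Postnikov F n K')

/-- The underlying tower. -/
abbrev tower : Tower 𝒯 where
  M := p.M
  X i := F.obj (K.X (i + 1))
  m := p.m
  e := p.e
  η := p.η

lemma isDist : p.tower.IsDist n := p.dist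

/-- The extension `δ` is the product of the connecting morphisms. -/
def Represents {A C : 𝒞} (X : NComplex n A C) (p : Postnikov F n X.K)
    (δ : F.obj C ⟶ (F.obj A)⟦(n : ℤ)⟧) : Prop :=
  p.tower.prod n ≫ (p.a.inv ≫ F.map X.left.hom)⟦(n : ℤ)⟧' = p.m n ≫ F.map X.right.hom ≫ δ

end Postnikov

/-- The complex `X` is decomposable with respect to `δ`. -/
def IsDecomposableAlong {A C : 𝒞} (X : NComplex n A C) (δ : F.obj C ⟶ (F.obj A)⟦(n : ℤ)⟧) : Prop :=
  ∃ p : Postnikov F n X.K, Postnikov.Represents X p δ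

variable {F} in
/-- A morphism of towers gives a morphism of complexes. -/
lemma Postnikov.exists_hom [F.Full] [F.Faithful] {K K' : CochainComplex 𝒞 ℕ}
    (p : Postnikov F n K) (p' : Postnikov F n K') (hK' : ∀ i, n + 1 < i → IsZero (K'.X i))
    {φ : ∀ i, p.M i ⟶ p'.M i} {f : ∀ i, F.obj (K.X (i + 1)) ⟶ F.obj (K'.X (i + 1))}
    (h : Tower.IsHom p.tower p'.tower n φ f) :
    ∃ g : K ⟶ K', F.map (g.f 0) = p.a.hom ≫ φ 0 ≫ p'.a.inv ∧
      (∀ i < n, F.map (g.f (i + 1)) = f i) ∧ p.m n ≫ F.map (g.f (n + 1)) = φ n ≫ p'.m n := by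
  have := p.isIso
  -- A morphism of the first `n` triangles does not control the last term of the complex; that
  -- component is transported along the isomorphism `m n`.
  let f' := Function.update f n (inv (p.m n) ≫ φ n ≫ p'.m n)
  have hf' : ∀ i < n, f' i = f i := fun i hi => Function.update_of_ne (by omega) _ _
  have hfn : f' n = inv (p.m n) ≫ φ n ≫ p'.m n := Function.update_self _ _ _
  have hm : ∀ i ≤ n, p.m i ≫ f' i = φ i ≫ p'.m i := by
    intro i hi
    rcases hi.lt_or_eq with hi | rfl
    · rw [hf' i hi]
      exact (h i hi).1
    · rw [hfn, IsIso.hom_inv_id_assoc]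
  let g : ∀ i, K.X i ⟶ K'.X i := fun i => match i with
    | 0 => F.preimage (p.a.hom ≫ φ 0 ≫ p'.a.inv)
    | i + 1 => F.preimage (f' i)
  have hg : ∀ i, g i ≫ K'.d i (i + 1) = K.d i (i + 1) ≫ g (i + 1) := by
    intro i
    rcases Nat.lt_or_ge n i with hi | hi
    · exact (hK' (i + 1) (by omega)).eq_of_tgt _ _
    apply F.map_injective
    rcases i with _ | i
    · simp [g, p'.d_zero, p.d_zero, hm 0 (by omega)]
    · have h₂ : p.e i ≫ φ (i + 1) = f i ≫ p'.e i := (h i (by omega)).2.1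
      simp [g, p'.d_succ i (by omega), p.d_succ i (by omega), hm (i + 1) hi, hf' i (by omega),
        reassoc_of% h₂]
  refine ⟨⟨g, ?_⟩, by simp [g], fun i hi => by simp [g, hf' i hi], ?_⟩
  · rintro i j rfl
    exact hg i
  · simpa [g] using hm n le_rfl

/-- A tower with terms in the essential image of `F` is the image of a decomposable complex. -/
lemma Tower.exists_complex [HasZeroObject 𝒞] [F.Additive] [F.Full] [F.Faithful] {k : ℕ}
    {t : Tower 𝒯} (ht : t.IsDist (k + 1)) (hX : ∀ i < k + 1, F.essImage (t.X i)) {A C : 𝒞}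
    (a : F.obj A ≅ t.M 0) (c : t.M (k + 1) ≅ F.obj C)
    (δ : F.obj C ⟶ (F.obj A)⟦((k + 1 : ℕ) : ℤ)⟧)
    (hδ : t.prod (k + 1) ≫ a.inv⟦((k + 1 : ℕ) : ℤ)⟧' = c.hom ≫ δ) :
    ∃ (X : NComplex (k + 1) A C) (x : ∀ i, F.obj (X.K.X (i + 1)) ⟶ t.X i),
      IsDecomposableAlong F X δ ∧ (∀ i < k + 1, IsIso (x i)) ∧
      F.map X.dFirst ≫ x 0 = a.hom ≫ t.m 0 ∧
      (∀ i < k, F.map (X.K.d (i + 1) (i + 2)) ≫ x (i + 1) = x i ≫ t.e i ≫ t.m (i + 1)) ∧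
      x k ≫ t.e k ≫ c.hom = F.map X.dLast := by
  -- After truncation the term of index `k + 1` is isomorphic to the image of C and the later ones
  -- vanish, so the complex is concentrated in degrees 0, …, k + 2.
  obtain ⟨t', φ, f, h₁, h₂, h₃, h₄, h₅, h₆⟩ := Tower.exists_truncation (k + 1) t ht
  have hS : ∀ i, F.essImage (t'.X i) := by
    intro i
    rcases lt_trichotomy i (k + 1) with hi | rfl | hi
    · have := h₄ i hi
      exact ObjectProperty.prop_of_iso _ (asIso (f i)).symm (hX i hi)
    · have := h₃ (k + 1) le_rfl
      exact ⟨C, ⟨c.symm ≪≫ (asIso (φ (k + 1))).symm ≪≫ asIso (t'.m (k + 1))⟩⟩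
    · exact ⟨0, ⟨(F.map_isZero (isZero_zero 𝒞)).iso (h₆ i hi)⟩⟩
  choose o ho using hS
  have α : ∀ i, F.obj (o i) ≅ t'.X i := fun i => (ho i).some
  have := h₃ 0 (by omega)
  have := h₃ (k + 1) le_rfl
  let α₀ : F.obj A ≅ t'.M 0 := a ≪≫ (asIso (φ 0)).symm
  let obj : ℕ → 𝒞 := fun i => match i with
    | 0 => A
    | i + 1 => o i
  let d : ∀ i, obj i ⟶ obj (i + 1) := fun i => match i with
    | 0 => F.preimage (α₀.hom ≫ t'.m 0 ≫ (α 0).inv)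
    | i + 1 => F.preimage ((α i).hom ≫ t'.e i ≫ t'.m (i + 1) ≫ (α (i + 1)).inv)
  have hd : ∀ i, d i ≫ d (i + 1) = 0 := by
    intro i
    rcases Nat.lt_or_ge k i with hi | hi
    · have : IsZero (F.obj (o (i + 1))) := (h₆ (i + 1) (by omega)).of_iso (α (i + 1))
      exact F.map_injective (this.eq_of_tgt _ _)
    · apply F.map_injective
      have e := distTriang_comp₁₂ (h₁ i (by omega))
      rcases i with _ | i
      · simp [d, reassoc_of% e]
      · simp [d, reassoc_of% e]
  let K : CochainComplex 𝒞 ℕ := CochainComplex.of obj d hd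
  have hd₀ : F.map (K.d 0 1) = α₀.hom ≫ t'.m 0 ≫ (α 0).inv :=
    (congrArg F.map (CochainComplex.of_d _ _ 0)).trans (F.map_preimage _)
  have hd₁ : ∀ i, F.map (K.d (i + 1) (i + 2)) =
      (α i).hom ≫ t'.e i ≫ t'.m (i + 1) ≫ (α (i + 1)).inv := fun i =>
    (congrArg F.map (CochainComplex.of_d _ _ (i + 1))).trans (F.map_preimage _)
  let r : F.obj (o (k + 1)) ≅ F.obj C :=
    α (k + 1) ≪≫ (asIso (t'.m (k + 1))).symm ≪≫ asIso (φ (k + 1)) ≪≫ c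
  let X : NComplex (k + 1) A C :=
    { K := K
      isZero := by
        rintro (_ | i) hi
        · omega
        · have : IsZero (F.obj (o i)) := (h₆ i (by omega)).of_iso (α i)
          rw [IsZero.iff_id_eq_zero]
          exact F.map_injective (this.eq_of_tgt _ _)
      left := Iso.refl A
      right := F.preimageIso r }
  let p : Postnikov F (k + 1) X.K :=
    { M := t'.M
      a := α₀
      m := fun i => t'.m i ≫ (α i).inv
      e := fun i => (α i).hom ≫ t'.e i
      η := t'.η
      dist := fun i hi => distTriang_of_iso (h₁ i hi) (Iso.refl _) (α i) (Iso.refl _) (by simp)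
        (by simp) (by simp)
      d_zero := hd₀
      d_succ := fun i _ => (hd₁ i).trans (by simp)
      isIso := inferInstance }
  have hr : F.map X.right.hom = r.hom := F.map_preimage _
  have hl : F.map X.left.inv = 𝟙 _ := F.map_id _
  refine ⟨X, fun i => (α i).hom ≫ f i, ⟨p, ?_⟩, ?_, ?_, ?_, ?_⟩
  · have e₁ := h₂.prod_comp
    have e₂ : p.a.inv ≫ F.map X.left.hom = φ 0 ≫ a.inv :=
      (congrArg (_ ≫ ·) (F.map_id _)).trans (by simp [p, α₀])
    have e₃ : t'.prod (k + 1) ≫ (φ 0 ≫ a.inv)⟦((k + 1 : ℕ) : ℤ)⟧' =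
        φ (k + 1) ≫ c.hom ≫ δ := by
      rw [Functor.map_comp, reassoc_of% e₁, hδ]
    change t'.prod (k + 1) ≫ _ = (t'.m (k + 1) ≫ (α (k + 1)).inv) ≫ _
    rw [e₂, e₃, hr]
    simp [r]
  · intro i hi
    have := h₄ i hi
    infer_instance
  · have h := (h₂ 0 (by omega)).1
    have e : F.map X.dFirst = α₀.hom ≫ t'.m 0 ≫ (α 0).inv := by
      rw [NComplex.dFirst, F.map_comp, hl]
      exact (Category.id_comp _).trans hd₀
    rw [e]
    simp [α₀, h]
  · intro i hi
    have h := (h₂ i (by omega)).2.1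
    have h' := (h₂ (i + 1) (by omega)).1
    have e : F.map (X.K.d (i + 1) (i + 2)) =
      (α i).hom ≫ t'.e i ≫ t'.m (i + 1) ≫ (α (i + 1)).inv := hd₁ i
    rw [e]
    simp [h', reassoc_of% h]
  · have h := (h₂ k (by omega)).2.1
    rw [NComplex.dLast, F.map_comp, hr]
    refine Eq.trans ?_ (congrArg (· ≫ r.hom) (hd₁ k).symm)
    simp [r, reassoc_of% h]

end

/-! ### Lifting of morphisms and exactness at inner terms. -/

section
variable {𝒯 : Type u} [Category.{v} 𝒯] [Preadditive 𝒯] [HasZeroObject 𝒯] [HasShift 𝒯 ℤ]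
  [∀ k : ℤ, (shiftFunctor 𝒯 k).Additive] [Pretriangulated 𝒯]

/-- Only conventions differ: in `Postnikov` the maps `e` start at X¹ and M n is identified with the
last term by `m n`; in `IsDecomposable` they start at X⁰, where the value is irrelevant, and M n is
identified with C. -/
lemma isDecomposableAlong_ι_iff {T : ObjectProperty 𝒯} {n : ℕ} [NeZero n] {A C : T.FullSubcategory}
    (X : NComplex n A C) (δ : C.obj ⟶ A.obj⟦(n : ℤ)⟧) :
    IsDecomposableAlong T.ι X δ ↔ IsDecomposable X δ := by
  obtain ⟨k, rfl⟩ : ∃ k, n = k + 1 := ⟨n - 1, by have := NeZero.ne n; omega⟩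
  constructor
  · rintro ⟨p, hp⟩
    have := p.isIso
    refine ⟨p.M, (T.ι.mapIso X.left).symm ≪≫ p.a, asIso (p.m (k + 1)) ≪≫ T.ι.mapIso X.right, p.m,
      fun | 0 => p.a.hom | i + 1 => p.e i, p.η, p.dist, ?_, ?_, ?_, ?_⟩
    · have := p.d_zero
      dsimp at this
      simp [NComplex.dFirst, this]
    · intro i hi hi'
      obtain ⟨i, rfl⟩ : ∃ j, i = j + 1 := ⟨i - 1, by omega⟩
      exact p.d_succ i (by omega)
    · have := p.d_succ k (by omega)
      dsimp at this
      simp [NComplex.dLast, this]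
    · have hp : p.tower.prod (k + 1) ≫ _ = _ := hp
      refine Eq.trans ?_ hp.symm
      simp
  · rintro ⟨M, a, c, m, e, η, h₁, h₂, h₃, h₄, h₅⟩
    let m' : ∀ i, M i ⟶ (X.K.X (i + 1)).obj :=
      Function.update m (k + 1) (c.hom ≫ X.right.inv.hom)
    have hm : ∀ i < k + 1, m' i = m i := fun i hi => Function.update_of_ne (by omega) _ _
    have hm' : m' (k + 1) = c.hom ≫ X.right.inv.hom := Function.update_self _ _ _
    refine ⟨⟨M, T.ι.mapIso X.left ≪≫ a, m', fun i => e (i + 1), η, ?_, ?_, ?_, ?_⟩, ?_⟩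
    · intro i hi
      rw [hm i hi]
      exact h₁ i hi
    · rw [hm 0 (by omega)]
      have : (X.K.d 0 1).hom = X.left.hom.hom ≫ X.dFirst.hom := by
        rw [← ObjectProperty.FullSubcategory.comp_hom]
        simp [NComplex.dFirst]
      refine this.trans ?_
      rw [h₂]
      simp
    · intro i hi
      rcases Nat.lt_or_ge i k with hi' | hi'
      · rw [hm (i + 1) (by omega)]
        exact h₃ (i + 1) (by omega) (by omega)
      · obtain rfl : i = k := by omega
        rw [hm']
        have : (X.K.d (i + 1) (i + 2)).hom = X.dLast.hom ≫ X.right.inv.hom := by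
          rw [← ObjectProperty.FullSubcategory.comp_hom]
          simp [NComplex.dLast]
        refine this.trans ?_
        rw [h₄, Category.assoc]
    · rw [hm']
      have : IsIso X.right.inv.hom := inferInstanceAs (IsIso (T.ι.map X.right.inv))
      infer_instance
    · change iteratedProduct M η (k + 1) ≫ _ = m' (k + 1) ≫ _
      have e : (T.ι.mapIso X.left ≪≫ a).inv ≫ T.ι.map X.left.hom = a.inv := by simp
      dsimp only
      rw [e, ← h₅, hm', Category.assoc]
      have : X.right.inv.hom ≫ X.right.hom.hom = 𝟙 _ := by
        rw [← ObjectProperty.FullSubcategory.comp_hom]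
        simp
      exact congrArg (c.hom ≫ ·) ((reassoc_of% this) δ).symm

variable {𝒞 : Type u'} [Category.{v'} 𝒞] [Preadditive 𝒞] {F : 𝒞 ⥤ 𝒯} {n : ℕ}

lemma Postnikov.Represents.prod_eq {A C : 𝒞} {X : NComplex n A C} {p : Postnikov F n X.K}
    {δ : F.obj C ⟶ (F.obj A)⟦(n : ℤ)⟧} (h : p.Represents X δ) :
    p.tower.prod n = p.m n ≫ F.map X.right.hom ≫ δ ≫ (F.map X.left.inv ≫ p.a.hom)⟦(n : ℤ)⟧' := by
  have h : p.tower.prod n ≫ _ = _ := h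
  have := h =≫ (F.map X.left.inv ≫ p.a.hom)⟦(n : ℤ)⟧'
  simp only [Category.assoc, ← Functor.map_comp] at this
  rw [← this, ← Functor.map_comp_assoc, Iso.hom_inv_id]
  simp

lemma Postnikov.essImage_last {K : CochainComplex 𝒞 ℕ} (p : Postnikov F n K) :
    F.essImage (p.M n) := by
  have := p.isIso
  exact ⟨_, ⟨(asIso (p.m n)).symm⟩⟩

lemma Postnikov.essImage_first {K : CochainComplex 𝒞 ℕ} (p : Postnikov F n K) :
    F.essImage (p.M 0) := ⟨_, ⟨p.a⟩⟩

/-- The kernel of composition with `f` comes from 𝒯(Q, C[-1]). This lemma and its dual are the way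
in which negative vanishing enters the exactness proofs. -/
lemma eq_zero_of_comp_eq_zero₁ {A B C Q : 𝒯} {f : A ⟶ B} {g : B ⟶ C} {h : C ⟶ A⟦(1 : ℤ)⟧}
    (hT : Triangle.mk f g h ∈ distTriang 𝒯) (hv : HomVanish Q C (-1)) (x : Q ⟶ A)
    (hx : x ≫ f = 0) : x = 0 := by
  obtain ⟨y, rfl⟩ := exists_lift₁ (inv_rot_of_distTriang _ hT) x hx
  exact (congrArg (· ≫ _) (hv y)).trans zero_comp

lemma eq_zero_of_comp_eq_zero₂ {A B C Q : 𝒯} {f : A ⟶ B} {g : B ⟶ C} {h : C ⟶ A⟦(1 : ℤ)⟧}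
    (hT : Triangle.mk f g h ∈ distTriang 𝒯) (hv : HomVanish A Q (-1)) (x : C ⟶ Q)
    (hx : g ≫ x = 0) : x = 0 := by
  obtain ⟨y, rfl⟩ := exists_desc₁ hT x hx
  rw [homVanish_zero.1 ((homVanish_shift_left (by norm_num)).2 hv) y, comp_zero]

lemma Tower.e_comp_prod {t : Tower 𝒯} {k : ℕ} (ht : t.IsDist (k + 1)) :
    t.e k ≫ t.prod (k + 1) = 0 := by
  rw [prod_succ, ShiftedHom.comp, ← Category.assoc, distTriang_comp₂₃ (ht k (by omega)), zero_comp]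

lemma Tower.prod_comp_m {t : Tower 𝒯} {k : ℕ} (ht : t.IsDist (k + 1)) :
    t.prod (k + 1) ≫ (t.m 0)⟦((k + 1 : ℕ) : ℤ)⟧' = 0 := by
  rw [← tail_prod_comp_map, distTriang_comp₃₁ (ht 0 (by omega)), ShiftedHom.comp_zero]

variable [F.Full] [F.Faithful] (hF : IsRigid n F.essImage)
include hF

/-- Morphisms of extensions lift to morphisms of decomposable complexes. -/
lemma IsDecomposableAlong.exists_lift {A B C D : 𝒞} {X : NComplex n A C} {Y : NComplex n B D}
    {δ : F.obj C ⟶ (F.obj A)⟦(n : ℤ)⟧} {ρ : F.obj D ⟶ (F.obj B)⟦(n : ℤ)⟧}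
    (hX : IsDecomposableAlong F X δ) (hY : IsDecomposableAlong F Y ρ) (a : A ⟶ B) (c : C ⟶ D)
    (h : δ ≫ (F.map a)⟦(n : ℤ)⟧' = F.map c ≫ ρ) :
    ∃ f : X.K ⟶ Y.K, HasEnds (X := X) (Y := Y) f a c := by
  obtain ⟨p, hp⟩ := hX
  obtain ⟨p', hp'⟩ := hY
  have := p.isIso
  have := p'.isIso
  obtain ⟨φ, f, h₀, hn, hφ⟩ := Tower.exists_isHom_of_prod hF p.isDist p'.isDist
    (fun i _ => F.obj_mem_essImage _) (fun i _ => F.obj_mem_essImage _) p.essImage_last le_rfl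
    (p.a.inv ≫ F.map (X.left.hom ≫ a ≫ Y.left.inv) ≫ p'.a.hom)
    (p.m n ≫ F.map (X.right.hom ≫ c ≫ Y.right.inv) ≫ inv (p'.m n)) (by
      rw [hp.prod_eq, hp'.prod_eq]
      simp only [Category.assoc, ← Functor.map_comp, IsIso.inv_hom_id_assoc,
        Iso.hom_inv_id_assoc]
      simp only [Functor.map_comp, Category.assoc, Iso.map_inv_hom_id_assoc]
      rw [← reassoc_of% h, ← Functor.map_comp_assoc, ← Functor.map_comp])
  obtain ⟨g, hg₀, -, hgn⟩ := p.exists_hom p' Y.isZero hφ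
  refine ⟨g, ?_, ?_⟩
  · rw [h₀] at hg₀
    apply F.map_injective
    rw [F.map_comp, hg₀]
    simp [← Functor.map_comp]
  · rw [hn] at hgn
    apply F.map_injective
    rw [← cancel_epi (p.m n), F.map_comp, reassoc_of% hgn]
    simp [← Functor.map_comp]

namespace Postnikov

variable {K : CochainComplex 𝒞 ℕ} (p : Postnikov F n K)
include p

lemma comp_e_eq_zero {Q : 𝒯} (hQ : F.essImage Q) {i : ℕ} (hi : i < n)
    (x : Q ⟶ F.obj (K.X (i + 1))) (hx : x ≫ F.map (K.d (i + 1) (i + 2)) = 0) : x ≫ p.e i = 0 := by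
  rw [p.d_succ i hi, ← Category.assoc] at hx
  rcases Nat.lt_or_ge (i + 1) n with hi' | hi'
  · exact eq_zero_of_comp_eq_zero₁ (p.dist (i + 1) hi') (Tower.homVanish_to_of_last hF p.isDist
      (fun i _ => F.obj_mem_essImage _) p.essImage_last hQ (i := i + 2) (r := n - (i + 2))
      (by omega) (by omega) (by omega)) _ hx
  · obtain rfl : n = i + 1 := by omega
    have := p.isIso
    exact (Preadditive.IsIso.comp_right_eq_zero _ _).1 hx

/-- A cycle lifts to M i; the obstruction to lifting it further to Kⁱ lies in 𝒯(Q, M (i - 1)[1]) = 0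
for i > 0, while M 0 is K⁰ itself. -/
lemma exists_lift_of_comp_d {Q : 𝒞} {i : ℕ} (hi : i < n) (f : Q ⟶ K.X (i + 1))
    (hf : f ≫ K.d (i + 1) (i + 2) = 0) : ∃ g : Q ⟶ K.X i, g ≫ K.d i (i + 1) = f := by
  obtain ⟨y, hy⟩ := exists_lift₁ (p.dist i hi) _
    (p.comp_e_eq_zero hF (F.obj_mem_essImage Q) hi (F.map f) (by rw [← F.map_comp, hf, F.map_zero]))
  rcases i with _ | i
  · refine ⟨F.preimage (y ≫ p.a.inv), F.map_injective ?_⟩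
    simp [p.d_zero, hy]
  · have : y ≫ p.η i = 0 := Tower.homVanish_to_of_first hF p.isDist
      (fun i _ => F.obj_mem_essImage _) p.essImage_first (F.obj_mem_essImage Q) (i := i)
      (by omega) le_rfl (by omega) _
    obtain ⟨z, rfl⟩ := exists_lift₂ (p.dist i (by omega)) y this
    refine ⟨F.preimage z, F.map_injective ?_⟩
    simp [p.d_succ i (by omega), hy]

lemma m_comp_eq_zero {Q : 𝒯} (hQ : F.essImage Q) {i : ℕ} (hi : i < n)
    (x : F.obj (K.X (i + 1)) ⟶ Q) (hx : F.map (K.d i (i + 1)) ≫ x = 0) : p.m i ≫ x = 0 := by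
  rcases i with _ | i
  · rw [p.d_zero, Category.assoc] at hx
    exact (Preadditive.IsIso.comp_left_eq_zero _ _).1 hx
  · rw [p.d_succ i (by omega), Category.assoc] at hx
    exact eq_zero_of_comp_eq_zero₂ (p.dist i (by omega)) (Tower.homVanish_from_of_first hF p.isDist
      (fun i _ => F.obj_mem_essImage _) p.essImage_first hQ (i := i)
      (by omega) (by omega) (by omega)) _ hx

lemma exists_desc_of_d_comp {Q : 𝒞} {i : ℕ} (hi : i < n) (f : K.X (i + 1) ⟶ Q)
    (hf : K.d i (i + 1) ≫ f = 0) : ∃ g : K.X (i + 2) ⟶ Q, K.d (i + 1) (i + 2) ≫ g = f := by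
  obtain ⟨y, hy⟩ := exists_desc₃ (p.dist i hi) _
    (p.m_comp_eq_zero hF (F.obj_mem_essImage Q) hi (F.map f) (by rw [← F.map_comp, hf, F.map_zero]))
  rcases Nat.lt_or_ge (i + 1) n with hi' | hi'
  · obtain ⟨z, rfl⟩ := exists_desc_of_comp_eq_zero (p.dist (i + 1) hi') y
      (Tower.homVanish_from_of_last hF p.isDist
        (fun i _ => F.obj_mem_essImage _) p.essImage_last (F.obj_mem_essImage Q) (i := i + 2)
        (r := n - (i + 2)) (by omega) le_rfl (by omega) _)
    refine ⟨F.preimage z, F.map_injective ?_⟩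
    simp [p.d_succ i (by omega), hy]
  · obtain rfl : n = i + 1 := by omega
    have := p.isIso
    refine ⟨F.preimage (inv (p.m (i + 1)) ≫ y), F.map_injective ?_⟩
    simp [p.d_succ i (by omega), hy]

end Postnikov

end

/-! ### The extension functor and axiom (R1). -/

section
variable {𝒯 : Type u} [Category.{v} 𝒯] [Preadditive 𝒯] [HasZeroObject 𝒯] [HasShift 𝒯 ℤ]
  [∀ k : ℤ, (shiftFunctor 𝒯 k).Additive] [Pretriangulated 𝒯]
variable {𝒞 : Type u'} [Category.{v'} 𝒞] [Preadditive 𝒞] {F : 𝒞 ⥤ 𝒯} {n : ℕ}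

variable (F n) in
/-- The functor `(C, A) ↦ 𝒯(F C, (F A)[n])`. -/
def extAlong : 𝒞ᵒᵖ ⥤ 𝒞 ⥤ AddCommGrpCat.{v} :=
  F.op ⋙ preadditiveCoyoneda ⋙ (Functor.whiskeringLeft _ _ _).obj (F ⋙ shiftFunctor 𝒯 (n : ℤ))

instance [F.Additive] : (extAlong F n).Additive where
  map_add {X Y f g} := by
    ext A δ
    exact (congrArg (· ≫ (δ : F.obj X.unop ⟶ (F.obj A)⟦(n : ℤ)⟧)) F.map_add).trans
      (Preadditive.add_comp _ _ _ _ _ _)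

instance [F.Additive] (C : 𝒞ᵒᵖ) : ((extAlong F n).obj C).Additive where
  map_add {X Y f g} := by
    ext δ
    exact (congrArg ((δ : F.obj C.unop ⟶ (F.obj X)⟦(n : ℤ)⟧) ≫ ·)
      (F ⋙ shiftFunctor 𝒯 (n : ℤ)).map_add).trans (Preadditive.comp_add _ _ _ _ _ _)

lemma IsDecomposableAlong.dLast_comp [F.Full] [F.Faithful] [NeZero n] {A C : 𝒞}
    {X : NComplex n A C} {δ : F.obj C ⟶ (F.obj A)⟦(n : ℤ)⟧} (hX : IsDecomposableAlong F X δ) :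
    F.map X.dLast ≫ δ = 0 := by
  obtain ⟨k, rfl⟩ : ∃ k, n = k + 1 := ⟨n - 1, by have := NeZero.ne n; omega⟩
  obtain ⟨p, hp⟩ := hX
  have h : p.tower.prod (k + 1) ≫ _ = _ := hp
  have := p.d_succ k (by omega)
  rw [NComplex.dLast, F.map_comp, this, Category.assoc, Category.assoc, ← h, ← Category.assoc]
  exact (congrArg (· ≫ _) (Tower.e_comp_prod p.isDist)).trans zero_comp

lemma IsDecomposableAlong.comp_dFirst [F.Full] [F.Faithful] [NeZero n] {A C : 𝒞}
    {X : NComplex n A C} {δ : F.obj C ⟶ (F.obj A)⟦(n : ℤ)⟧} (hX : IsDecomposableAlong F X δ) :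
    δ ≫ (F.map X.dFirst)⟦(n : ℤ)⟧' = 0 := by
  obtain ⟨k, rfl⟩ : ∃ k, n = k + 1 := ⟨n - 1, by have := NeZero.ne n; omega⟩
  obtain ⟨p, hp⟩ := hX
  have h : p.tower.prod (k + 1) ≫ _ = _ := hp
  have := p.isIso
  have e₁ : δ = F.map X.right.inv ≫ inv (p.m (k + 1)) ≫ p.tower.prod (k + 1) ≫
      (p.a.inv ≫ F.map X.left.hom)⟦((k + 1 : ℕ) : ℤ)⟧' := by
    rw [h]
    simp
  have e₂ : p.a.inv ≫ F.map X.left.hom ≫ F.map X.dFirst = p.m 0 := by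
    rw [NComplex.dFirst, F.map_comp, p.d_zero]
    simp
  have e₃ := Tower.prod_comp_m p.isDist
  rw [e₁]
  simp only [Category.assoc, ← (shiftFunctor 𝒯 ((k + 1 : ℕ) : ℤ)).map_comp]
  rw [e₂, e₃, comp_zero, comp_zero]

/-- Decomposable complexes are `n`-exangles. -/
lemma IsDecomposableAlong.isNExangle [F.Full] [F.Faithful] [F.Additive] [NeZero n]
    (hF : IsRigid n F.essImage) {A C : 𝒞}
    {X : NComplex n A C} {δ : F.obj C ⟶ (F.obj A)⟦(n : ℤ)⟧} (hX : IsDecomposableAlong F X δ) :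
    IsNExangle (𝔼 := extAlong F n) X δ := by
  have h₁ := hX.dLast_comp
  have h₂ := hX.comp_dFirst
  obtain ⟨p, hp⟩ := hX
  refine ⟨?_, ?_, ?_, ?_⟩
  · intro Q i hi f
    exact ⟨fun hf => p.exists_lift_of_comp_d hF (by omega) f hf, by rintro ⟨g, rfl⟩; simp⟩
  · intro Q f
    refine ⟨fun hf => ?_, ?_⟩
    · obtain ⟨k, rfl⟩ : ∃ k, n = k + 1 := ⟨n - 1, by have := NeZero.ne n; omega⟩
      have := p.isIso
      have hf : F.map f ≫ δ = 0 := hf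
      obtain ⟨g, hg⟩ := Tower.exists_lift_of_comp_prod hF p.isDist
        (fun i _ => F.obj_mem_essImage _) (F.obj_mem_essImage Q) le_rfl
        (F.map f ≫ F.map X.right.inv ≫ inv (p.m (k + 1))) (by
          rw [hp.prod_eq]
          simp [reassoc_of% hf])
      refine ⟨F.preimage g, F.map_injective ?_⟩
      have := p.d_succ k (by omega)
      simp only [NComplex.dLast, F.map_comp, F.map_preimage]
      rw [this, Category.assoc, ← reassoc_of% hg]
      simp
    · rintro ⟨g, rfl⟩
      change F.map (g ≫ X.dLast) ≫ δ = 0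
      rw [F.map_comp, Category.assoc, h₁, comp_zero]
  · intro Q i hi f
    exact ⟨fun hf => p.exists_desc_of_d_comp hF (by omega) f hf, by rintro ⟨g, rfl⟩; simp⟩
  · intro Q f
    refine ⟨fun hf => ?_, ?_⟩
    · obtain ⟨k, rfl⟩ : ∃ k, n = k + 1 := ⟨n - 1, by have := NeZero.ne n; omega⟩
      have hf : δ ≫ (F.map f)⟦((k + 1 : ℕ) : ℤ)⟧' = 0 := hf
      obtain ⟨g, hg⟩ := Tower.exists_desc_of_prod_comp hF p.isDist
        (fun i _ => F.obj_mem_essImage _) (F.obj_mem_essImage Q) le_rfl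
        (p.a.inv ≫ F.map X.left.hom ≫ F.map f) (by
          have e : (F.map X.left.inv ≫ p.a.hom) ≫ p.a.inv ≫ F.map X.left.hom ≫ F.map f =
            F.map f := by simp [← F.map_comp_assoc]
          rw [hp.prod_eq, Category.assoc, Category.assoc, Category.assoc,
            ← (shiftFunctor 𝒯 ((k + 1 : ℕ) : ℤ)).map_comp, e, hf, comp_zero, comp_zero])
      refine ⟨F.preimage g, F.map_injective ?_⟩
      simp only [NComplex.dFirst, F.map_comp, F.map_preimage, p.d_zero, Category.assoc]
      rw [← hg]
      simp [← F.map_comp_assoc]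
    · rintro ⟨g, rfl⟩
      change δ ≫ (F.map (X.dFirst ≫ g))⟦(n : ℤ)⟧' = 0
      rw [F.map_comp, Functor.map_comp, reassoc_of% h₂, zero_comp]

end

/-! ### Axiom (R2), existence of realizations, and axiom (EA1). -/

section
variable {𝒯 : Type u} [Category.{v} 𝒯] [Preadditive 𝒯] [HasZeroObject 𝒯] [HasShift 𝒯 ℤ]
  [∀ k : ℤ, (shiftFunctor 𝒯 k).Additive] [Pretriangulated 𝒯]

lemma distTriang_id_zero (X : 𝒯) {Z : 𝒯} (hZ : IsZero Z) :
    Triangle.mk (𝟙 X) (0 : X ⟶ Z) 0 ∈ distTriang 𝒯 :=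
  distTriang_of_iso (contractible_distinguished X) (Iso.refl _) (Iso.refl _)
    (hZ.iso (isZero_zero _)) (by simp) (by simp) (by simp)

lemma distTriang_zero_id (X : 𝒯) {Z : 𝒯} (hZ : IsZero Z) (f : Z ⟶ X) :
    Triangle.mk f (𝟙 X) 0 ∈ distTriang 𝒯 :=
  distTriang_of_rot (distTriang_of_iso
    (distTriang_id_zero X ((shiftFunctor 𝒯 (1 : ℤ)).map_isZero hZ)) (Iso.refl _) (Iso.refl _)
    (Iso.refl _) (by simp) (by simp) (by simp [hZ.eq_of_src f 0]))

variable {𝒞 : Type u'} [Category.{v'} 𝒞] [Preadditive 𝒞] {F : 𝒞 ⥤ 𝒯} {n : ℕ}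

lemma isDecomposableAlong_idLeft [HasZeroObject 𝒞] [F.Additive] [NeZero n] (A : 𝒞) :
    IsDecomposableAlong F (NComplex.idLeft n A) 0 := by
  let K := (NComplex.idLeft n A).K
  have hz : ∀ i, 1 < i → IsZero (F.obj (K.X i)) := fun i hi =>
    F.map_isZero (HomologicalComplex.isZero_double_X (𝟙 A)
      (show (ComplexShape.up ℕ).Rel 0 1 from rfl) _
      (by omega) (by omega))
  have hd : IsIso (K.d 0 1) := by
    have h : (ComplexShape.up ℕ).Rel 0 1 := rfl
    have : K.d 0 1 = (HomologicalComplex.doubleXIso₀ (𝟙 A) h ≪≫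
        (HomologicalComplex.doubleXIso₁ (𝟙 A) h (by omega)).symm).hom :=
      (HomologicalComplex.double_d (𝟙 A) h (by omega)).trans (by simp)
    rw [this]
    exact Iso.isIso_hom _
  have := NeZero.ne n
  refine ⟨⟨fun i => F.obj (K.X (i + 1)), F.mapIso (asIso (K.d 0 1)), fun i => 𝟙 _, fun i => 0,
    fun i => 0, fun i _ => distTriang_id_zero _ (hz _ (by omega)), by simp [K], ?_,
    inferInstance⟩, ?_⟩
  · intro i hi
    exact (hz (i + 2) (by omega)).eq_of_tgt _ _
  · exact (hz (n + 1) (by omega)).eq_of_src _ _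

lemma isDecomposableAlong_idRight [HasZeroObject 𝒞] [F.Additive] [NeZero n] (A : 𝒞) :
    IsDecomposableAlong F (NComplex.idRight n A) 0 := by
  let K := (NComplex.idRight n A).K
  have hz : ∀ i, i < n → IsZero (F.obj (K.X i)) := fun i hi =>
    F.map_isZero (HomologicalComplex.isZero_double_X (𝟙 A)
      (show (ComplexShape.up ℕ).Rel n (n + 1) from rfl) _
      (by omega) (by omega))
  have hd : IsIso (K.d n (n + 1)) := by
    have h : (ComplexShape.up ℕ).Rel n (n + 1) := rfl
    have : K.d n (n + 1) = (HomologicalComplex.doubleXIso₀ (𝟙 A) h ≪≫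
        (HomologicalComplex.doubleXIso₁ (𝟙 A) h (by omega)).symm).hom :=
      (HomologicalComplex.double_d (𝟙 A) h (by omega)).trans (by simp)
    rw [this]
    exact Iso.isIso_hom _
  refine ⟨⟨fun i => F.obj (K.X i), Iso.refl _, fun i => F.map (K.d i (i + 1)), fun i => 𝟙 _,
    fun i => 0, fun i hi => distTriang_zero_id _ (hz i hi) _, ?_, ?_, inferInstance⟩, ?_⟩
  · exact (Category.id_comp _).symm
  · intro i hi
    exact (Category.id_comp _).symm
  · exact ((shiftFunctor 𝒯 (n : ℤ)).map_isZero (F.map_isZero (isZero_zero 𝒞))).eq_of_tgt _ _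

variable [IsTriangulated 𝒯] [HasZeroObject 𝒞] [F.Additive] [F.Full] [F.Faithful] {r : ℕ}

/-- Each extension is realized by a decomposable complex. -/
lemma exists_isDecomposableAlong (h : ObjectProperty.extensionProduct (starShifts F.essImage r)
    (starShifts F.essImage r) ≤ starShifts F.essImage r) {A C : 𝒞}
    (δ : F.obj C ⟶ (F.obj A)⟦((r + 1 : ℕ) : ℤ)⟧) :
    ∃ X : NComplex (r + 1) A C, IsDecomposableAlong F X δ := by
  have : F.essImage.ContainsZero := ⟨_, F.map_isZero (isZero_zero 𝒞), F.obj_mem_essImage _⟩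
  obtain ⟨Z, z, w, hT⟩ := distinguished_cocone_triangle₁ δ
  -- The triangle A[r] ⟶ Z ⟶ C has its outer terms in the top and bottom layers of the product.
  have hZ : starShifts F.essImage r Z := by
    refine h _ ⟨_, _, _, _, _, inv_rot_of_distTriang _ hT, ?_,
      le_starShifts r _ (F.obj_mem_essImage C)⟩
    exact ObjectProperty.prop_of_iso _ ((shiftFunctorAdd' 𝒯 ((r + 1 : ℕ) : ℤ) (-1) (r : ℤ)
      (by push_cast; ring)).app _) (starShifts_obj_mem r (F.obj_mem_essImage A))
  obtain ⟨t, a, c, h₁, h₂, h₃⟩ := Tower.exists_prod_eq (r + 1) hT hZ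
  obtain ⟨X, x, hX, -⟩ := Tower.exists_complex F h₁ h₂ a.symm c δ h₃
  exact ⟨X, hX⟩

/-- A coresolution of the cone of `f`, preceded by `f`, is a whole tower. The resulting condition no
longer mentions complexes, so composition of inflations becomes an octahedron. -/
lemma exists_dFirst_eq_iff {A B : 𝒞} (f : A ⟶ B) :
    (∃ (C : 𝒞) (δ : F.obj C ⟶ (F.obj A)⟦((r + 1 : ℕ) : ℤ)⟧) (X : NComplex (r + 1) A C)
      (e : X.K.X 1 ≅ B), IsDecomposableAlong F X δ ∧ X.dFirst ≫ e.hom = f) ↔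
    ∃ (Z : 𝒯) (g : F.obj B ⟶ Z) (w : Z ⟶ (F.obj A)⟦(1 : ℤ)⟧),
      Triangle.mk (F.map f) g w ∈ distTriang 𝒯 ∧ starShifts F.essImage r (Z⟦(r : ℤ)⟧) := by
  constructor
  · rintro ⟨C, δ, X, e, ⟨p, -⟩, rfl⟩
    refine ⟨p.M 1, F.map e.inv ≫ p.e 0, p.η 0 ≫ (p.a.inv ≫ F.map X.left.hom)⟦(1 : ℤ)⟧',
      distTriang_of_iso (p.dist 0 (by omega)) (F.mapIso X.left.symm ≪≫ p.a) (F.mapIso e.symm)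
        (Iso.refl _) ?_ (by simp) ?_, ?_⟩
    · simp [NComplex.dFirst, p.d_zero, ← F.map_comp]
    · simp [← Functor.map_comp]
    · exact Tower.starShifts_shift_of_isDist r p.tower.tail p.isDist.tail
        (fun i _ => F.obj_mem_essImage _) p.essImage_last
  · rintro ⟨Z, g, w, hT, hZ⟩
    obtain ⟨t, rfl, h₁, h₂, ⟨C, ⟨c⟩⟩⟩ := Tower.exists_of_starShifts_shift r Z hZ
    obtain ⟨X, x, hX, hx, hx₀, -⟩ := Tower.exists_complex F (t := t.cons (F.map f) g w)
      (h₁.cons hT) (by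
        rintro (_ | i) hi
        · exact F.obj_mem_essImage B
        · exact h₂ i (by omega)) (Iso.refl _) c.symm
      (c.hom ≫ (t.cons (F.map f) g w).prod (r + 1)) (by simp)
    have := hx 0 (by omega)
    refine ⟨C, _, X, F.preimageIso (asIso (x 0)), hX, F.map_injective ?_⟩
    simp [hx₀]

/-- Dually, a resolution of the cocone of `g`, followed by `g`, is a whole tower. -/
lemma exists_dLast_eq_iff {B C : 𝒞} (g : B ⟶ C) :
    (∃ (A : 𝒞) (δ : F.obj C ⟶ (F.obj A)⟦((r + 1 : ℕ) : ℤ)⟧) (X : NComplex (r + 1) A C)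
      (e : B ≅ X.K.X (r + 1)), IsDecomposableAlong F X δ ∧ e.hom ≫ X.dLast = g) ↔
    ∃ (Z : 𝒯) (f : Z ⟶ F.obj B) (w : F.obj C ⟶ Z⟦(1 : ℤ)⟧),
      Triangle.mk f (F.map g) w ∈ distTriang 𝒯 ∧ starShifts F.essImage r Z := by
  constructor
  · rintro ⟨A, δ, X, e, ⟨p, -⟩, rfl⟩
    have := p.isIso
    have hd := p.d_succ r (by omega)
    refine ⟨p.M r, p.m r ≫ F.map e.inv, F.map X.right.inv ≫ inv (p.m (r + 1)) ≫ p.η r,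
      distTriang_of_iso (p.dist r (by omega)) (Iso.refl _) (F.mapIso e)
        (F.mapIso X.right.symm ≪≫ (asIso (p.m (r + 1))).symm) ?_ ?_ (by simp), ?_⟩
    · simp
    · simp [NComplex.dLast, hd]
    · exact Tower.starShifts_of_isDist r p.tower (p.isDist.mono (by omega))
        (fun i _ => F.obj_mem_essImage _) p.essImage_first
  · rintro ⟨Z, f, w, hT, hZ⟩
    obtain ⟨t, y, c, h₁, ⟨A, ⟨a⟩⟩, h₂, h₃⟩ := Tower.exists_of_starShifts r hT hZ
      (F.obj_mem_essImage B)
    obtain ⟨X, x, hX, hx, -, -, hx'⟩ := Tower.exists_complex F h₁ h₂ a c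
      (c.inv ≫ t.prod (r + 1) ≫ a.inv⟦((r + 1 : ℕ) : ℤ)⟧') (by simp)
    have := hx r (by omega)
    refine ⟨A, _, X, F.preimageIso (y.symm ≪≫ (asIso (x r)).symm), hX, F.map_injective ?_⟩
    rw [F.map_comp, ← hx', h₃]
    simp

lemma exists_dFirst_eq_comp (h : ObjectProperty.extensionProduct (starShifts F.essImage r)
    (starShifts F.essImage r) ≤ starShifts F.essImage r) {A B C : 𝒞} {f : A ⟶ B} {g : B ⟶ C}
    (hf : ∃ (Z : 𝒯) (g : F.obj B ⟶ Z) (w : Z ⟶ (F.obj A)⟦(1 : ℤ)⟧),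
      Triangle.mk (F.map f) g w ∈ distTriang 𝒯 ∧ starShifts F.essImage r (Z⟦(r : ℤ)⟧))
    (hg : ∃ (Z : 𝒯) (h : F.obj C ⟶ Z) (w : Z ⟶ (F.obj B)⟦(1 : ℤ)⟧),
      Triangle.mk (F.map g) h w ∈ distTriang 𝒯 ∧ starShifts F.essImage r (Z⟦(r : ℤ)⟧)) :
    ∃ (Z : 𝒯) (h : F.obj C ⟶ Z) (w : Z ⟶ (F.obj A)⟦(1 : ℤ)⟧),
      Triangle.mk (F.map (f ≫ g)) h w ∈ distTriang 𝒯 ∧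
        starShifts F.essImage r (Z⟦(r : ℤ)⟧) := by
  obtain ⟨Z₁, y₁, w₁, h₁, hZ₁⟩ := hf
  obtain ⟨Z₂, y₂, w₂, h₂, hZ₂⟩ := hg
  obtain ⟨Z, y, w, hT⟩ := distinguished_cocone_triangle (F.map (f ≫ g))
  let O := Triangulated.someOctahedron (F.map_comp f g).symm h₁ h₂ hT
  obtain ⟨w', hO⟩ := exists_shift_distTriang O.mem (r : ℤ)
  exact ⟨Z, y, w, hT, h _ ⟨_, _, _, _, _, hO, hZ₁, hZ₂⟩⟩

lemma exists_dLast_eq_comp (h : ObjectProperty.extensionProduct (starShifts F.essImage r)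
    (starShifts F.essImage r) ≤ starShifts F.essImage r) {A B C : 𝒞} {f : A ⟶ B} {g : B ⟶ C}
    (hf : ∃ (Z : 𝒯) (z : Z ⟶ F.obj A) (w : F.obj B ⟶ Z⟦(1 : ℤ)⟧),
      Triangle.mk z (F.map f) w ∈ distTriang 𝒯 ∧ starShifts F.essImage r Z)
    (hg : ∃ (Z : 𝒯) (z : Z ⟶ F.obj B) (w : F.obj C ⟶ Z⟦(1 : ℤ)⟧),
      Triangle.mk z (F.map g) w ∈ distTriang 𝒯 ∧ starShifts F.essImage r Z) :
    ∃ (Z : 𝒯) (z : Z ⟶ F.obj A) (w : F.obj C ⟶ Z⟦(1 : ℤ)⟧),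
      Triangle.mk z (F.map (f ≫ g)) w ∈ distTriang 𝒯 ∧ starShifts F.essImage r Z := by
  obtain ⟨Z₁, y₁, w₁, h₁, hZ₁⟩ := hf
  obtain ⟨Z₂, y₂, w₂, h₂, hZ₂⟩ := hg
  obtain ⟨Z, y, w, hT⟩ := distinguished_cocone_triangle₁ (F.map (f ≫ g))
  -- The octahedron relates the cocones after one shift, which is then undone.
  let O := Triangulated.someOctahedron (F.map_comp f g).symm (rot_of_distTriang _ h₁)
    (rot_of_distTriang _ h₂) (rot_of_distTriang _ hT)
  obtain ⟨B', _, _, _, b, hO, -⟩ := exists_unshift_distTriang O.mem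
  exact ⟨Z, y, w, hT, ObjectProperty.prop_of_iso _
    ((shiftFunctor 𝒯 (1 : ℤ)).preimageIso b) (h _ ⟨_, _, _, _, _, hO, hZ₁, hZ₂⟩)⟩

end

/-! ### Uniqueness of the decomposable complex up to homotopy. -/

section

lemma exists_seq {α : ℕ → Type*} (P : ∀ i, α i → Prop) (R : ∀ i, α i → α (i + 1) → Prop)
    (a : α 0) (h₀ : P 0 a) (h : ∀ i a, P i a → ∃ b, P (i + 1) b ∧ R i a b) :
    ∃ s : ∀ i, α i, s 0 = a ∧ (∀ i, P i (s i)) ∧ ∀ i, R i (s i) (s (i + 1)) := by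
  choose g hg using h
  let s : ∀ i, { x : α i // P i x } := fun i =>
    Nat.rec ⟨a, h₀⟩ (fun i b => ⟨g i b.1 b.2, (hg i b.1 b.2).1⟩) i
  exact ⟨fun i => (s i).1, rfl, fun i => (s i).2, fun i => (hg i (s i).1 (s i).2).2⟩

variable {𝒯 : Type u} [Category.{v} 𝒯] [Preadditive 𝒯] [HasZeroObject 𝒯] [HasShift 𝒯 ℤ]
  [∀ k : ℤ, (shiftFunctor 𝒯 k).Additive] [Pretriangulated 𝒯]
variable {𝒞 : Type u'} [Category.{v'} 𝒞] [Preadditive 𝒞] {F : 𝒞 ⥤ 𝒯} {n : ℕ}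

section

variable [F.Full] [F.Faithful] (hF : IsRigid n F.essImage)
include hF

/-- An endomorphism of a decomposable complex which vanishes at both ends is homotopic to a
morphism with square zero. -/
lemma Postnikov.exists_homotopy {K : CochainComplex 𝒞 ℕ} (p : Postnikov F n K)
    (hK : ∀ i, n + 1 < i → IsZero (K.X i)) (h : K ⟶ K) (h₀ : h.f 0 = 0) (hn : h.f (n + 1) = 0) :
    ∃ τ : K ⟶ K, Nonempty (Homotopy h τ) ∧ τ ≫ τ = 0 := by
  -- The homotopy is built degree by degree. The invariant says that d kills `h - s ≫ d`, so
  -- exactness provides the next component.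
  obtain ⟨s, hs₀, -, hs⟩ := exists_seq (α := fun i => (K.X (i + 1) ⟶ K.X i))
    (fun i s => i ≤ n → K.d i (i + 1) ≫ s ≫ K.d i (i + 1) = K.d i (i + 1) ≫ h.f (i + 1))
    (fun i s s' => i < n → K.d (i + 1) (i + 2) ≫ s' = h.f (i + 1) - s ≫ K.d i (i + 1)) 0
    (fun _ => by rw [← h.comm, h₀, zero_comp, zero_comp, comp_zero]) (by
      intro i s hs
      rcases Nat.lt_or_ge i n with hi | hi
      · obtain ⟨s', hs'⟩ := p.exists_desc_of_d_comp hF hi (h.f (i + 1) - s ≫ K.d i (i + 1))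
          (by rw [Preadditive.comp_sub, hs hi.le, sub_self])
        refine ⟨s', fun _ => ?_, fun _ => hs'⟩
        rw [reassoc_of% hs', Preadditive.sub_comp, Category.assoc, K.d_comp_d, comp_zero, sub_zero,
          h.comm]
      · exact ⟨0, by omega, by omega⟩)
  let σ : ∀ i j, (ComplexShape.up ℕ).Rel j i → (K.X i ⟶ K.X j) := fun i j hij =>
    eqToHom (by rw [← hij]) ≫ s j
  have hσ : ∀ i, (Homotopy.nullHomotopicMap' σ).f (i + 1) =
      K.d (i + 1) (i + 2) ≫ s (i + 1) + s i ≫ K.d i (i + 1) := by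
    intro i
    rw [Homotopy.nullHomotopicMap'_f (show (ComplexShape.up ℕ).Rel i (i + 1) from rfl)
      (show (ComplexShape.up ℕ).Rel (i + 1) (i + 2) from rfl)]
    simp [σ]
  have hσ₀ : (Homotopy.nullHomotopicMap' σ).f 0 = 0 := by
    rw [Homotopy.nullHomotopicMap'_f_of_not_rel_right (show (ComplexShape.up ℕ).Rel 0 1 from rfl)
      (fun l hl => by simp at hl)]
    simp [σ, hs₀]
  -- What remains is concentrated in degree `n + 1`, where it factors through the last differential;
  -- since that differential followed by τ is zero, τ has square zero.
  let τ := h - Homotopy.nullHomotopicMap' σ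
  have hτ : ∀ i ≤ n, τ.f i = 0 := by
    rintro (_ | i) hi
    · simp [τ, h₀, hσ₀]
    · simp [τ, hσ, hs i (by omega)]
  refine ⟨τ, ⟨Homotopy.equivSubZero.symm ((Homotopy.ofEq (by simp [τ])).trans
    (Homotopy.nullHomotopy' σ))⟩, ?_⟩
  ext i
  rcases lt_trichotomy i (n + 1) with hi | rfl | hi
  · simp [hτ i (by omega)]
  · have e₁ : τ.f (n + 1) = -(s n ≫ K.d n (n + 1)) := by
      have : K.d (n + 1) (n + 2) = 0 := (hK (n + 2) (by omega)).eq_of_tgt _ _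
      simp [τ, hn, hσ, this]
    have e₂ : K.d n (n + 1) ≫ τ.f (n + 1) = 0 := by rw [← τ.comm, hτ n le_rfl, zero_comp]
    rw [HomologicalComplex.comp_f]
    nth_rewrite 1 [e₁]
    rw [Preadditive.neg_comp, Category.assoc, e₂, comp_zero, neg_zero]
    rfl
  · exact (hK i hi).eq_of_tgt _ _

/-- Two complexes which are decomposable with respect to the same extension are homotopically
equivalent. -/
lemma IsDecomposableAlong.htpyEquivalent {A C : 𝒞} {X Y : NComplex n A C}
    {δ : F.obj C ⟶ (F.obj A)⟦(n : ℤ)⟧} (hX : IsDecomposableAlong F X δ)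
    (hY : IsDecomposableAlong F Y δ) : HtpyEquivalent X Y := by
  obtain ⟨f, hf₀, hf₁⟩ := hX.exists_lift hF hY (𝟙 A) (𝟙 C) (by simp)
  obtain ⟨g, hg₀, hg₁⟩ := hY.exists_lift hF hX (𝟙 A) (𝟙 C) (by simp)
  obtain ⟨p, -⟩ := hX
  obtain ⟨p', -⟩ := hY
  rw [Category.comp_id] at hf₀ hf₁ hg₀ hg₁
  have hfg₀ : f.f 0 ≫ g.f 0 = 𝟙 _ := by
    rw [← cancel_mono X.left.hom, Category.assoc, hg₀, hf₀, Category.id_comp]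
  have hfg₁ : f.f (n + 1) ≫ g.f (n + 1) = 𝟙 _ := by
    rw [← cancel_mono X.right.hom, Category.assoc, hg₁, hf₁, Category.id_comp]
  have hgf₀ : g.f 0 ≫ f.f 0 = 𝟙 _ := by
    rw [← cancel_mono Y.left.hom, Category.assoc, hf₀, hg₀, Category.id_comp]
  have hgf₁ : g.f (n + 1) ≫ f.f (n + 1) = 𝟙 _ := by
    rw [← cancel_mono Y.right.hom, Category.assoc, hf₁, hg₁, Category.id_comp]
  obtain ⟨τ, ⟨hτ⟩, hτ'⟩ := p.exists_homotopy hF X.isZero (f ≫ g - 𝟙 _) (by simp [hfg₀])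
    (by simp [hfg₁])
  obtain ⟨ρ, ⟨hρ⟩, hρ'⟩ := p'.exists_homotopy hF Y.isZero (g ≫ f - 𝟙 _) (by simp [hgf₀])
    (by simp [hgf₁])
  let Q := HomotopyCategory.quotient 𝒞 (ComplexShape.up ℕ)
  have e₁ : Q.map f ≫ Q.map g = 𝟙 _ + Q.map τ := by
    have := HomotopyCategory.eq_of_homotopy _ _ hτ
    rw [Functor.map_sub, sub_eq_iff_eq_add', Functor.map_comp,
      CategoryTheory.Functor.map_id] at this
    exact this
  have e₂ : Q.map g ≫ Q.map f = 𝟙 _ + Q.map ρ := by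
    have := HomotopyCategory.eq_of_homotopy _ _ hρ
    rw [Functor.map_sub, sub_eq_iff_eq_add', Functor.map_comp,
      CategoryTheory.Functor.map_id] at this
    exact this
  have e₃ : Q.map τ ≫ Q.map τ = 0 := by rw [← Q.map_comp, hτ', Q.map_zero]
  have e₄ : Q.map ρ ≫ Q.map ρ = 0 := by rw [← Q.map_comp, hρ', Q.map_zero]
  -- Up to homotopy this is `g` followed by `1 - τ`, and `(1 + τ)(1 - τ) = 1`. Written with `f ≫ g -
  -- 𝟙`, which vanishes at the ends, it stays strictly the identity on A and C.
  let g' := g ≫ (𝟙 _ - (f ≫ g - 𝟙 _))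
  have e₅ : Q.map g' = Q.map g ≫ (𝟙 _ - Q.map τ) := by
    rw [Functor.map_comp, Functor.map_sub, HomotopyCategory.eq_of_homotopy _ _ hτ,
      CategoryTheory.Functor.map_id]
  have e₆ : Q.map f ≫ Q.map g' = 𝟙 _ := by
    rw [e₅, ← Category.assoc, e₁]
    simp [e₃]
  have e₇ : ((𝟙 _ - Q.map ρ) ≫ Q.map g) ≫ Q.map f = 𝟙 _ := by
    rw [Category.assoc, e₂]
    simp [e₄]
  have e₈ : Q.map g' ≫ Q.map f = 𝟙 _ := by
    have : Q.map g' = (𝟙 _ - Q.map ρ) ≫ Q.map g := by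
      have := e₇ =≫ Q.map g'
      rwa [Category.assoc, e₆, Category.comp_id, Category.id_comp, eq_comm] at this
    rw [this, e₇]
  refine ⟨⟨f, g', HomotopyCategory.homotopyOfEq _ _ (by rw [Q.map_comp, e₆, Q.map_id]),
    HomotopyCategory.homotopyOfEq _ _ (by rw [Q.map_comp, e₈, Q.map_id])⟩, ⟨?_, ?_⟩, ?_, ?_⟩
  · simpa using hf₀
  · simpa using hf₁
  · simpa [g', hfg₀] using hg₀
  · simpa [g', hfg₁] using hg₁

end

end

/-! ### Splitting complexes into triangles, and perturbed identities of towers. -/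

section
variable {𝒯 : Type u} [Category.{v} 𝒯] [Preadditive 𝒯] [HasZeroObject 𝒯] [HasShift 𝒯 ℤ]
  [∀ k : ℤ, (shiftFunctor 𝒯 k).Additive] [Pretriangulated 𝒯]

/-- A complex `M₀ ⟶ X 0 ⟶ X 1 ⟶ ⋯` splits into distinguished triangles provided that enough
morphisms of negative degree vanish. -/
lemma Tower.exists_of_complex (k : ℕ) (X : ℕ → 𝒯) (d : ∀ i, X i ⟶ X (i + 1))
    (hd : ∀ i, d i ≫ d (i + 1) = 0)
    (hX : ∀ i i' (j : ℤ), -k < j → j ≤ -1 → HomVanish (X i) (X i') j) (M₀ : 𝒯)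
    (hM : ∀ i (j : ℤ), -k < j → j ≤ -1 → HomVanish M₀ (X i) j) (m₀ : M₀ ⟶ X 0)
    (hm : 0 < k → m₀ ≫ d 0 = 0) :
    ∃ (M : ℕ → 𝒯) (a : M₀ ≅ M 0) (m : ∀ i, M i ⟶ X i) (e : ∀ i, X i ⟶ M (i + 1))
      (η : ∀ i, M (i + 1) ⟶ (M i)⟦(1 : ℤ)⟧),
      (∀ i < k, Triangle.mk (m i) (e i) (η i) ∈ distTriang 𝒯) ∧ m₀ = a.hom ≫ m 0 ∧
        ∀ i < k, d i = e i ≫ m (i + 1) := by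
  induction k generalizing X M₀ with
  | zero =>
    exact ⟨fun _ => M₀, Iso.refl _, fun | 0 => m₀ | i + 1 => 0, 0, 0, by omega, by simp, by omega⟩
  | succ k ih =>
    -- The map `d 0` factors through the cone M₁, and the factor composes to zero with `d 1` by
    -- negative vanishing; it starts the same problem for the shifted sequence.
    obtain ⟨M₁, e₀, η₀, hT⟩ := distinguished_cocone_triangle m₀
    obtain ⟨m₁, hm₁⟩ := exists_desc₃ hT (d 0) (hm (by omega))
    obtain ⟨M, a, m, e, η, h₁, h₂, h₃⟩ := ih (fun i => X (i + 1)) (fun i => d (i + 1))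
      (fun i => hd (i + 1)) (fun i i' j h h' => hX _ _ j (by push_cast; omega) h') M₁
      (fun i j h h' => homVanish_from₃ hT (hX _ _ j (by push_cast; omega) h')
        (hM _ _ (by push_cast; omega) (by omega))) m₁ (fun hk => by
        refine eq_zero_of_comp_eq_zero₂ hT (hM _ _ (by push_cast; omega) (by omega)) _ ?_
        rw [← Category.assoc, ← hm₁, hd])
    refine ⟨fun | 0 => M₀ | i + 1 => M i, Iso.refl _, fun | 0 => m₀ | i + 1 => m i,
      fun | 0 => e₀ ≫ a.hom | i + 1 => e i, fun | 0 => a.inv ≫ η₀ | i + 1 => η i, ?_, by simp, ?_⟩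
    · rintro (_ | i) hi
      · exact distTriang_of_iso hT (Iso.refl _) (Iso.refl _) a.symm (by simp) (by simp) (by simp)
      · exact h₁ i (by omega)
    · rintro (_ | i) hi
      · simp [hm₁, h₂]
      · exact h₃ i (by omega)

/-- An endomorphism of a tower which induces a null-homotopic perturbation of the identity on the
terms `X i` is invertible up to an explicit correction. -/
lemma Tower.IsHom.isIso_sub {t : Tower 𝒯} {k : ℕ} (ht : t.IsDist (k + 1))
    {φ : ∀ i, t.M i ⟶ t.M i} {f : ∀ i, t.X i ⟶ t.X i} (h : IsHom t t (k + 1) φ f)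
    (h₀ : φ 0 = 𝟙 _) (s₀ : t.X 0 ⟶ t.M 0) (hs₀ : t.m 0 ≫ s₀ = 0)
    (s : ∀ i, t.X (i + 1) ⟶ t.X i) (hf₀ : f 0 = t.e 0 ≫ t.m 1 ≫ s 0 + s₀ ≫ t.m 0 + 𝟙 _)
    (hf : ∀ i < k, f (i + 1) = t.e (i + 1) ≫ t.m (i + 2) ≫ s (i + 1) +
      s i ≫ t.e i ≫ t.m (i + 1) + 𝟙 _) :
    IsIso (φ (k + 1) - t.m (k + 1) ≫ s k ≫ t.e k) := by
  -- θ is a morphism of towers over `f - 𝟙` that is zero on M 0. Hence `φ - θ` lies over identities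
  -- and is invertible by the five lemma.
  let θ : ∀ i, t.M i ⟶ t.M i := fun i => match i with
    | 0 => 0
    | i + 1 => t.m (i + 1) ≫ s i ≫ t.e i
  have hθ : IsHom t t (k + 1) θ (fun i => f i - 𝟙 _) := by
    intro i hi
    have e₁ := distTriang_comp₁₂ (ht i hi)
    have e₃ := distTriang_comp₃₁ (ht i hi)
    rcases i with _ | i
    · refine ⟨?_, ?_, ?_⟩
      · simp [hf₀, θ, reassoc_of% e₁, reassoc_of% hs₀]
      · simp [hf₀, θ, e₁]
      · simp [θ, distTriang_comp₂₃ (ht 0 hi)]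
    · refine ⟨?_, ?_, ?_⟩
      · simp [hf i (by omega), θ, reassoc_of% e₁]
      · simp [hf i (by omega), θ, e₁]
      · simp only [θ, Functor.map_comp, reassoc_of% e₃, zero_comp, Category.assoc,
          distTriang_comp₂₃ (ht (i + 1) hi), comp_zero]
  have := (h.sub hθ).isIso ht ht (by
      simp only [h₀, θ, sub_zero]
      infer_instance) (fun i _ => by
      simp only [sub_sub_cancel]
      infer_instance) (k + 1) le_rfl
  exact this

variable {𝒞 : Type u'} [Category.{v'} 𝒞] [Preadditive 𝒞] {F : 𝒞 ⥤ 𝒯} {n : ℕ}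
  [F.Full] [F.Faithful] [F.Additive]

lemma Postnikov.isIso_sub {k : ℕ} {K : CochainComplex 𝒞 ℕ} {M : ℕ → 𝒯} {a : F.obj (K.X 0) ≅ M 0}
    {m : ∀ i, M i ⟶ F.obj (K.X (i + 1))} {e : ∀ i, F.obj (K.X (i + 1)) ⟶ M (i + 1)}
    {η : ∀ i, M (i + 1) ⟶ (M i)⟦(1 : ℤ)⟧}
    (ht : Tower.IsDist ⟨M, fun i => F.obj (K.X (i + 1)), m, e, η⟩ (k + 1))
    (h₀ : F.map (K.d 0 1) = a.hom ≫ m 0)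
    (h : ∀ i < k + 1, F.map (K.d (i + 1) (i + 2)) = e i ≫ m (i + 1)) {f : K ⟶ K}
    {φ : ∀ i, M i ⟶ M i} (hφ : Tower.IsHom ⟨M, fun i => F.obj (K.X (i + 1)), m, e, η⟩
      ⟨M, fun i => F.obj (K.X (i + 1)), m, e, η⟩ (k + 1) φ (fun i => F.map (f.f (i + 1))))
    (hφ₀ : φ 0 = 𝟙 _) (hf : f.f 0 = 𝟙 _) (H : Homotopy f (𝟙 K)) :
    IsIso (φ (k + 1) - m (k + 1) ≫ F.map (H.hom (k + 2) (k + 1)) ≫ e k) := by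
  have H' : ∀ i, F.map (f.f (i + 1)) = F.map (K.d (i + 1) (i + 2)) ≫
      F.map (H.hom (i + 2) (i + 1)) + F.map (H.hom (i + 1) i) ≫ F.map (K.d i (i + 1)) + 𝟙 _ := by
    intro i
    rw [H.comm (i + 1), Homotopy.dNext_cochainComplex, Homotopy.prevD_succ_cochainComplex]
    simp only [F.map_add, F.map_comp, HomologicalComplex.id_f, CategoryTheory.Functor.map_id]
  refine Tower.IsHom.isIso_sub ht hφ hφ₀ (F.map (H.hom 1 0) ≫ a.hom) ?_
    (fun i => F.map (H.hom (i + 2) (i + 1))) ?_ ?_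
  · have := H.comm 0
    rw [hf] at this
    simp only [Homotopy.dNext_cochainComplex, Homotopy.prevD_zero_cochainComplex, add_zero,
      HomologicalComplex.id_f, right_eq_add] at this
    have := congrArg F.map this
    rw [F.map_comp, F.map_zero, h₀, Category.assoc] at this
    have := (Preadditive.IsIso.comp_left_eq_zero _ _).1 this
    exact (Category.assoc _ _ _).symm.trans ((congrArg (· ≫ a.hom) this).trans zero_comp)
  · refine (H' 0).trans ?_
    rw [h 0 (by omega), h₀]
    simp only [Category.assoc]
  · intro i hi
    refine (H' (i + 1)).trans ?_
    rw [h i (by omega), h (i + 1) (by omega)]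
    simp only [Category.assoc]

end

/-! ### Homotopy invariance of decomposability. -/

section
variable {𝒯 : Type u} [Category.{v} 𝒯] [Preadditive 𝒯] [HasZeroObject 𝒯] [HasShift 𝒯 ℤ]
  [∀ k : ℤ, (shiftFunctor 𝒯 k).Additive] [Pretriangulated 𝒯]
variable {𝒞 : Type u'} [Category.{v'} 𝒞] [Preadditive 𝒞] {F : 𝒞 ⥤ 𝒯}
  [F.Full] [F.Faithful] [F.Additive]

/-- Decomposability is invariant under homotopy equivalences which are the identity at both
ends. -/
lemma IsDecomposableAlong.of_htpyEquivalent {k : ℕ} (hF : IsRigid (k + 1) F.essImage) {A C : 𝒞}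
    {X Y : NComplex (k + 1) A C} {δ : F.obj C ⟶ (F.obj A)⟦((k + 1 : ℕ) : ℤ)⟧}
    (hX : IsDecomposableAlong F X δ) (hXY : HtpyEquivalent X Y) : IsDecomposableAlong F Y δ := by
  obtain ⟨⟨f, g, H, H'⟩, ⟨hf₀, hf₁⟩, hg₀, hg₁⟩ := hXY
  obtain ⟨p, hp⟩ := hX
  dsimp only at hf₀ hf₁ hg₀ hg₁
  rw [Category.comp_id] at hf₀ hf₁ hg₀ hg₁
  have hfg₀ : (f ≫ g).f 0 = 𝟙 _ := by
    rw [HomologicalComplex.comp_f, ← cancel_mono X.left.hom, Category.assoc, hg₀, hf₀,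
      Category.id_comp]
  have hfg₁ : f.f (k + 2) ≫ g.f (k + 2) = 𝟙 _ := by
    rw [← cancel_mono X.right.hom, Category.assoc, hg₁, hf₁, Category.id_comp]
  have hgf₀ : (g ≫ f).f 0 = 𝟙 _ := by
    rw [HomologicalComplex.comp_f, ← cancel_mono Y.left.hom, Category.assoc, hf₀, hg₀,
      Category.id_comp]
  have hgf₁ : g.f (k + 2) ≫ f.f (k + 2) = 𝟙 _ := by
    rw [← cancel_mono Y.right.hom, Category.assoc, hf₁, hg₁, Category.id_comp]
  have hgf₀' : F.map (g.f 0) ≫ F.map (f.f 0) = 𝟙 _ := by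
    rw [← F.map_comp, ← HomologicalComplex.comp_f, hgf₀, F.map_id]
  have hfg₀' : F.map (f.f 0) ≫ F.map (g.f 0) = 𝟙 _ := by
    rw [← F.map_comp, ← HomologicalComplex.comp_f, hfg₀, F.map_id]
  have hv : ∀ (Q Q' : 𝒞) (j : ℤ), -(k + 1 : ℕ) < j → j ≤ -1 →
      HomVanish (F.obj Q) (F.obj Q') j := fun Q Q' j h h' =>
    hF (F.obj_mem_essImage _) (F.obj_mem_essImage _) j (by omega) (by push_cast at h ⊢; omega)
      (by push_cast; omega)
  -- The complex Y splits for degree reasons, but this does not yet identify the last object of the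
  -- tower with the last term of Y; that comes from comparison with the tower of X.
  obtain ⟨M, a, m, e, η, h₁, h₂, h₃⟩ := Tower.exists_of_complex (k + 1)
    (fun i => F.obj (Y.K.X (i + 1))) (fun i => F.map (Y.K.d (i + 1) (i + 2)))
    (fun i => by rw [← F.map_comp, Y.K.d_comp_d, F.map_zero]) (fun i i' j => hv _ _ j)
    (F.obj (Y.K.X 0)) (fun i j => hv _ _ j) (F.map (Y.K.d 0 1))
    (fun _ => by rw [← F.map_comp, Y.K.d_comp_d, F.map_zero])
  let t : Tower 𝒯 := ⟨M, fun i => F.obj (Y.K.X (i + 1)), m, e, η⟩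
  have ht : t.IsDist (k + 1) := h₁
  obtain ⟨φ, hφ₀, hφ⟩ := Tower.exists_isHom_of_comm p.isDist (t' := t) ht
    (fun i hi => Tower.homVanish_from_of_first hF p.isDist (fun i _ => F.obj_mem_essImage _)
      p.essImage_first (F.obj_mem_essImage _) (i := i) (by omega) le_rfl (by push_cast; omega))
    (fun i => F.map (f.f (i + 1))) (fun i hi => by
      rw [← p.d_succ i (by omega), ← h₃ i (by omega), ← F.map_comp, ← F.map_comp, f.comm])
    (p.a.inv ≫ F.map (f.f 0) ≫ a.hom) (fun _ => by
      have e₁ : p.tower.m 0 = p.a.inv ≫ F.map (X.K.d 0 1) := by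
        rw [p.d_zero, p.a.inv_hom_id_assoc]
      have e₂ : (a.hom ≫ t.m 0) = F.map (Y.K.d 0 1) := h₂.symm
      rw [Category.assoc, Category.assoc, e₂, e₁, Category.assoc, ← F.map_comp, ← F.map_comp,
        f.comm])
  obtain ⟨ψ, hψ₀, hψ⟩ := Tower.exists_isHom_of_comm (t := t) ht p.isDist
    (fun i hi => Tower.homVanish_from_of_first hF ht (fun i _ => F.obj_mem_essImage _)
      ⟨_, ⟨a⟩⟩ (F.obj_mem_essImage _) (i := i) (by omega) le_rfl (by push_cast; omega))
    (fun i => F.map (g.f (i + 1))) (fun i hi => by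
      rw [← p.d_succ i (by omega), ← h₃ i (by omega), ← F.map_comp, ← F.map_comp, g.comm])
    (a.inv ≫ F.map (g.f 0) ≫ p.a.hom) (fun _ => by
      have e₁ : t.m 0 = a.inv ≫ F.map (Y.K.d 0 1) := by rw [h₂, a.inv_hom_id_assoc]
      rw [Category.assoc, Category.assoc, ← p.d_zero, e₁, Category.assoc, ← F.map_comp,
        ← F.map_comp, g.comm])
  have := p.isIso
  -- The last map is redefined as that of X, transported through `ψ` and `f`; it is invertible as
  -- soon as `ψ (k + 1)` is.
  let m' : ∀ i, M i ⟶ F.obj (Y.K.X (i + 1)) :=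
    Function.update m (k + 1) (ψ (k + 1) ≫ p.m (k + 1) ≫ F.map (f.f (k + 2)))
  have hm : ∀ i < k + 1, m' i = m i := fun i hi => Function.update_of_ne (by omega) _ _
  have hm' : m' (k + 1) = ψ (k + 1) ≫ p.m (k + 1) ≫ F.map (f.f (k + 2)) :=
    Function.update_self _ _ _
  let t' : Tower 𝒯 := ⟨M, fun i => F.obj (Y.K.X (i + 1)), m', e, η⟩
  have ht' : t'.IsDist (k + 1) := fun i hi => by
    simpa only [t', hm i hi] using h₁ i hi
  have hφ' : Tower.IsHom p.tower t' (k + 1) φ (fun i => F.map (f.f (i + 1))) := fun i hi => by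
    simpa only [t', hm i hi] using hφ i hi
  have hψ' : Tower.IsHom t' p.tower (k + 1) ψ (fun i => F.map (g.f (i + 1))) := fun i hi => by
    simpa only [t', hm i hi] using hψ i hi
  have h₀' : F.map (Y.K.d 0 1) = a.hom ≫ m' 0 := by rw [hm 0 (by omega), h₂]
  have h₃' : ∀ i < k + 1, F.map (Y.K.d (i + 1) (i + 2)) = e i ≫ m' (i + 1) := by
    intro i hi
    rcases Nat.lt_or_ge i k with hi' | hi'
    · rw [hm (i + 1) (by omega), h₃ i hi]
    · obtain rfl : i = k := by omega
      have e₁ : e i ≫ ψ (i + 1) = F.map (g.f (i + 1)) ≫ p.e i := (hψ i hi).2.1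
      rw [hm', reassoc_of% e₁, ← reassoc_of% (p.d_succ i hi), ← F.map_comp, ← F.map_comp,
        g.comm_assoc, hgf₁, Category.comp_id]
  have I₁ := Postnikov.isIso_sub p.isDist p.d_zero p.d_succ (f := f ≫ g)
    (φ := fun i => φ i ≫ ψ i) (by simpa using hφ'.comp hψ') (by
      rw [hφ₀, hψ₀]
      simp [reassoc_of% hfg₀']) hfg₀ H
  have I₂ := Postnikov.isIso_sub ht' h₀' h₃' (f := g ≫ f) (φ := fun i => ψ i ≫ φ i)
    (by simpa using hψ'.comp hφ') (by
      rw [hφ₀, hψ₀]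
      simp [reassoc_of% hgf₀']) hgf₀ H'
  -- Since `f ≫ g` is the identity at the right end, the correction term in `I₁` vanishes; this
  -- makes `ψ (k + 1)` a split epimorphism.
  have e₁ : H.hom (k + 2) (k + 1) ≫ X.K.d (k + 1) (k + 2) = 0 := by
    have := H.comm (k + 2)
    rw [Homotopy.dNext_cochainComplex, Homotopy.prevD_succ_cochainComplex,
      HomologicalComplex.comp_f, hfg₁, (X.isZero (k + 3) (by omega)).eq_of_tgt (X.K.d _ _) 0,
      zero_comp, zero_add, HomologicalComplex.id_f, right_eq_add] at this
    exact this
  have e₂ : F.map (H.hom (k + 2) (k + 1)) ≫ p.e k = 0 := by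
    have := congrArg F.map e₁
    rw [F.map_comp, F.map_zero, p.d_succ k (by omega), ← Category.assoc] at this
    exact (Preadditive.IsIso.comp_right_eq_zero _ _).1 this
  rw [e₂, comp_zero, sub_zero] at I₁
  have : IsSplitEpi (ψ (k + 1)) := ⟨⟨⟨inv (φ (k + 1) ≫ ψ (k + 1)) ≫ φ (k + 1), by
    rw [Category.assoc, IsIso.inv_hom_id]⟩⟩⟩
  -- The correction term in `I₂` begins with `m'`, hence with `ψ (k + 1)`; so anything killed by `ψ
  -- (k + 1)` is killed by an isomorphism.
  have : Mono (ψ (k + 1)) := by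
    refine Preadditive.mono_of_cancel_zero _ fun {Q} x hx => ?_
    have h : x ≫ (ψ (k + 1) ≫ φ (k + 1) -
        m' (k + 1) ≫ F.map (H'.hom (k + 2) (k + 1)) ≫ e k) = 0 := by
      rw [Preadditive.comp_sub, reassoc_of% hx, hm', Category.assoc, reassoc_of% hx, zero_comp,
        zero_comp, sub_zero]
    exact (Preadditive.IsIso.comp_right_eq_zero _ _).1 h
  have : IsIso (ψ (k + 1)) := isIso_of_mono_of_isSplitEpi _
  have : IsIso (f.f (k + 2)) := ⟨g.f (k + 2), hfg₁, hgf₁⟩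
  refine ⟨⟨M, a, m', e, η, ht', h₀', h₃', by rw [hm']; infer_instance⟩, ?_⟩
  change t'.prod (k + 1) ≫ _ = m' (k + 1) ≫ _
  have e₃ := hψ'.prod_comp
  have e₄ : a.inv ≫ F.map Y.left.hom = ψ 0 ≫ p.a.inv ≫ F.map X.left.hom := by
    rw [hψ₀]
    simp [← F.map_comp, hg₀]
  have hp : p.tower.prod (k + 1) ≫ (p.a.inv ≫ F.map X.left.hom)⟦((k + 1 : ℕ) : ℤ)⟧' = _ := hp
  have e₅ : F.map (f.f (k + 2)) ≫ F.map Y.right.hom = F.map X.right.hom := by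
    rw [← F.map_comp, hf₁]
  dsimp only
  rw [e₄, Functor.map_comp, reassoc_of% e₃, hp, hm']
  simp only [Category.assoc]
  rw [reassoc_of% e₅]

end

/-! ### Mapping cones of morphisms of towers. -/

section
variable {𝒯 : Type u} [Category.{v} 𝒯] [Preadditive 𝒯] [HasZeroObject 𝒯] [HasShift 𝒯 ℤ]
  [∀ k : ℤ, (shiftFunctor 𝒯 k).Additive] [Pretriangulated 𝒯]
variable {𝒞 : Type u'} [Category.{v'} 𝒞] [Preadditive 𝒞] {F : 𝒞 ⥤ 𝒯} {n : ℕ}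

lemma exists_hom_of_comm [F.Full] [F.Faithful] {K K' : CochainComplex 𝒞 ℕ}
    (hK' : ∀ i, n + 1 < i → IsZero (K'.X i)) (φ : ∀ i, F.obj (K.X i) ⟶ F.obj (K'.X i))
    (hφ : ∀ i ≤ n, F.map (K.d i (i + 1)) ≫ φ (i + 1) = φ i ≫ F.map (K'.d i (i + 1))) :
    ∃ g : K ⟶ K', ∀ i, F.map (g.f i) = φ i := by
  refine ⟨⟨fun i => F.preimage (φ i), ?_⟩, fun i => F.map_preimage _⟩
  rintro i j rfl
  rcases Nat.lt_or_ge n i with hi | hi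
  · exact (hK' (i + 1) (by omega)).eq_of_tgt _ _
  · apply F.map_injective
    simp [hφ i hi]

section Biprod

variable [HasBinaryBiproducts 𝒞] [F.Additive]

variable (F) in
/-- An additive functor preserves biproducts. -/
def mapBiprodIso (X Y : 𝒞) : F.obj (X ⊞ Y) ≅ F.obj X ⊞ F.obj Y where
  hom := biprod.lift (F.map biprod.fst) (F.map biprod.snd)
  inv := biprod.desc (F.map biprod.inl) (F.map biprod.inr)
  hom_inv_id := by
    rw [biprod.lift_desc, ← F.map_comp, ← F.map_comp, ← F.map_add, biprod.total, F.map_id]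
  inv_hom_id := by
    have h₁ : F.map (biprod.inl : X ⟶ X ⊞ Y) ≫ F.map biprod.fst = 𝟙 _ := by
      rw [← F.map_comp, biprod.inl_fst, F.map_id]
    have h₂ : F.map (biprod.inl : X ⟶ X ⊞ Y) ≫ F.map biprod.snd = 0 := by
      rw [← F.map_comp, biprod.inl_snd, F.map_zero]
    have h₃ : F.map (biprod.inr : Y ⟶ X ⊞ Y) ≫ F.map biprod.fst = 0 := by
      rw [← F.map_comp, biprod.inr_fst, F.map_zero]
    have h₄ : F.map (biprod.inr : Y ⟶ X ⊞ Y) ≫ F.map biprod.snd = 𝟙 _ := by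
      rw [← F.map_comp, biprod.inr_snd, F.map_id]
    ext <;> simp [h₁, h₂, h₃, h₄]

lemma map_lift_mapBiprodIso {X Y Z : 𝒞} (f : Z ⟶ X) (g : Z ⟶ Y) :
    F.map (biprod.lift f g) ≫ (mapBiprodIso F X Y).hom = biprod.lift (F.map f) (F.map g) := by
  ext <;> simp [mapBiprodIso, ← F.map_comp]

lemma map_desc_eq {X Y Z : 𝒞} (f : X ⟶ Z) (g : Y ⟶ Z) :
    F.map (biprod.desc f g) = (mapBiprodIso F X Y).hom ≫ biprod.desc (F.map f) (F.map g) := by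
  rw [← Iso.inv_comp_eq]
  ext <;> simp [mapBiprodIso, ← F.map_comp]

lemma ofComponents_eq_desc {X Y X' Y' : 𝒞} (a : X ⟶ X') (b : X ⟶ Y') (c : Y ⟶ X')
    (d : Y ⟶ Y') :
    Biprod.ofComponents a b c d = biprod.desc (biprod.lift a b) (biprod.lift c d) := by
  ext <;> simp

lemma map_ofComponents_mapBiprodIso {X Y X' Y' : 𝒞} (a : X ⟶ X') (b : X ⟶ Y') (c : Y ⟶ X')
    (d : Y ⟶ Y') :
    F.map (Biprod.ofComponents a b c d) ≫ (mapBiprodIso F X' Y').hom =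
      (mapBiprodIso F X Y).hom ≫
        Biprod.ofComponents (F.map a) (F.map b) (F.map c) (F.map d) := by
  rw [ofComponents_eq_desc, ofComponents_eq_desc, map_desc_eq, Category.assoc]
  congr 1
  apply biprod.hom_ext' <;> simp [map_lift_mapBiprodIso]

end Biprod

/-- Sequences decomposing the mapping cone of a morphism from the tower `t` to the tower `t'`. -/
structure IsConeSeq (t t' : Tower 𝒯) (k : ℕ) (N : ℕ → 𝒯) (j : ∀ i, t'.M i ⟶ N i)
    (π : ∀ i, N i ⟶ t.M (i + 1)) (y : ∀ i, t.X i ⟶ N i) (q : ∀ i, N i ⟶ t'.X i)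
    (θ : ∀ i, N (i + 1) ⟶ (N i)⟦(1 : ℤ)⟧) : Prop where
  j_q : ∀ i ≤ k, j i ≫ q i = t'.m i
  y_π : ∀ i < k, y i ≫ π i = t.e i
  j_π : ∀ i < k, j i ≫ π i = 0
  j_θ : ∀ i < k, j (i + 1) ≫ θ i = t'.η i ≫ (j i)⟦(1 : ℤ)⟧'
  dist : ∀ i < k, Triangle.mk (biprod.lift (π i ≫ (-t.m (i + 1))) (q i))
    (biprod.desc (y (i + 1)) (t'.e i ≫ j (i + 1))) (θ i) ∈ distTriang 𝒯

/-- Vanishing of the composite in each triangle of the cone makes `y i ≫ q i` compatible with the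
differentials; these composites define the good lift. -/
lemma IsConeSeq.comm {t t' : Tower 𝒯} {k : ℕ} {N : ℕ → 𝒯} {j : ∀ i, t'.M i ⟶ N i}
    {π : ∀ i, N i ⟶ t.M (i + 1)} {y : ∀ i, t.X i ⟶ N i} {q : ∀ i, N i ⟶ t'.X i}
    {θ : ∀ i, N (i + 1) ⟶ (N i)⟦(1 : ℤ)⟧} (h : IsConeSeq t t' k N j π y q θ) {i : ℕ} (hi : i < k) :
    (t.e i ≫ t.m (i + 1)) ≫ y (i + 1) ≫ q (i + 1) =
      (y i ≫ q i) ≫ t'.e i ≫ t'.m (i + 1) := by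
  have := distTriang_comp₁₂ (h.dist i hi)
  simp only [biprod.lift_desc, Preadditive.comp_neg, Preadditive.neg_comp, Category.assoc] at this
  rw [neg_add_eq_zero] at this
  rw [← h.y_π i hi, ← h.j_q (i + 1) hi]
  simp only [Category.assoc]
  rw [reassoc_of% this]

/-- The chain runs on `t.tail` and `t'`, and its first link is the first triangle of `t` transported
along `a`. So N 0 is `t.X 0`, the starting object of the cone, and N (k + 1) is the end of `t'`. -/
lemma exists_isConeSeq [IsTriangulated 𝒯] {t t' : Tower 𝒯} {k : ℕ} {P : ObjectProperty 𝒯}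
    (hP : IsRigid (k + 1) P) (ht : t.IsDist (k + 1)) (ht' : t'.IsDist (k + 1))
    (hX : ∀ i ≤ k + 1, P (t.X i)) (hX' : ∀ i < k + 1, P (t'.X i)) (h₀ : P (t'.M 0))
    (hk : P (t.M (k + 1))) (hm : IsIso (t.m (k + 1))) (a : t.M 0 ⟶ t'.M 0) (ha : IsIso a)
    (c : t.M (k + 1) ⟶ t'.M (k + 1))
    (hc : t.prod (k + 1) ≫ a⟦((k + 1 : ℕ) : ℤ)⟧' = c ≫ t'.prod (k + 1)) :
    ∃ (N : ℕ → 𝒯) (j : ∀ i, t'.M i ⟶ N i) (π : ∀ i, N i ⟶ t.M (i + 1)) (y : ∀ i, t.X i ⟶ N i)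
      (q : ∀ i, N i ⟶ t'.X i) (θ : ∀ i, N (i + 1) ⟶ (N i)⟦(1 : ℤ)⟧),
      IsConeSeq t t' (k + 1) N j π y q θ ∧ IsIso (y 0) ∧ IsIso (j (k + 1)) ∧
      t.m 0 ≫ y 0 = a ≫ j 0 ∧ t.m (k + 1) ≫ y (k + 1) = c ≫ j (k + 1) := by
  obtain ⟨s₀, ν, hj, hp, hω, hd⟩ : ∃ (s₀ : Link (t'.M 0) (t.M 1)) (ν : t.X 0 ≅ s₀.N),
      t.m 0 ≫ ν.hom = a ≫ s₀.j ∧ ν.hom ≫ s₀.p = t.e 0 ∧ s₀.ω = t.η 0 ≫ a⟦(1 : ℤ)⟧' ∧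
      s₀.IsDist :=
    ⟨⟨t.X 0, inv a ≫ t.m 0, t.e 0, t.η 0 ≫ a⟦(1 : ℤ)⟧'⟩, Iso.refl _, by simp, by simp, rfl,
      distTriang_of_iso (ht 0 (by omega)) (asIso a).symm (Iso.refl _) (Iso.refl _) (by simp)
        (by simp) (by simp)⟩
  obtain ⟨s, q, x, θ, rfl, h₁, h₂, h₃, h₄⟩ := exists_cone_chain hP (X := t.tail) (Y := t') ht.tail
    ht' le_rfl (fun i hi => hX (i + 1) (by omega)) hX' hk
    (fun i hi => Tower.homVanish_from_of_first hP ht' hX' h₀ (hX _ (by omega)) (i := i) (by omega)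
      le_rfl (by push_cast; omega)) hm s₀ hd c (by
        rw [← hc, ← Tower.tail_prod_comp_map]
        exact congrArg (fun z => ShiftedHom.comp (t.tail.prod k) z _) hω)
  -- The chain says nothing about the last `q`; its value is forced by `j ≫ q = m'`.
  let q' := Function.update q (k + 1) (inv (s (k + 1)).j ≫ t'.m (k + 1))
  have hq : ∀ i < k + 1, q' i = q i := fun i hi => Function.update_of_ne (by omega) _ _
  have hq' : q' (k + 1) = inv (s (k + 1)).j ≫ t'.m (k + 1) := Function.update_self _ _ _
  refine ⟨fun i => (s i).N, fun i => (s i).j, fun i => (s i).p,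
    fun | 0 => ν.hom | i + 1 => x i, q', θ, ⟨?_, ?_, ?_, ?_, ?_⟩, inferInstanceAs (IsIso ν.hom),
    h₃, hj, h₄⟩
  · intro i hi
    rcases hi.lt_or_eq with hi | rfl
    · rw [hq i hi]
      exact (h₁ i hi).j_q
    · rw [hq', IsIso.hom_inv_id_assoc]
  · rintro (_ | i) hi
    · exact hp
    · exact (h₂ i (by omega)).x_p
  · exact fun i hi => (h₁ i hi).j_p
  · exact fun i hi => (h₁ i hi).j_θ
  · intro i hi
    rw [hq i hi]
    exact (h₁ i hi).dist

end

/-! ### Axiom (EA2). -/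

section
variable {𝒯 : Type u} [Category.{v} 𝒯] [Preadditive 𝒯] [HasZeroObject 𝒯] [HasShift 𝒯 ℤ]
  [∀ k : ℤ, (shiftFunctor 𝒯 k).Additive] [Pretriangulated 𝒯]

/-- The tower of the mapping cone of a morphism from `t` to `t'`. -/
abbrev coneTower (t t' : Tower 𝒯) (N : ℕ → 𝒯) (j : ∀ i, t'.M i ⟶ N i)
    (π : ∀ i, N i ⟶ t.M (i + 1)) (y : ∀ i, t.X i ⟶ N i) (q : ∀ i, N i ⟶ t'.X i)
    (θ : ∀ i, N (i + 1) ⟶ (N i)⟦(1 : ℤ)⟧) : Tower 𝒯 where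
  M := N
  X i := t.X (i + 1) ⊞ t'.X i
  m i := biprod.lift (π i ≫ (-t.m (i + 1))) (q i)
  e i := biprod.desc (y (i + 1)) (t'.e i ≫ j (i + 1))
  η := θ

namespace IsConeSeq

variable {t t' : Tower 𝒯} {k : ℕ} {N : ℕ → 𝒯} {j : ∀ i, t'.M i ⟶ N i}
  {π : ∀ i, N i ⟶ t.M (i + 1)} {y : ∀ i, t.X i ⟶ N i} {q : ∀ i, N i ⟶ t'.X i}
  {θ : ∀ i, N (i + 1) ⟶ (N i)⟦(1 : ℤ)⟧} (h : IsConeSeq t t' k N j π y q θ)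

include h

/-- Through `Tower.IsHom.prod_comp`, this computes the product of the connecting morphisms of the
cone from that of `t'`. -/
lemma isHom_coneTower :
    Tower.IsHom t' (coneTower t t' N j π y q θ) k j (fun _ => biprod.inr) := by
  intro i hi
  refine ⟨?_, by simp, (h.j_θ i hi).symm⟩
  apply biprod.hom_ext
  · simp [reassoc_of% (h.j_π i hi)]
  · simp [h.j_q i hi.le]

lemma e_comp_m_coneTower {i : ℕ} (hi : i + 1 < k) :
    (coneTower t t' N j π y q θ).e i ≫ (coneTower t t' N j π y q θ).m (i + 1) =
      Biprod.ofComponents (-(t.e (i + 1) ≫ t.m (i + 2))) (y (i + 1) ≫ q (i + 1)) 0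
        (t'.e i ≫ t'.m (i + 1)) := by
  rw [ofComponents_eq_desc]
  ext
  · simp [reassoc_of% (h.y_π (i + 1) hi)]
  · simp
  · simp [reassoc_of% (h.j_π (i + 1) hi)]
  · simp [h.j_q (i + 1) hi.le]

end IsConeSeq

variable [IsTriangulated 𝒯]
variable {𝒞 : Type u'} [Category.{v'} 𝒞] [Preadditive 𝒞] {F : 𝒞 ⥤ 𝒯} {k : ℕ}
  [HasZeroObject 𝒞] [HasBinaryBiproducts 𝒞] [F.Additive] [F.Full] [F.Faithful]

/-- The axiom (EA2) for decomposable complexes. -/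
lemma IsDecomposableAlong.exists_isMappingCone (hF : IsRigid (k + 1) F.essImage) {A C D : 𝒞}
    {ρ : F.obj D ⟶ (F.obj A)⟦((k + 1 : ℕ) : ℤ)⟧} {c : C ⟶ D} {X : NComplex (k + 1) A C}
    {Y : NComplex (k + 1) A D} (hX : IsDecomposableAlong F X (F.map c ≫ ρ))
    (hY : IsDecomposableAlong F Y ρ) :
    ∃ (f : X.K ⟶ Y.K) (M : NComplex (k + 1) (X.K.X 1) D),
      HasEnds (X := X) (Y := Y) f (𝟙 A) c ∧ IsMappingCone (X := X) (Y := Y) f M ∧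
        IsDecomposableAlong F M (ρ ≫ (F.map X.dFirst)⟦((k + 1 : ℕ) : ℤ)⟧') := by
  obtain ⟨p, hp⟩ := hX
  obtain ⟨p', hp'⟩ := hY
  have := p.isIso
  have := p'.isIso
  let a : p.M 0 ⟶ p'.M 0 := p.a.inv ≫ F.map (X.left.hom ≫ Y.left.inv) ≫ p'.a.hom
  let c' : p.M (k + 1) ⟶ p'.M (k + 1) :=
    p.m (k + 1) ≫ F.map (X.right.hom ≫ c ≫ Y.right.inv) ≫ inv (p'.m (k + 1))
  obtain ⟨N, j, π, y, q, θ, h, hy, hj, hm₀, hmk⟩ := exists_isConeSeq hF p.isDist p'.isDist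
    (fun i _ => F.obj_mem_essImage _) (fun i _ => F.obj_mem_essImage _) p'.essImage_first
    p.essImage_last p.isIso a inferInstance c' (by
      rw [hp.prod_eq, hp'.prod_eq]
      simp only [c', a, Category.assoc, ← Functor.map_comp, IsIso.inv_hom_id_assoc,
        Iso.hom_inv_id_assoc]
      simp only [Functor.map_comp, Category.assoc, Iso.map_inv_hom_id_assoc])
  have hW : (coneTower p.tower p'.tower N j π y q θ).IsDist (k + 1) := h.dist
  -- The lift is read off from the chain as `y i ≫ q i`, so its mapping cone is decomposable by
  -- construction.
  obtain ⟨f, hf⟩ := exists_hom_of_comm (K := X.K) (K' := Y.K) Y.isZero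
    (F := F) (fun | 0 => F.map (X.left.hom ≫ Y.left.inv) | i + 1 => y i ≫ q i) (by
      rintro (_ | i) hi
      · have := h.j_q 0 (by omega)
        rw [p.d_zero, p'.d_zero, Category.assoc, reassoc_of% hm₀, this]
        simp [a]
      · rw [p.d_succ i (by omega), p'.d_succ i (by omega)]
        exact h.comm (by omega))
  have hq := h.j_q (k + 1) le_rfl
  rw [← IsIso.eq_inv_comp] at hq
  obtain ⟨M, x, hM, hx, hx₀, hx₁, hxk⟩ := Tower.exists_complex F hW
    (fun i _ => ⟨_, ⟨mapBiprodIso F (X.K.X (i + 2)) (Y.K.X (i + 1))⟩⟩) (asIso (y 0))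
    ((asIso (j (k + 1))).symm ≪≫ asIso (p'.m (k + 1)) ≪≫ F.mapIso Y.right)
    (ρ ≫ (F.map X.dFirst)⟦((k + 1 : ℕ) : ℤ)⟧') (by
      have e₁ := h.isHom_coneTower.prod_comp
      rw [hp'.prod_eq] at e₁
      -- Under the identification `y 0`, the map `j 0` is the first differential of X; hence the
      -- cone realizes the pushforward of `ρ` along it.
      have e₂ : (F.map Y.left.inv ≫ p'.a.hom) ≫ j 0 ≫ inv (y 0) = F.map X.dFirst := by
        have : j 0 = inv a ≫ p.m 0 ≫ y 0 := by rw [IsIso.eq_inv_comp, hm₀]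
        rw [this]
        simp only [Category.assoc, IsIso.hom_inv_id, Category.comp_id]
        simp [a, NComplex.dFirst, p.d_zero]
      simp only [Category.assoc, ← (shiftFunctor 𝒯 ((k + 1 : ℕ) : ℤ)).map_comp] at e₁
      have e₃ := e₁ =≫ (inv (y 0))⟦((k + 1 : ℕ) : ℤ)⟧'
      simp only [Category.assoc, ← (shiftFunctor 𝒯 ((k + 1 : ℕ) : ℤ)).map_comp] at e₃ e₂
      rw [e₂] at e₃
      simp only [Iso.trans_hom, Iso.symm_hom, asIso_hom, asIso_inv, Functor.mapIso_hom,
        Category.assoc]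
      rw [← cancel_epi (j (k + 1)), IsIso.hom_inv_id_assoc]
      exact e₃.symm)
  have hfk : F.map (f.f (k + 2)) = F.map (X.right.hom ≫ c ≫ Y.right.inv) := by
    rw [hf, ← cancel_epi (p.m (k + 1))]
    dsimp only
    rw [reassoc_of% hmk, hq]
    simp [c']
  let e : ∀ i < k + 1, (M.K.X (i + 1) ≅ X.K.X (i + 2) ⊞ Y.K.X (i + 1)) := fun i hi =>
    have := hx i hi
    F.preimageIso (asIso (x i) ≪≫ (mapBiprodIso F _ _).symm)
  have he : ∀ i (hi : i < k + 1), F.map (e i hi).hom ≫ (mapBiprodIso F _ _).hom = x i := by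
    intro i hi
    simp [e]
  have e₂ : ∀ i (hi : i < k), M.K.d (i + 1) (i + 2) ≫ (e (i + 1) (by omega)).hom =
      (e i (by omega)).hom ≫ Biprod.ofComponents (-(X.K.d (i + 2) (i + 3))) (f.f (i + 2)) 0
        (Y.K.d (i + 1) (i + 2)) := by
    intro i hi
    apply F.map_injective
    rw [← cancel_mono (mapBiprodIso F _ _).hom, F.map_comp, F.map_comp, Category.assoc,
      Category.assoc, map_ofComponents_mapBiprodIso, he (i + 1) (by omega),
      reassoc_of% (he i (by omega)), hx₁ i (by omega), h.e_comp_m_coneTower (by omega), hf,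
      F.map_neg, F.map_zero, p.d_succ (i + 1) (by omega), p'.d_succ i (by omega)]
  have e₃ : M.dLast = (e k (by omega)).hom ≫
      biprod.desc (f.f (k + 2) ≫ Y.right.hom) Y.dLast := by
    apply F.map_injective
    rw [← hxk, F.map_comp, map_desc_eq, reassoc_of% (he k (by omega))]
    congr 1
    ext
    · simp [hf, hq]
    · simp [NComplex.dLast, p'.d_succ k (by omega)]
  refine ⟨f, M, ⟨?_, ?_⟩,
    ⟨fun | 0, h₁, h₂ => absurd h₁ (by omega) | i + 1, h₁, h₂ => e i (by omega), ?_, ?_, fun _ => e₃⟩, hM⟩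
  · have : f.f 0 = X.left.hom ≫ Y.left.inv := F.map_injective (hf 0)
    simp [this]
  · simp [F.map_injective hfk]
  · intro _
    apply F.map_injective
    rw [← cancel_mono (mapBiprodIso F _ _).hom, F.map_comp, Category.assoc, he 0 (by omega), hx₀,
      map_lift_mapBiprodIso, hf, F.map_neg, p.d_succ 0 (by omega)]
    ext
    · simp [reassoc_of% (h.y_π 0 (by omega))]
    · simp
  · rintro (_ | i) h₁ h₂
    · omega
    · exact e₂ i (by omega)

end

/-! ### Mapping cocones and axiom (EA2)ᵒᵖ. -/

section
variable {𝒯 : Type u} [Category.{v} 𝒯] [Preadditive 𝒯] [HasZeroObject 𝒯] [HasShift 𝒯 ℤ]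
  [∀ k : ℤ, (shiftFunctor 𝒯 k).Additive] [Pretriangulated 𝒯]

/-- The homotopy pushout of the first morphism of a distinguished triangle. -/
lemma exists_homotopy_cocartesian [IsTriangulated 𝒯] {M X M' L : 𝒯} {m : M ⟶ X} {e : X ⟶ M'}
    {η : M' ⟶ M⟦(1 : ℤ)⟧} (hT : Triangle.mk m e η ∈ distTriang 𝒯) (a : M ⟶ L) :
    ∃ (N : 𝒯) (x : X ⟶ N) (j : L ⟶ N) (p : N ⟶ M'),
      Triangle.mk (biprod.lift m a) (biprod.desc x j) (p ≫ η) ∈ distTriang 𝒯 ∧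
      Triangle.mk j p (-(η ≫ a⟦(1 : ℤ)⟧')) ∈ distTriang 𝒯 ∧ x ≫ p = e := by
  obtain ⟨N, g, θ, hN⟩ := distinguished_cocone_triangle (biprod.lift m a)
  -- The composite considered is M ⟶ X ⊞ L ⟶ X, which equals `m`.
  let O := Triangulated.someOctahedron (biprod.lift_fst m a) hN
    (rot_of_distTriang _ (biprod_inr_fst_distTriang X L)) hT
  obtain ⟨p, ω, c₁, c₂, c₄, hO⟩ : ∃ (p : N ⟶ M') (ω : M' ⟶ L⟦(1 : ℤ)⟧), g ≫ p = biprod.fst ≫ e ∧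
      p ≫ η = θ ∧ η ≫ (biprod.lift m a)⟦(1 : ℤ)⟧' =
        ω ≫ (-(biprod.inr : L ⟶ X ⊞ L)⟦(1 : ℤ)⟧') ∧
      Triangle.mk p ω ((-(biprod.inr : L ⟶ X ⊞ L)⟦(1 : ℤ)⟧') ≫ g⟦(1 : ℤ)⟧') ∈ distTriang 𝒯 :=
    ⟨O.m₁, O.m₃, O.comm₁, O.comm₂, O.comm₄, O.mem⟩
  obtain rfl : ω = -(η ≫ a⟦(1 : ℤ)⟧') := by
    have := c₄ =≫ (biprod.snd : X ⊞ L ⟶ L)⟦(1 : ℤ)⟧'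
    rw [Category.assoc, Category.assoc, ← Functor.map_comp, biprod.lift_snd,
      Preadditive.neg_comp, ← Functor.map_comp, biprod.inr_snd] at this
    rw [this]
    simp
  refine ⟨N, biprod.inl ≫ g, biprod.inr ≫ g, p, ?_, distTriang_of_rot ?_, ?_⟩
  · rw [c₂]
    convert hN using 2
    ext <;> simp
  · convert hO using 2
    simp
  · simp [c₁]

/-- Sequences decomposing the mapping cocone of a morphism from the tower `t` to the tower `t'`. -/
structure IsCoconeSeq (t t' : Tower 𝒯) (k : ℕ) (N : ℕ → 𝒯) (j : ∀ i, t'.M i ⟶ N i)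
    (π : ∀ i, N i ⟶ t.M (i + 1)) (y : ∀ i, t.X i ⟶ N i) (q : ∀ i, N i ⟶ t'.X i)
    (θ : ∀ i, N (i + 1) ⟶ (N i)⟦(1 : ℤ)⟧) : Prop where
  j_q : ∀ i ≤ k, j i ≫ q i = t'.m i
  y_π : ∀ i ≤ k, y i ≫ π i = t.e i
  j_π : ∀ i ≤ k, j i ≫ π i = 0
  θ_π : ∀ i < k, θ i ≫ (π i)⟦(1 : ℤ)⟧' = -(π (i + 1) ≫ t.η (i + 1))
  dist : ∀ i < k, Triangle.mk (biprod.lift (π i ≫ (-t.m (i + 1))) (q i))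
    (biprod.desc (y (i + 1)) (t'.e i ≫ j (i + 1))) (θ i) ∈ distTriang 𝒯

lemma IsCoconeSeq.comm {t t' : Tower 𝒯} {k : ℕ} {N : ℕ → 𝒯} {j : ∀ i, t'.M i ⟶ N i}
    {π : ∀ i, N i ⟶ t.M (i + 1)} {y : ∀ i, t.X i ⟶ N i} {q : ∀ i, N i ⟶ t'.X i}
    {θ : ∀ i, N (i + 1) ⟶ (N i)⟦(1 : ℤ)⟧} (h : IsCoconeSeq t t' k N j π y q θ) {i : ℕ}
    (hi : i < k) : (t.e i ≫ t.m (i + 1)) ≫ y (i + 1) ≫ q (i + 1) =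
      (y i ≫ q i) ≫ t'.e i ≫ t'.m (i + 1) := by
  have := distTriang_comp₁₂ (h.dist i hi)
  simp only [biprod.lift_desc, Preadditive.comp_neg, Preadditive.neg_comp, Category.assoc] at this
  rw [neg_add_eq_zero] at this
  rw [← h.y_π i hi.le, ← h.j_q (i + 1) hi]
  simp only [Category.assoc]
  rw [reassoc_of% this]

/-- As `a` need not be invertible, the first link is a homotopy pushout along `a`. Its connecting
morphism carries a sign, so the chain is run with `-c`. -/
lemma exists_isCoconeSeq [IsTriangulated 𝒯] {t t' : Tower 𝒯} {k : ℕ} {P : ObjectProperty 𝒯}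
    (hP : IsRigid (k + 1) P) (ht : t.IsDist (k + 1)) (ht' : t'.IsDist (k + 1))
    (hX : ∀ i ≤ k + 1, P (t.X i)) (hX' : ∀ i < k + 1, P (t'.X i)) (h₀ : P (t'.M 0))
    (hk : P (t.M (k + 1))) (a : t.M 0 ⟶ t'.M 0) (c : t.M (k + 1) ⟶ t'.M (k + 1)) (hc' : IsIso c)
    (hc : t.prod (k + 1) ≫ a⟦((k + 1 : ℕ) : ℤ)⟧' = c ≫ t'.prod (k + 1)) :
    ∃ (N : ℕ → 𝒯) (j : ∀ i, t'.M i ⟶ N i) (π : ∀ i, N i ⟶ t.M (i + 1)) (y : ∀ i, t.X i ⟶ N i)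
      (q : ∀ i, N i ⟶ t'.X i) (θ : ∀ i, N (i + 1) ⟶ (N i)⟦(1 : ℤ)⟧),
      IsCoconeSeq t t' k N j π y q θ ∧ IsIso (q k) ∧ π k ≫ c = -(q k ≫ t'.e k) ∧
      Triangle.mk (biprod.lift (t.m 0) a) (biprod.desc (y 0) (j 0)) (π 0 ≫ t.η 0) ∈
        distTriang 𝒯 := by
  obtain ⟨s₀, ν, hT, hp, hω, hd⟩ : ∃ (s₀ : Link (t'.M 0) (t.M 1)) (ν : t.X 0 ⟶ s₀.N),
      Triangle.mk (biprod.lift (t.m 0) a) (biprod.desc ν s₀.j) (s₀.p ≫ t.η 0) ∈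
        distTriang 𝒯 ∧ ν ≫ s₀.p = t.e 0 ∧ s₀.ω = -(t.η 0 ≫ a⟦(1 : ℤ)⟧') ∧ s₀.IsDist := by
    obtain ⟨N, x, j, p, h₁, h₂, h₃⟩ := exists_homotopy_cocartesian (ht 0 (by omega)) a
    exact ⟨⟨N, j, p, _⟩, x, h₁, h₃, rfl, h₂⟩
  obtain ⟨s, q, x, θ, rfl, h₁, h₂, h₃, h₄⟩ := exists_cocone_chain hP (X := t.tail) (Y := t')
    ht.tail ht' le_rfl (fun i hi => hX (i + 1) (by omega)) hX' hk
    (fun i hi => Tower.homVanish_from_of_first hP ht' hX' h₀ (hX _ (by omega)) (i := i) (by omega)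
      le_rfl (by push_cast; omega)) s₀ hd (-c) (by
        rw [Preadditive.neg_comp, ← hc, ← Tower.tail_prod_comp_map, ← ShiftedHom.comp_neg]
        exact congrArg (fun z => ShiftedHom.comp (t.tail.prod k) z _) hω)
  have h₃' : Triangle.mk (s k).j (s k).p (s k).ω ∈ distTriang 𝒯 := h₃
  -- The last link is the pullback along `-c` of the last triangle of `t'`; invertibility of `c`
  -- therefore identifies N k with `t'.X k`.
  obtain ⟨b, hb, hb'⟩ := exists_hom₂ h₃' (ht' k (by omega)) (𝟙 _) (-c) (by simp [h₄])
  have hb₀ : IsIso b := isIso_of_distTriang₂ h₃' (ht' k (by omega)) (a := 𝟙 _) (c := -c) hb hb'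
    (by simp [h₄]) inferInstance (inferInstanceAs (IsIso (-(asIso c)).hom))
  let q' := Function.update q k b
  have hq : ∀ i < k, q' i = q i := fun i hi => Function.update_of_ne (by omega) _ _
  have hq' : q' k = b := Function.update_self _ _ _
  refine ⟨fun i => (s i).N, fun i => (s i).j, fun i => (s i).p,
    fun | 0 => ν | i + 1 => x i, q', θ, ⟨?_, ?_, ?_, ?_, ?_⟩, ?_, ?_, hT⟩
  · intro i hi
    rcases hi.lt_or_eq with hi | rfl
    · rw [hq i hi]
      exact (h₁ i hi).j_q
    · rw [hq', hb, Category.id_comp]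
  · rintro (_ | i) hi
    · exact hp
    · exact (h₂ i (by omega)).x_p
  · intro i hi
    rcases hi.lt_or_eq with hi | rfl
    · exact (h₁ i hi).j_p
    · exact distTriang_comp₁₂ h₃'
  · exact fun i hi => (h₂ i hi).θ_p
  · intro i hi
    rw [hq i hi]
    exact (h₁ i hi).dist
  · rwa [hq']
  · rw [hq', ← hb']
    simp

variable [IsTriangulated 𝒯]
variable {𝒞 : Type u'} [Category.{v'} 𝒞] [Preadditive 𝒞] {F : 𝒞 ⥤ 𝒯} {k : ℕ}

section Tower

variable {K' : CochainComplex 𝒞 ℕ} (t : Tower 𝒯) (p' : Postnikov F (k + 1) K')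

/-- The morphism `K'ⁱ ⟶ M i` of a decomposition. -/
abbrev Postnikov.ε : ∀ i, F.obj (K'.X i) ⟶ p'.M i
  | 0 => p'.a.hom
  | i + 1 => p'.e i

lemma Postnikov.map_d {i : ℕ} (hi : i ≤ k + 1) :
    F.map (K'.d i (i + 1)) = p'.ε i ≫ p'.m i := by
  rcases i with _ | i
  · exact p'.d_zero
  · exact p'.d_succ i hi

/-- The tower of the mapping cocone of a morphism from `t` to the tower of `p'`. -/
abbrev coconeTower (N : ℕ → 𝒯) (j : ∀ i, p'.M i ⟶ N i) (π : ∀ i, N i ⟶ t.M (i + 1))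
    (y : ∀ i, t.X i ⟶ N i) (q : ∀ i, N i ⟶ F.obj (K'.X (i + 1)))
    (θ : ∀ i, N (i + 1) ⟶ (N i)⟦(1 : ℤ)⟧) (a : t.M 0 ⟶ p'.M 0) : Tower 𝒯 where
  M := fun | 0 => t.M 0 | i + 1 => N i
  X i := t.X i ⊞ F.obj (K'.X i)
  m := fun
    | 0 => biprod.lift (t.m 0) (a ≫ p'.a.inv)
    | i + 1 => biprod.lift (π i ≫ t.m (i + 1)) (-q i)
  e i := biprod.desc (y i) (p'.ε i ≫ j i)
  η := fun
    | 0 => π 0 ≫ t.η 0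
    | i + 1 => -θ i

variable {t p'} {N : ℕ → 𝒯} {j : ∀ i, p'.M i ⟶ N i} {π : ∀ i, N i ⟶ t.M (i + 1)}
  {y : ∀ i, t.X i ⟶ N i} {q : ∀ i, N i ⟶ F.obj (K'.X (i + 1))}
  {θ : ∀ i, N (i + 1) ⟶ (N i)⟦(1 : ℤ)⟧} {a : t.M 0 ⟶ p'.M 0}
  (h : IsCoconeSeq t p'.tower k N j π y q θ)

include h

namespace IsCoconeSeq

lemma isDist_coconeTower
    (h₀ : Triangle.mk (biprod.lift (t.m 0) a) (biprod.desc (y 0) (j 0)) (π 0 ≫ t.η 0) ∈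
      distTriang 𝒯) : (coconeTower t p' N j π y q θ a).IsDist (k + 1) := by
  rintro (_ | i) hi
  · refine distTriang_of_iso h₀ (Iso.refl _) (biprod.mapIso (Iso.refl _) p'.a) (Iso.refl _)
      ?_ ?_ ?_
    · ext <;> simp
    · ext <;> simp
    · simp
  · have e : biprod.lift (π i ≫ t.m (i + 1)) (-q i) =
        -biprod.lift (π i ≫ (-t.m (i + 1))) (q i) := by
      ext <;> simp
    have := distTriang_neg (h.dist i (by omega))
    rw [← e] at this
    exact this

/-- Being the identity on M 0, this morphism to `t` exhibits the product of the cocone tower as the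
pullback along `π k` of the product of `t`. -/
lemma isHom_coconeTower :
    Tower.IsHom (coconeTower t p' N j π y q θ a) t (k + 1) (fun | 0 => 𝟙 _ | i + 1 => π i)
      (fun _ => biprod.fst) := by
  rintro (_ | i) hi
  · refine ⟨by simp, ?_, by simp⟩
    apply biprod.hom_ext'
    · simp [h.y_π 0 (by omega)]
    · simp [h.j_π 0 (by omega)]
  · refine ⟨by simp, ?_, ?_⟩
    · apply biprod.hom_ext'
      · simp [h.y_π (i + 1) (by omega)]
      · simp [h.j_π (i + 1) (by omega)]
    · simp [h.θ_π i (by omega)]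

lemma e_comp_m_coconeTower {i : ℕ} (hi : i < k) :
    (coconeTower t p' N j π y q θ a).e i ≫ (coconeTower t p' N j π y q θ a).m (i + 1) =
      Biprod.ofComponents (t.e i ≫ t.m (i + 1)) (-(y i ≫ q i)) 0 (-(p'.ε i ≫ p'.m i)) := by
  rw [ofComponents_eq_desc]
  ext
  · simp [reassoc_of% (h.y_π i hi.le)]
  · simp
  · simp [reassoc_of% (h.j_π i hi.le)]
  · simp [h.j_q i hi.le]

end IsCoconeSeq

end Tower

variable [HasZeroObject 𝒞] [HasBinaryBiproducts 𝒞] [F.Additive] [F.Full] [F.Faithful]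

/-- The axiom (EA2)ᵒᵖ for decomposable complexes. -/
lemma IsDecomposableAlong.exists_isMappingCocone (hF : IsRigid (k + 1) F.essImage) {A B C : 𝒞}
    {δ : F.obj C ⟶ (F.obj A)⟦((k + 1 : ℕ) : ℤ)⟧} {a : A ⟶ B} {X : NComplex (k + 1) A C}
    {Y : NComplex (k + 1) B C} (hX : IsDecomposableAlong F X δ)
    (hY : IsDecomposableAlong F Y (δ ≫ (F.map a)⟦((k + 1 : ℕ) : ℤ)⟧')) :
    ∃ (f : X.K ⟶ Y.K) (N : NComplex (k + 1) A (Y.K.X (k + 1))),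
      HasEnds (X := X) (Y := Y) f a (𝟙 C) ∧ IsMappingCocone (X := X) (Y := Y) f N ∧
        IsDecomposableAlong F N (F.map Y.dLast ≫ δ) := by
  obtain ⟨p, hp⟩ := hX
  obtain ⟨p', hp'⟩ := hY
  have := p.isIso
  have := p'.isIso
  let a' : p.M 0 ⟶ p'.M 0 := p.a.inv ≫ F.map (X.left.hom ≫ a ≫ Y.left.inv) ≫ p'.a.hom
  let c : p.M (k + 1) ⟶ p'.M (k + 1) :=
    p.m (k + 1) ≫ F.map (X.right.hom ≫ Y.right.inv) ≫ inv (p'.m (k + 1))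
  obtain ⟨N, j, π, y, q, θ, h, hq, hc, hd⟩ := exists_isCoconeSeq hF p.isDist p'.isDist
    (fun i _ => F.obj_mem_essImage _) (fun i _ => F.obj_mem_essImage _) p'.essImage_first
    p.essImage_last a' c inferInstance (by
      rw [hp.prod_eq, hp'.prod_eq]
      simp only [c, a', Category.assoc, ← Functor.map_comp, IsIso.inv_hom_id_assoc,
        Iso.hom_inv_id_assoc]
      simp only [Functor.map_comp, Category.assoc, Iso.map_inv_hom_id_assoc])
  have hm₀ : p.m 0 ≫ y 0 = -(a' ≫ j 0) := by
    have := distTriang_comp₁₂ hd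
    rw [biprod.lift_desc] at this
    exact eq_neg_of_add_eq_zero_left this
  have hc' : c ≫ p'.m (k + 1) = p.m (k + 1) ≫ F.map (X.right.hom ≫ Y.right.inv) := by simp [c]
  have hW := h.isDist_coconeTower hd
  -- The cocone convention makes the lift `-(y i ≫ q i)`. The chain stops at index `k`, so the
  -- component of degree `k + 2` is prescribed separately.
  let φ : ∀ i, F.obj (X.K.X i) ⟶ F.obj (Y.K.X i) := fun
    | 0 => F.map (X.left.hom ≫ a ≫ Y.left.inv)
    | i + 1 => -(y i ≫ q i)
  let φ' := Function.update φ (k + 2) (F.map (X.right.hom ≫ Y.right.inv))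
  have hφ : ∀ i < k + 2, φ' i = φ i := fun i hi => Function.update_of_ne (by omega) _ _
  have hφ' : φ' (k + 2) = _ := Function.update_self _ _ _
  obtain ⟨f, hf⟩ := exists_hom_of_comm (K := X.K) (K' := Y.K) Y.isZero (F := F) φ' (by
      rintro (_ | i) hi
      · have hjq : j 0 ≫ q 0 = p'.m 0 := h.j_q 0 (by omega)
        rw [hφ 0 (by omega), hφ 1 (by omega), p.d_zero, p'.d_zero]
        simp only [φ, Preadditive.comp_neg, Category.assoc]
        rw [reassoc_of% hm₀]
        simp [a', hjq]
      · rw [hφ (i + 1) (by omega), p.d_succ i (by omega), p'.d_succ i (by omega)]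
        rcases Nat.lt_or_ge i k with hi' | hi'
        · rw [hφ (i + 2) (by omega)]
          simpa [φ] using h.comm hi'
        · obtain rfl : i = k := by omega
          have e := h.y_π i le_rfl
          dsimp only at e
          rw [hφ', Category.assoc, ← hc', ← e]
          simp [φ, reassoc_of% hc])
  obtain ⟨M, x, hM, hx, hx₀, hx₁, hxk⟩ := Tower.exists_complex F hW
    (fun i _ => ⟨_, ⟨mapBiprodIso F (X.K.X (i + 1)) (Y.K.X i)⟩⟩) (F.mapIso X.left.symm ≪≫ p.a)
    (-asIso (q k)) (F.map Y.dLast ≫ δ) (by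
      have e₁ := h.isHom_coconeTower (a := a').prod_comp
      rw [hp.prod_eq] at e₁
      have e₂ : F.map Y.dLast = p'.e k ≫ p'.m (k + 1) ≫ F.map Y.right.hom := by
        simp [NComplex.dLast, p'.d_succ k (by omega)]
      have e₃ : (F.map X.left.inv ≫ p.a.hom) ≫ (F.mapIso X.left.symm ≪≫ p.a).inv = 𝟙 _ := by
        simp [← F.map_comp]
      have e₁ : (coconeTower p.tower p' N j π y q θ a').prod (k + 1) =
          π k ≫ p.m (k + 1) ≫ F.map X.right.hom ≫ δ ≫
            (F.map X.left.inv ≫ p.a.hom)⟦((k + 1 : ℕ) : ℤ)⟧' := by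
        refine Eq.trans ?_ e₁
        exact ((congrArg (_ ≫ ·) (CategoryTheory.Functor.map_id _ _)).trans
          (Category.comp_id _)).symm
      -- This sign is compensated by identifying N k with the last middle term of Y through `-q k`.
      have e₄ : π k ≫ p.m (k + 1) ≫ F.map X.right.hom = -(q k ≫ F.map Y.dLast) := by
        have hc : π k ≫ c = -(q k ≫ p'.e k) := hc
        have : p.m (k + 1) ≫ F.map X.right.hom = c ≫ p'.m (k + 1) ≫ F.map Y.right.hom := by
          rw [reassoc_of% hc']
          simp
        rw [this, reassoc_of% hc, e₂]
        simp
      rw [e₁]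
      simp only [Category.assoc, ← (shiftFunctor 𝒯 ((k + 1 : ℕ) : ℤ)).map_comp]
      simp only [Category.assoc] at e₃
      rw [e₃, CategoryTheory.Functor.map_id, Category.comp_id, reassoc_of% e₄]
      simp)
  let e : ∀ i < k + 1, (M.K.X (i + 1) ≅ X.K.X (i + 1) ⊞ Y.K.X i) := fun i hi =>
    have := hx i hi
    F.preimageIso (asIso (x i) ≪≫ (mapBiprodIso F _ _).symm)
  have he : ∀ i (hi : i < k + 1), F.map (e i hi).hom ≫ (mapBiprodIso F _ _).hom = x i := by
    intro i hi
    simp [e]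
  have e₁ : M.dFirst ≫ (e 0 (by omega)).hom =
      biprod.lift X.dFirst (X.left.inv ≫ f.f 0) := by
    apply F.map_injective
    rw [← cancel_mono (mapBiprodIso F _ _).hom, F.map_comp, Category.assoc, he 0 (by omega), hx₀,
      map_lift_mapBiprodIso, F.map_comp, hf, hφ 0 (by omega)]
    ext
    · simp [NComplex.dFirst, p.d_zero]
    · simp [a', φ]
  have e₂ : ∀ i (hi : i < k), M.K.d (i + 1) (i + 2) ≫ (e (i + 1) (by omega)).hom =
      (e i (by omega)).hom ≫ Biprod.ofComponents (X.K.d (i + 1) (i + 2)) (f.f (i + 1)) 0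
        (-(Y.K.d i (i + 1))) := by
    intro i hi
    apply F.map_injective
    rw [← cancel_mono (mapBiprodIso F _ _).hom, F.map_comp, F.map_comp, Category.assoc,
      Category.assoc, map_ofComponents_mapBiprodIso, he (i + 1) (by omega),
      reassoc_of% (he i (by omega)), hx₁ i (by omega), h.e_comp_m_coconeTower (by omega), hf,
      F.map_neg, F.map_zero, p.d_succ i (by omega), p'.map_d (by omega), hφ (i + 1) (by omega)]
  have e₃ : M.dLast = (e k (by omega)).hom ≫
      biprod.desc (f.f (k + 1)) (-(Y.K.d k (k + 1))) := by
    have hjq : j k ≫ q k = p'.m k := h.j_q k le_rfl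
    apply F.map_injective
    rw [← hxk, F.map_comp, map_desc_eq, reassoc_of% (he k (by omega)), hf, hφ (k + 1) (by omega),
      F.map_neg, p'.map_d (by omega), ← hjq]
    congr 1
    ext
    · simp [φ]
    · simp
  refine ⟨f, M, ⟨?_, ?_⟩, ⟨fun | _, j, rfl, h => e j (by omega),
    fun _ => e₁, ?_, ?_⟩, hM⟩
  · have : f.f 0 = X.left.hom ≫ a ≫ Y.left.inv := F.map_injective ((hf 0).trans (hφ 0 (by omega)))
    simp [this]
  · have : f.f (k + 2) = X.right.hom ≫ Y.right.inv := F.map_injective ((hf _).trans hφ')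
    simp [this]
  · rintro _ i rfl h₂
    exact e₂ i (by omega)
  · intro i hi
    obtain rfl : i = k := by omega
    exact e₃

end

/-! ### The n-exangulated structure given by decomposable complexes. -/

section
variable {𝒯 : Type u} [Category.{v} 𝒯] [Preadditive 𝒯] [HasZeroObject 𝒯] [HasShift 𝒯 ℤ]
  [∀ k : ℤ, (shiftFunctor 𝒯 k).Additive] [Pretriangulated 𝒯] [IsTriangulated 𝒯]
variable {𝒞 : Type u'} [Category.{v'} 𝒞] [Preadditive 𝒞] {F : 𝒞 ⥤ 𝒯} {r : ℕ}
  [HasZeroObject 𝒞] [HasBinaryBiproducts 𝒞] [F.Additive] [F.Full] [F.Faithful]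
  (hF : IsRigid (r + 1) F.essImage)
  (h : ObjectProperty.extensionProduct (starShifts F.essImage r) (starShifts F.essImage r) ≤
    starShifts F.essImage r)

include hF h

lemma exists_correspondence : ∃ 𝔰 : Correspondence (extAlong F (r + 1)) (r + 1),
    ∀ ⦃A C : 𝒞⦄ (δ : F.obj C ⟶ (F.obj A)⟦((r + 1 : ℕ) : ℤ)⟧) (X : NComplex (r + 1) A C),
      Realizes 𝔰 X δ ↔ IsDecomposableAlong F X δ := by
  -- The class of any chosen decomposable complex works: uniqueness and homotopy invariance say that
  -- its members are exactly the decomposable complexes.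
  choose Y hY using fun (A C : 𝒞) (δ : F.obj C ⟶ (F.obj A)⟦((r + 1 : ℕ) : ℤ)⟧) =>
    exists_isDecomposableAlong h δ
  refine ⟨fun A C δ => Quotient.mk _ (Y A C δ), fun A C δ X => ⟨fun e => ?_, fun hX => ?_⟩⟩
  · exact (hY A C δ).of_htpyEquivalent hF (Quotient.exact e)
  · exact Quotient.sound ((hY A C δ).htpyEquivalent hF hX)

/-- Decomposable complexes define an `n`-exangulated structure. -/
theorem isNExangulated_extAlong (𝔰 : Correspondence (extAlong F (r + 1)) (r + 1))
    (h𝔰 : ∀ ⦃A C : 𝒞⦄ (δ : F.obj C ⟶ (F.obj A)⟦((r + 1 : ℕ) : ℤ)⟧) (X : NComplex (r + 1) A C),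
      Realizes 𝔰 X δ ↔ IsDecomposableAlong F X δ) :
    IsNExangulated (extAlong F (r + 1)) 𝔰 := by
  have inflation : ∀ {A B : 𝒞} (f : A ⟶ B), IsInflation 𝔰 f ↔
      ∃ (Z : 𝒯) (g : F.obj B ⟶ Z) (w : Z ⟶ (F.obj A)⟦(1 : ℤ)⟧),
        Triangle.mk (F.map f) g w ∈ distTriang 𝒯 ∧ starShifts F.essImage r (Z⟦(r : ℤ)⟧) := by
    intro A B f
    rw [← exists_dFirst_eq_iff]
    exact exists_congr fun C => exists_congr fun δ => exists_congr fun X => exists_congr fun e =>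
      and_congr_left fun _ => h𝔰 δ X
  have deflation : ∀ {B C : 𝒞} (g : B ⟶ C), IsDeflation 𝔰 g ↔
      ∃ (Z : 𝒯) (f : Z ⟶ F.obj B) (w : F.obj C ⟶ Z⟦(1 : ℤ)⟧),
        Triangle.mk f (F.map g) w ∈ distTriang 𝒯 ∧ starShifts F.essImage r Z := by
    intro B C g
    rw [← exists_dLast_eq_iff]
    exact exists_congr fun A => exists_congr fun δ => exists_congr fun X => exists_congr fun e =>
      and_congr_left fun _ => h𝔰 δ X
  exact
    { hasZeroObject := inferInstance
      hasBinaryBiproducts := inferInstance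
      additive_left := inferInstance
      additive_right := inferInstance
      exists_lift := fun δ ρ X Y hX hY a c hac =>
        ((h𝔰 δ X).1 hX).exists_lift hF ((h𝔰 ρ Y).1 hY) a c hac
      isNExangle := fun δ X hX => ((h𝔰 δ X).1 hX).isNExangle hF
      realizes_idLeft := fun A => (h𝔰 _ _).2 (isDecomposableAlong_idLeft A)
      realizes_idRight := fun A => (h𝔰 _ _).2 (isDecomposableAlong_idRight A)
      inflation_comp := fun f g hf hg =>
        (inflation _).2 (exists_dFirst_eq_comp h ((inflation f).1 hf) ((inflation g).1 hg))
      deflation_comp := fun f g hf hg =>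
        (deflation _).2 (exists_dLast_eq_comp h ((deflation f).1 hf) ((deflation g).1 hg))
      exists_good_lift := fun ρ c X Y hX hY => by
        obtain ⟨f, M, h₁, h₂, h₃⟩ :=
          IsDecomposableAlong.exists_isMappingCone hF ((h𝔰 _ X).1 hX) ((h𝔰 ρ Y).1 hY)
        exact ⟨f, M, h₁, h₂, (h𝔰 _ M).2 h₃⟩
      exists_good_colift := fun δ a X Y hX hY => by
        obtain ⟨f, N, h₁, h₂, h₃⟩ :=
          IsDecomposableAlong.exists_isMappingCocone hF ((h𝔰 δ X).1 hX) ((h𝔰 _ Y).1 hY)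
        exact ⟨f, N, h₁, h₂, (h𝔰 _ N).2 h₃⟩ }

end

/-! ### Transfer to full subcategories of 𝒯. -/

section
variable {𝒯 : Type u} [Category.{v} 𝒯] [Preadditive 𝒯] [HasZeroObject 𝒯] [HasShift 𝒯 ℤ]
  [∀ k : ℤ, (shiftFunctor 𝒯 k).Additive] [Pretriangulated 𝒯]

/-- A decomposition involves only the image of the complex in 𝒯, so the data on both sides coincide.
-/
lemma isDecomposableAlong_comp_iff {𝒞 : Type*} [Category* 𝒞] [Preadditive 𝒞]
    {𝒟 : Type*} [Category* 𝒟] [Preadditive 𝒟] (G : 𝒟 ⥤ 𝒞) [G.Additive] (F : 𝒞 ⥤ 𝒯) {n : ℕ}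
    {A C : 𝒟} (X : NComplex n A C) (δ : F.obj (G.obj C) ⟶ (F.obj (G.obj A))⟦(n : ℤ)⟧) :
    IsDecomposableAlong (G ⋙ F) X δ ↔ IsDecomposableAlong F (X.map G) δ :=
  ⟨fun ⟨p, hp⟩ => ⟨⟨p.M, p.a, p.m, p.e, p.η, p.dist, p.d_zero, p.d_succ, p.isIso⟩, hp⟩,
   fun ⟨p, hp⟩ => ⟨⟨p.M, p.a, p.m, p.e, p.η, p.dist, p.d_zero, p.d_succ, p.isIso⟩, hp⟩⟩

section EssImage

variable {𝒞 : Type u'} [Category.{v'} 𝒞] [Preadditive 𝒞] (F : 𝒞 ⥤ 𝒯) [F.Full] [F.Faithful]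
  [F.Additive]

lemma hasZeroObject_of_essImage [F.essImage.ContainsZero] : HasZeroObject 𝒞 := by
  obtain ⟨Z, hZ, X, ⟨e⟩⟩ := F.essImage.exists_prop_of_containsZero
  refine ⟨X, (IsZero.iff_id_eq_zero X).2 (F.map_injective ?_)⟩
  exact (hZ.of_iso e).eq_of_src _ _

/-- The direct sum in 𝒯 is a split extension, so it lies in the image; its structure maps come back
by fullness. -/
lemma hasBinaryBiproducts_of_essImage
    (h : ObjectProperty.extensionProduct F.essImage F.essImage ≤ F.essImage) :
    HasBinaryBiproducts 𝒞 := by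
  refine ⟨fun X Y => ?_⟩
  obtain ⟨Z, ⟨e⟩⟩ : F.essImage (F.obj X ⊞ F.obj Y) :=
    h _ ⟨_, _, _, _, _, binaryBiproductTriangle_distinguished (F.obj X) (F.obj Y),
      F.obj_mem_essImage X, F.obj_mem_essImage Y⟩
  let b : BinaryBicone X Y :=
    { pt := Z
      fst := F.preimage (e.hom ≫ biprod.fst)
      snd := F.preimage (e.hom ≫ biprod.snd)
      inl := F.preimage (biprod.inl ≫ e.inv)
      inr := F.preimage (biprod.inr ≫ e.inv)
      inl_fst := F.map_injective (by simp)
      inl_snd := F.map_injective (by simp)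
      inr_fst := F.map_injective (by simp)
      inr_snd := F.map_injective (by simp) }
  refine HasBinaryBiproduct.mk ⟨b, isBinaryBilimitOfTotal b (F.map_injective ?_)⟩
  have : e.hom ≫ (biprod.fst ≫ biprod.inl + biprod.snd ≫ biprod.inr) ≫ e.inv = 𝟙 _ := by
    rw [biprod.total, Category.id_comp, e.hom_inv_id]
  rw [Preadditive.add_comp, Preadditive.comp_add] at this
  simpa [b] using this

end EssImage

lemma essImage_ι (T : ObjectProperty 𝒯) [T.IsClosedUnderIsomorphisms] : T.ι.essImage = T := by
  ext X
  exact ⟨fun ⟨Y, ⟨e⟩⟩ => T.prop_of_iso e Y.property, fun hX => ⟨⟨X, hX⟩, ⟨Iso.refl X⟩⟩⟩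

lemma essImage_inverseImage_ι (T E : ObjectProperty 𝒯) [T.IsClosedUnderIsomorphisms]
    [E.IsClosedUnderIsomorphisms] : ((E.inverseImage T.ι).ι ⋙ T.ι).essImage = E ⊓ T := by
  ext X
  exact ⟨fun ⟨Y, ⟨e⟩⟩ => ⟨E.prop_of_iso e Y.property, T.prop_of_iso e Y.obj.property⟩,
    fun hX => ⟨⟨⟨X, hX.2⟩, hX.1⟩, ⟨Iso.refl X⟩⟩⟩

end

end NExang

end

/-! ### The structures on T and on E ∩ T. -/

theorem mainTheorem8
    {𝒯 : Type u} [Category.{v} 𝒯] [Preadditive 𝒯] [HasZeroObject 𝒯] [HasShift 𝒯 ℤ]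
    [∀ k : ℤ, (shiftFunctor 𝒯 k).Additive] [Pretriangulated 𝒯] [IsTriangulated 𝒯]
    (n : ℕ) [NeZero n]
    (T : ObjectProperty 𝒯) (hT : IsNClusterTilting n T)
    (hright : (shifted T ((n : ℤ) - 1)).rightOrthogonal ≤ (shifted T (-1)).rightOrthogonal)
    (hleft : (shifted T ((n : ℤ) - 1)).leftOrthogonal ≤ (shifted T (-1)).leftOrthogonal)
    (E : ObjectProperty 𝒯) (hE : IsTriangExtensionClosed E)
    (hstar : ∀ i : ℕ, 1 ≤ i → i < n →
      ObjectProperty.extensionProduct (shifted (E ⊓ T) (i : ℤ)) (E ⊓ T) ≤ starShifts (E ⊓ T) i) :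
    ∃ 𝔰 : Correspondence (extN T n) n,
      (∀ (A C : T.FullSubcategory) (δ : C.obj ⟶ A.obj⟦(n : ℤ)⟧) (X : NComplex n A C),
        Realizes 𝔰 X δ ↔ IsDecomposable X δ) ∧
      IsNExangulated (extN T n) 𝔰 ∧
      IsExtensionClosed 𝔰 (E.inverseImage T.ι) ∧
      ∃ 𝔱 : Correspondence (restrictExt (extN T n) (E.inverseImage T.ι)) n,
        IsInduced 𝔰 (E.inverseImage T.ι) 𝔱 ∧
        IsNExangulated (restrictExt (extN T n) (E.inverseImage T.ι)) 𝔱 := by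
  obtain ⟨r, rfl⟩ : ∃ r, n = r + 1 := ⟨n - 1, by have := NeZero.ne n; omega⟩
  have := hT.isClosedUnderIsomorphisms
  have := hE.isClosedUnderIsomorphisms
  have := hT.containsZero
  have := hE.containsZero
  have hTr := hT.isRigid hright
  have hS₀ := extensionProduct_inf_le hE.extensionProduct_le hT.extensionProduct_le
  have : (E ⊓ T).ContainsZero := by
    obtain ⟨Z, hZ, hEZ⟩ := E.exists_prop_of_containsZero
    exact ⟨Z, hZ, hEZ, T.prop_of_isZero hZ⟩
  -- With E ∩ T included through T, `restrictExt` of `extN` is by definition `extAlong F`, and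
  -- `extN` is `extAlong T.ι`; the general theorem therefore applies directly to both.
  let F := (E.inverseImage T.ι).ι ⋙ T.ι
  have e₁ : T.ι.essImage = T := essImage_ι T
  have e₂ : F.essImage = E ⊓ T := essImage_inverseImage_ι T E
  have : T.ι.essImage.ContainsZero := by rwa [e₁]
  have : F.essImage.ContainsZero := by rwa [e₂]
  have := hasZeroObject_of_essImage T.ι
  have := hasZeroObject_of_essImage F
  have := hasBinaryBiproducts_of_essImage T.ι (by rw [e₁]; exact hT.extensionProduct_le)
  have := hasBinaryBiproducts_of_essImage F (by rwa [e₂])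
  have h₁ : IsRigid (r + 1) T.ι.essImage := by rwa [e₁]
  have h₂ : IsRigid (r + 1) F.essImage := by rw [e₂]; exact hTr.mono inf_le_right
  have h₁' : ObjectProperty.extensionProduct (starShifts T.ι.essImage r)
      (starShifts T.ι.essImage r) ≤ starShifts T.ι.essImage r := by
    rw [e₁]
    -- For T the product is all of 𝒯, so closure under extensions is automatic.
    exact fun X _ => hT.starShifts_eq_top rfl X
  have h₂' : ObjectProperty.extensionProduct (starShifts F.essImage r)
      (starShifts F.essImage r) ≤ starShifts F.essImage r := by
    rw [e₂]
    exact starShifts_extensionProduct_le hS₀ hstar r (by omega)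
  obtain ⟨𝔰, h𝔰⟩ := exists_correspondence h₁ h₁'
  obtain ⟨𝔱, h𝔱⟩ := exists_correspondence h₂ h₂'
  have hind : ∀ ⦃A C : (E.inverseImage T.ι).FullSubcategory⦄
      (δ : C.obj.obj ⟶ A.obj.obj⟦((r + 1 : ℕ) : ℤ)⟧) (X : NComplex (r + 1) A C),
      IsDecomposableAlong F X δ ↔ IsDecomposableAlong T.ι (X.map (E.inverseImage T.ι).ι) δ :=
    fun A C δ X => isDecomposableAlong_comp_iff (E.inverseImage T.ι).ι T.ι X δ
  refine ⟨𝔰, fun A C δ X => (h𝔰 δ X).trans (isDecomposableAlong_ι_iff X δ),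
    isNExangulated_extAlong h₁ h₁' 𝔰 h𝔰, ?_, 𝔱,
    fun A C δ X => (h𝔱 δ X).trans ((hind δ X).trans (h𝔰 δ _).symm),
    isNExangulated_extAlong h₂ h₂' 𝔱 h𝔱⟩
  intro A C hA hC δ
  -- A realization built inside E ∩ T is also one in T, and its terms lie in E by construction.
  obtain ⟨X, hX⟩ := exists_isDecomposableAlong (F := F) h₂' (A := ⟨A, hA⟩) (C := ⟨C, hC⟩) δ
  exact ⟨X.map (E.inverseImage T.ι).ι, (h𝔰 δ _).2 ((hind _ X).1 hX),
    fun i _ _ => (X.K.X i).property⟩
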